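/- **Setting.** Let $(M,d)$ be a locally compact separable metric space with a Radon measure $\mu$ that is strictly positive on non-empty open sets and doubling: with $V(x,r)=\mu(B(x,r))$, there is a constant $C_0$ such that $V(x,2r)\le C_0V(x,r)$ for all $x\in M$, $r>0$. Let $L$ be a densely defined, non-negative, self-adjoint operator on the real space $L^2(M,\mu)$, and $(e^{-tL})_{t\ge0}$ the strongly continuous semigroup generated by $-L$. Assume that for every $t>0$ it is given by a non-negative measurable kernel $p_t$, in the sense that $(e^{-tL}f)(x)=\int_M p_t(x,y)f(y)\,d\mu(y)$ for a.e. $x$ and every $f$ in the domain of $L$; that $t\mapsto p_t(x,y)$ is smooth on $(0,1]$ for a.e. $(x,y)$; and that there is $c>0$ such that, for every integer $k\ge0$ there is a constant $C_k$ with, for all $0<t\le1$ and a.e. $(x,y)$, $$\big|\partial_t^k p_t(x,y)\big|\le \frac{C_k\,t^{-k}}{\sqrt{V(x,\sqrt t)V(y,\sqrt t)}}\exp\Big(-c\,\frac{d(x,y)^2}{t}\Big).$$ Fix $o\in M$. Let $\mathcal S_o$ be the space of all $f\in\bigcap_n \mathcal D(L^n)$ with $\|(1+d(o,\cdot))^{m}L^{n}f\|_2<\infty$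 for all $m,n\in\mathbb N$, with the topology given by these seminorms; distributions are the continuous linear functionals on $\mathcal S_o$. A bounded function $h$ defines the functional $\varphi\mapsto\int h\varphi\,d\mu$, and $\|u\|_\infty$ is the essential supremum norm of the bounded function that represents $u$ ($\|u\|_\infty=\infty$ if there is none). Functions of $L$ act on functionals by duality, $\langle Au,\varphi\rangle=\langle u,A\varphi\rangle$. For an integer $k\ge0$ and $t>0$ put $Q^{(k)}_t=(tL)^ke^{-tL}$, and for an integer $k\ge1$ put $P^{(k)}_t=\phi_k(tL)$ with $\phi_k(x)=\Gamma(k)^{-1}\int_x^\infty s^{k}e^{-s}\frac{ds}{s}$, that is, $P_t^{(k)}=\sum_{j<k}\frac1{j!}(tL)^je^{-tL}$. Fix an integer $a\ge1$. For $\sigma<2$, $\mathcal C^\sigma$ is the set of distributions $u$ with $$\|u\|_{\mathcal C^\sigma}=\|e^{-L}u\|_\infty+\sup_{0<t\le1}t^{-\sigma/2}\|Q^{(a)}_tu\|_\infty<\infty .$$ For an integer $b\ge2$ the paraproduct is $$\Pi^{(b)}_g(f)=\frac1{\Gamma(b)}\int_0^1\Big\{(tL)P^{(b)}_t\big(Q^{(b-1)}_tf\cdot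 P^{(b)}_tg\big)+Q^{(b-1)}_t\big((tL)P^{(b)}_tf\cdot P^{(b)}_tg\big)\Big\}\frac{dt}{t}.$$ It is said to be *well defined* if $Q^{(b-1)}_tf$, $(tL)P^{(b)}_tf$ and $P^{(b)}_tg$ are bounded functions for every $t\in(0,1]$, if the integral converges absolutely when paired with any $\varphi\in\mathcal S_o$, and if the result is a distribution. **Proposition.** Let $b\ge2$ be an integer and $\alpha\in(-2,1)$. 1. There is a constant $C$ such that for all $f\in\mathcal C^\alpha$ and $g\in L^\infty$ the paraproduct $\Pi^{(b)}_g(f)$ is well defined and $$\|\Pi^{(b)}_g(f)\|_{\mathcal C^\alpha}\le C\,\|g\|_\infty\,\|f\|_{\mathcal C^\alpha}.$$ 2. For every $\beta<0$ with $\alpha+\beta\in(-2,1)$ there is a constant $C$ such that for all $f\in\mathcal C^\alpha$ and $g\in\mathcal C^\beta$ the paraproduct $\Pi^{(b)}_g(f)$ is well defined and $$\|\Pi^{(b)}_g(f)\|_{\mathcal C^{\alpha+\beta}}\le C\,\|g\|_{\mathcal C^\beta}\,\|f\|_{\mathcal C^\alpha}.$$ -/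

import Mathlib

open MeasureTheory Set Filter Topology
open scoped ENNReal NNReal

namespace SemigroupPara

noncomputable section

/-! ### The ambient space, the operator `L` and its heat semigroup -/

/-- Volume doubling: `μ (B(x, 2r)) ≤ C μ (B(x, r))` for all points `x` and all radii `r > 0`. -/
def VolumeDoubling {M : Type*} [MetricSpace M] [MeasurableSpace M] (μ : Measure M) : Prop :=
  ∃ C : ℝ≥0, ∀ (x : M) (r : ℝ), 0 < r → μ (Metric.ball x (2 * r)) ≤ C * μ (Metric.ball x r)

/-- `L` is a (possibly unbounded) densely defined, non-negative, self-adjoint operator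
on the real Hilbert space `L²(M, μ)`. -/
structure IsNonnegSelfAdjoint {M : Type*} [MeasurableSpace M] {μ : Measure M}
    (L : Lp ℝ 2 μ →ₗ.[ℝ] Lp ℝ 2 μ) : Prop where
  dense_domain : Dense (L.domain : Set (Lp ℝ 2 μ))
  selfAdjoint : IsSelfAdjoint L
  nonneg : ∀ f : L.domain, 0 ≤ inner ℝ (f : Lp ℝ 2 μ) (L f)

/-- `T t = e^{-tL}` for `t ≥ 0`: `T` is the strongly continuous semigroup on `L²(M, μ)` whose
infinitesimal generator is exactly `-L` (same domain, same values). This determines `T t` for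
all `t ≥ 0`. -/
structure IsHeatSemigroup {M : Type*} [MeasurableSpace M] {μ : Measure M}
    (L : Lp ℝ 2 μ →ₗ.[ℝ] Lp ℝ 2 μ) (T : ℝ → Lp ℝ 2 μ →L[ℝ] Lp ℝ 2 μ) : Prop where
  zero : T 0 = ContinuousLinearMap.id ℝ (Lp ℝ 2 μ)
  add : ∀ s t : ℝ, 0 ≤ s → 0 ≤ t → T (s + t) = (T s).comp (T t)
  continuousOn : ∀ f : Lp ℝ 2 μ, ContinuousOn (fun t => T t f) (Ici 0)
  generator : ∀ f g : Lp ℝ 2 μ,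
    (∃ hf : f ∈ L.domain, L ⟨f, hf⟩ = g) ↔
      Tendsto (fun t : ℝ => t⁻¹ • (f - T t f)) (𝓝[>] 0) (𝓝 g)

/-- `p` is a heat kernel: non-negative, measurable, and `e^{-tL} f (x) = ∫ p_t(x,y) f(y) dμ(y)`
for a.e. `x`, all `t > 0` and all `f` in the domain of `L`. -/
structure IsHeatKernel {M : Type*} [MeasurableSpace M] {μ : Measure M}
    (L : Lp ℝ 2 μ →ₗ.[ℝ] Lp ℝ 2 μ) (T : ℝ → Lp ℝ 2 μ →L[ℝ] Lp ℝ 2 μ)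
    (p : ℝ → M → M → ℝ) : Prop where
  nonneg : ∀ t : ℝ, 0 < t → ∀ x y : M, 0 ≤ p t x y
  measurable : ∀ t : ℝ, 0 < t → Measurable (Function.uncurry (p t))
  repr : ∀ t : ℝ, 0 < t → ∀ f : Lp ℝ 2 μ, f ∈ L.domain →
    ⇑(T t f) =ᵐ[μ] fun x => ∫ y, p t x y * f y ∂μ

/-- The Gaussian upper estimates for the heat kernel and all its time derivatives, for the
times `0 < t ≤ 1` only:
`|∂_t^a p_t(x,y)| ≤ C_a t^{-a} (V(x,√t) V(y,√t))^{-1/2} exp (-c d(x,y)² / t)`. -/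
structure GaussianUpperBound {M : Type*} [MetricSpace M] [MeasurableSpace M] (μ : Measure M)
    (p : ℝ → M → M → ℝ) : Prop where
  smooth : ∀ᵐ z ∂(μ.prod μ), ContDiffOn ℝ ((⊤ : ℕ∞) : WithTop ℕ∞) (fun t => p t z.1 z.2) (Ioc 0 1)
  bound : ∃ c : ℝ, 0 < c ∧ ∀ a : ℕ, ∃ C : ℝ, ∀ t ∈ Ioc (0 : ℝ) 1, ∀ᵐ z ∂(μ.prod μ),
    |iteratedDerivWithin a (fun s => p s z.1 z.2) (Ioc 0 1) t| ≤
      C * (t ^ a)⁻¹ *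
        (√(μ.real (Metric.ball z.1 (√t)) * μ.real (Metric.ball z.2 (√t))))⁻¹ *
        Real.exp (-c * dist z.1 z.2 ^ 2 / t)

/-! ### Powers of `L`, test functions and distributions -/

section Operators

variable {M : Type*} [MeasurableSpace M] {μ : Measure M}

open scoped Classical in
/-- `L` as a total function on `L²`, equal to `0` outside its domain. -/
def applyL (L : Lp ℝ 2 μ →ₗ.[ℝ] Lp ℝ 2 μ) (f : Lp ℝ 2 μ) : Lp ℝ 2 μ :=
  if h : f ∈ L.domain then L ⟨f, h⟩ else 0

/-- `powL L n f = Lⁿ f`, for `f` in the domain of `Lⁿ`. -/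
def powL (L : Lp ℝ 2 μ →ₗ.[ℝ] Lp ℝ 2 μ) (n : ℕ) (f : Lp ℝ 2 μ) : Lp ℝ 2 μ :=
  (applyL L)^[n] f

variable (L : Lp ℝ 2 μ →ₗ.[ℝ] Lp ℝ 2 μ)

theorem applyL_of_mem {f : Lp ℝ 2 μ} (h : f ∈ L.domain) : applyL L f = L ⟨f, h⟩ := dif_pos h

theorem powL_succ (n : ℕ) (f : Lp ℝ 2 μ) : powL L (n + 1) f = applyL L (powL L n f) :=
  Function.iterate_succ_apply' _ _ _

theorem powL_zero_vec (n : ℕ) : powL L n 0 = 0 := by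
  induction n with
  | zero => rfl
  | succ n ih =>
    rw [powL_succ, ih, applyL_of_mem L L.domain.zero_mem]
    exact L.map_zero

theorem powL_add (n : ℕ) {f g : Lp ℝ 2 μ} (hf : ∀ k, powL L k f ∈ L.domain)
    (hg : ∀ k, powL L k g ∈ L.domain) : powL L n (f + g) = powL L n f + powL L n g := by
  induction n with
  | zero => rfl
  | succ n ih =>
    rw [powL_succ, powL_succ, powL_succ, ih, applyL_of_mem L (hf n), applyL_of_mem L (hg n),
      applyL_of_mem L (L.domain.add_mem (hf n) (hg n)), ← L.map_add]
    rfl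

theorem powL_smul (n : ℕ) (r : ℝ) {f : Lp ℝ 2 μ} (hf : ∀ k, powL L k f ∈ L.domain) :
    powL L n (r • f) = r • powL L n f := by
  induction n with
  | zero => rfl
  | succ n ih =>
    rw [powL_succ, powL_succ, ih, applyL_of_mem L (hf n),
      applyL_of_mem L (L.domain.smul_mem r (hf n)), ← L.map_smul]
    rfl

/-- `Q_t^{(a)} = (tL)^a e^{-tL}`, as a map on `L²`. -/
def opQ (T : ℝ → Lp ℝ 2 μ →L[ℝ] Lp ℝ 2 μ) (a : ℕ) (t : ℝ) (f : Lp ℝ 2 μ) : Lp ℝ 2 μ :=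
  t ^ a • powL L a (T t f)

/-- The function `φ_a(x) = γ_a⁻¹ ∫_x^∞ s^a e^{-s} ds/s`, with `γ_a = Γ(a)`. -/
def phi (a : ℕ) (x : ℝ) : ℝ :=
  (Real.Gamma a)⁻¹ * ∫ s in Ioi x, s ^ a * Real.exp (-s) / s

theorem hasDerivAt_expSum (n : ℕ) (s : ℝ) :
    HasDerivAt (fun s : ℝ => ∑ k ∈ Finset.range (n + 1), (k.factorial : ℝ)⁻¹ * s ^ k)
      (∑ k ∈ Finset.range n, (k.factorial : ℝ)⁻¹ * s ^ k) s := by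
  induction n with
  | zero => simpa using hasDerivAt_const s (1 : ℝ)
  | succ n ih =>
    have h := ih.add ((hasDerivAt_pow (n + 1) s).const_mul ((n + 1).factorial : ℝ)⁻¹)
    have e : (fun s : ℝ => ∑ k ∈ Finset.range (n + 1 + 1), (k.factorial : ℝ)⁻¹ * s ^ k) =
        (fun s : ℝ => ∑ k ∈ Finset.range (n + 1), (k.factorial : ℝ)⁻¹ * s ^ k) +
          fun s : ℝ => ((n + 1).factorial : ℝ)⁻¹ * s ^ (n + 1) := by
      funext y
      exact Finset.sum_range_succ _ _
    rw [e, Finset.sum_range_succ]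
    refine h.congr_deriv ?_
    congr 1
    have : (n.factorial : ℝ) ≠ 0 := by positivity
    rw [Nat.factorial_succ]
    push_cast
    field_simp

/-- `φ_a(x) = (∑_{k < a} x^k / k!) e^{-x}`. -/
theorem phi_eq (a : ℕ) (ha : 1 ≤ a) (x : ℝ) (hx : 0 ≤ x) :
    phi a x = (∑ k ∈ Finset.range a, (k.factorial : ℝ)⁻¹ * x ^ k) * Real.exp (-x) := by
  obtain ⟨n, rfl⟩ : ∃ n, a = n + 1 := ⟨a - 1, by omega⟩
  have hfac : (n.factorial : ℝ) ≠ 0 := by positivity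
  have hd : ∀ s : ℝ, HasDerivAt (fun s : ℝ =>
      -((∑ k ∈ Finset.range (n + 1), (k.factorial : ℝ)⁻¹ * s ^ k) * Real.exp (-s)))
      ((n.factorial : ℝ)⁻¹ * s ^ n * Real.exp (-s)) s := by
    intro s
    have h := ((hasDerivAt_expSum n s).mul (Real.hasDerivAt_exp (-s) |>.comp s (hasDerivAt_neg s))).neg
    refine HasDerivAt.congr_deriv h ?_
    rw [Finset.sum_range_succ]
    simp only [Function.comp]
    ring
  have hlim : Tendsto (fun s : ℝ =>
      -((∑ k ∈ Finset.range (n + 1), (k.factorial : ℝ)⁻¹ * s ^ k) * Real.exp (-s)))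
      atTop (𝓝 0) := by
    have h : Tendsto (fun s : ℝ => ∑ k ∈ Finset.range (n + 1),
        (k.factorial : ℝ)⁻¹ * (s ^ k * Real.exp (-s))) atTop
        (𝓝 (∑ k ∈ Finset.range (n + 1), (k.factorial : ℝ)⁻¹ * 0)) :=
      tendsto_finsetSum _ fun k _ =>
        (Real.tendsto_pow_mul_exp_neg_atTop_nhds_zero k).const_mul _
    have h2 := h.neg
    simp only [mul_zero, Finset.sum_const_zero, neg_zero] at h2
    refine h2.congr fun s => ?_
    rw [Finset.sum_mul]
    simp only [mul_assoc]
  have hint := integral_Ioi_of_hasDerivAt_of_nonneg' (a := x) (fun s _ => hd s)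
    (fun s hs => by have : 0 ≤ s := hx.trans (le_of_lt hs); positivity) hlim
  unfold phi
  rw [Nat.cast_add, Nat.cast_one, Real.Gamma_nat_eq_factorial, ← integral_const_mul]
  rw [zero_sub, neg_neg] at hint
  rw [← hint]
  refine setIntegral_congr_fun measurableSet_Ioi fun s hs => ?_
  have hs0 : s ≠ 0 := (hx.trans_lt hs).ne'
  field_simp
  ring

/-- `P_t^{(a)} = φ_a(tL)`. By `phi_eq`, `φ_a(λ) = ∑_{k < a} λ^k e^{-λ} / k!` on the half-line
containing the spectrum, so `φ_a(tL) = ∑_{k < a} (tL)^k e^{-tL} / k!`. -/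
def opP (T : ℝ → Lp ℝ 2 μ →L[ℝ] Lp ℝ 2 μ) (a : ℕ) (t : ℝ) (f : Lp ℝ 2 μ) : Lp ℝ 2 μ :=
  ∑ k ∈ Finset.range a, (k.factorial : ℝ)⁻¹ • opQ L T k t f

/-- `(tL) P_t^{(a)}`. -/
def opLP (T : ℝ → Lp ℝ 2 μ →L[ℝ] Lp ℝ 2 μ) (a : ℕ) (t : ℝ) (f : Lp ℝ 2 μ) : Lp ℝ 2 μ :=
  t • applyL L (opP L T a t f)

end Operators

section Distributions

variable {M : Type*} [MetricSpace M] [MeasurableSpace M] {μ : Measure M}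

/-- The test functions, as a subspace of `L²`: those `f` which lie in the domain of every power
of `L` and satisfy `‖(1 + d(o,·))^m Lⁿ f‖₂ < ∞` for all `m` and `n`. -/
def testSubmodule (L : Lp ℝ 2 μ →ₗ.[ℝ] Lp ℝ 2 μ) (o : M) : Submodule ℝ (Lp ℝ 2 μ) where
  carrier := {f | ∀ n : ℕ, powL L n f ∈ L.domain ∧
    ∀ m : ℕ, MemLp (fun x => (1 + dist o x) ^ m * powL L n f x) 2 μ}
  zero_mem' := by
    intro n
    rw [powL_zero_vec]
    refine ⟨L.domain.zero_mem, fun m => ?_⟩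
    refine (memLp_congr_ae ?_).mpr (MemLp.zero (ε := ℝ) (p := 2) (μ := μ))
    filter_upwards [Lp.coeFn_zero ℝ 2 μ] with x hx
    rw [hx]
    simp
  add_mem' := by
    intro f g hf hg n
    rw [powL_add L n (fun k => (hf k).1) (fun k => (hg k).1)]
    refine ⟨L.domain.add_mem (hf n).1 (hg n).1, fun m => ?_⟩
    refine (memLp_congr_ae ?_).mpr (((hf n).2 m).add ((hg n).2 m))
    filter_upwards [Lp.coeFn_add (powL L n f) (powL L n g)] with x hx
    rw [hx]
    simp [mul_add]
  smul_mem' := by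
    intro r f hf n
    rw [powL_smul L n r (fun k => (hf k).1)]
    refine ⟨L.domain.smul_mem r (hf n).1, fun m => ?_⟩
    refine (memLp_congr_ae ?_).mpr (((hf n).2 m).const_smul r)
    filter_upwards [Lp.coeFn_smul r (powL L n f)] with x hx
    rw [hx]
    simp
    ring

/-- The space `𝒮_o` of test functions; it carries the Fréchet topology given below, not the
topology of `L²`. -/
def TestFun (L : Lp ℝ 2 μ →ₗ.[ℝ] Lp ℝ 2 μ) (o : M) : Type _ := ↥(testSubmodule L o)

variable {L : Lp ℝ 2 μ →ₗ.[ℝ] Lp ℝ 2 μ} {o : M}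

instance : AddCommGroup (TestFun L o) := inferInstanceAs (AddCommGroup (testSubmodule L o))

instance : Module ℝ (TestFun L o) := inferInstanceAs (Module ℝ (testSubmodule L o))

/-- The class in `L²` of a test function. -/
def TestFun.toL2 (φ : TestFun L o) : Lp ℝ 2 μ := Subtype.val (p := (· ∈ testSubmodule L o)) φ

theorem TestFun.mem (φ : TestFun L o) : φ.toL2 ∈ testSubmodule L o :=
  Subtype.prop (p := (· ∈ testSubmodule L o)) φ

variable (L o) in
/-- The linear map `φ ↦ (1 + d(o,·))^m Lⁿ φ` from test functions to `L²`. -/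
def weightedPow (m n : ℕ) : TestFun L o →ₗ[ℝ] Lp ℝ 2 μ where
  toFun φ := ((φ.mem n).2 m).toLp
  map_add' φ ψ := by
    rw [← MemLp.toLp_add, MemLp.toLp_eq_toLp_iff]
    have h : powL L n (φ + ψ).toL2 = powL L n φ.toL2 + powL L n ψ.toL2 :=
      powL_add L n (fun k => (φ.mem k).1) (fun k => (ψ.mem k).1)
    rw [h]
    filter_upwards [Lp.coeFn_add (powL L n φ.toL2) (powL L n ψ.toL2)] with x hx
    rw [hx]
    simp [mul_add]
  map_smul' r φ := by
    rw [RingHom.id_apply, ← MemLp.toLp_const_smul, MemLp.toLp_eq_toLp_iff]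
    have h : powL L n (r • φ).toL2 = r • powL L n φ.toL2 :=
      powL_smul L n r (fun k => (φ.mem k).1)
    rw [h]
    filter_upwards [Lp.coeFn_smul r (powL L n φ.toL2)] with x hx
    rw [hx]
    simp
    ring

variable (L o) in
/-- The seminorms `‖(1 + d(o,·))^m Lⁿ φ‖₂` on the test functions. -/
def testSeminorm : SeminormFamily ℝ (TestFun L o) (ℕ × ℕ) :=
  fun i => (normSeminorm ℝ (Lp ℝ 2 μ)).comp (weightedPow L o i.1 i.2)

/-- The topology of `𝒮_o`, generated by the seminorms `‖(1 + d(o,·))^m Lⁿ φ‖₂`. -/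
instance : TopologicalSpace (TestFun L o) := (testSeminorm L o).moduleFilterBasis.topology

variable (L o) in
/-- Distributions: continuous linear functionals on the space of test functions. -/
abbrev Distribution : Type _ := TestFun L o →L[ℝ] ℝ

/-! ### Action of operators on functionals, Hölder spaces -/

open scoped Classical in
/-- The image of a test function under a map `A` of `L²` (the value `0` when it is not a test
function does not occur for the operators used below, which preserve test functions). -/
def mapTest (A : Lp ℝ 2 μ → Lp ℝ 2 μ) (φ : TestFun L o) : TestFun L o :=
  if h : A φ.toL2 ∈ testSubmodule L o then (⟨A φ.toL2, h⟩ : testSubmodule L o) else (0 : TestFun L o)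

/-- Action by duality of a symmetric operator `A` on a functional: `⟨A u, φ⟩ = ⟨u, A φ⟩`. -/
def act (A : Lp ℝ 2 μ → Lp ℝ 2 μ) (u : TestFun L o → ℝ) : TestFun L o → ℝ :=
  fun φ => u (mapTest A φ)

/-- The functional `φ ↦ ∫ h φ dμ` attached to a bounded function `h`. -/
def ofLinfty (h : Lp ℝ ∞ μ) : TestFun L o → ℝ :=
  fun φ => ∫ x, h x * φ.toL2 x ∂μ

/-- `‖u‖_∞`: the functional `u` is identified with the bounded function `h` such that
`u φ = ∫ h φ dμ` for all test functions `φ`; the value is `∞` if there is no such `h`. -/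
def linftyNorm (u : TestFun L o → ℝ) : ℝ≥0∞ :=
  ⨅ (h : Lp ℝ ∞ μ) (_ : u = ofLinfty h), ‖h‖ₑ

/-- The Hölder norm `‖u‖_{𝒞^σ} = ‖e^{-L} u‖_∞ + sup_{0 < t ≤ 1} t^{-σ/2} ‖Q_t^{(a)} u‖_∞`.
A distribution `u` belongs to `𝒞^σ` when this is finite. -/
def holderNorm (T : ℝ → Lp ℝ 2 μ →L[ℝ] Lp ℝ 2 μ) (a : ℕ) (σ : ℝ) (u : TestFun L o → ℝ) : ℝ≥0∞ :=
  linftyNorm (act (T 1) u) +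
    ⨆ t ∈ Ioc (0 : ℝ) 1, linftyNorm (act (opQ L T a t) u) * ENNReal.ofReal (t ^ (-σ / 2))

/-! ### The paraproduct -/

/-- `Π = Π_g^{(b)}(f)`, i.e.
`Π = γ_b⁻¹ ∫_0^1 { (tL)P_t (Q_t^{(b-1)} f ⬝ P_t g) + Q_t^{(b-1)} ((tL)P_t f ⬝ P_t g) } dt/t`
with `P_t = P_t^{(b)}` and `γ_b = Γ(b)`. This says that for every `t ∈ (0,1]` the distributions
`Q_t^{(b-1)} f`, `(tL)P_t f` and `P_t g` are bounded functions `qf t`, `lf t` and `pg t` (so that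
the products make sense), and that the integral over `t` converges absolutely against every test
function, with value `Π`. -/
def HasParaproduct (T : ℝ → Lp ℝ 2 μ →L[ℝ] Lp ℝ 2 μ) (b : ℕ) (g f : TestFun L o → ℝ)
    (Pi : Distribution L o) : Prop :=
  ∃ qf lf pg : ℝ → Lp ℝ ∞ μ,
    (∀ t ∈ Ioc (0 : ℝ) 1,
      act (opQ L T (b - 1) t) f = ofLinfty (qf t) ∧
      act (opLP L T b t) f = ofLinfty (lf t) ∧
      act (opP L T b t) g = ofLinfty (pg t)) ∧
    ∀ φ : TestFun L o,
      IntegrableOn (fun t : ℝ =>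
        ((∫ x, (qf t x * pg t x) * opLP L T b t φ.toL2 x ∂μ) +
          ∫ x, (lf t x * pg t x) * opQ L T (b - 1) t φ.toL2 x ∂μ) / t) (Ioc 0 1) ∧
      Pi φ = (Real.Gamma b)⁻¹ * ∫ t in Ioc (0 : ℝ) 1,
        ((∫ x, (qf t x * pg t x) * opLP L T b t φ.toL2 x ∂μ) +
          ∫ x, (lf t x * pg t x) * opQ L T (b - 1) t φ.toL2 x ∂μ) / t

end Distributions

end

end SemigroupPara

namespace SemigroupPara

noncomputable section

set_option linter.unusedSectionVars false

/-! ### Doubling measures and Gaussian kernels -/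

/-! All sup norms are estimated by duality. A linear functional `u` on test functions is a bounded
function of norm at most `K` exactly when `|u φ| ≤ K ‖φ‖₁` for every test function `φ`. So it
suffices to know how `Q_t^{(k)}` acts on `L¹`. Doubling makes Gaussian kernels uniformly integrable
in either variable, and the Schur test then bounds `e^{-tL}` on `L¹` and on weighted `L²`. The
estimate of `∂_t p_t` gives Lipschitz increments in time, hence the smoothing of `e^{-tL}` and the
bound for `tL e^{-tL}`; higher powers follow by composing semigroup factors. No spectral calculus is
needed (`heatSetting`).

If `f` has Hölder norm `N` of order `σ`, then `|f(Q_t^{(k)} φ)| ≤ C N t^{σ/2} ‖φ‖₁` for every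
integer `k > σ/2` (`exists_decay`). Orders `k ≥ a` come from composition; lower ones come from
integrating the derivative of `t^{-k} Q_t^{(k)}`, which is `-t^{-k-1} Q_t^{(k+1)}`, from `t` up to
time `2`, where `e^{-L}` controls the value. As `α < 1`, this covers all orders `k ≥ 1` for `f`, the
only ones occurring in `Q_t^{(b-1)} f` and `(tL)P_t f`. For `β < 0` it also covers `k = 0`, which
`P_t g` needs; for bounded `g` the bound with `β = 0` is the `L¹` bound of `Q_t^{(k)}`. Hence both
products in the integrand have sup norm at most `K t^{γ/2}` with `γ = α + β`.

On the test side each operator is a combination of `Q_t^{(k)}` with `k ≥ 1`. Against a fixed `φ`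
this gains a factor `t`, so the integral converges for `γ > -2`. Against `Q_s^{(a)} φ` the identity
`Q_t^{(k)} Q_s^{(a)} = t^k s^a (t+s)^{-k-a} Q_{t+s}^{(k+a)}` gains `min(t/s, s/t)`, and `∫₀¹ t^{γ/2}
min(t/s, s/t) dt/t ≤ C s^{γ/2}` is the Hölder bound (`exists_integral`). -/

/-- Quantitative form of the standing assumptions on the measure. -/
structure IsDoublingWith {M : Type*} [MetricSpace M] [MeasurableSpace M] (μ : Measure M)
    (D : ℝ≥0) : Prop where
  one_le : 1 ≤ D
  doubling : ∀ (x : M) (r : ℝ), 0 < r → μ (Metric.ball x (2 * r)) ≤ D * μ (Metric.ball x r)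
  finite : ∀ (x : M) (r : ℝ), μ (Metric.ball x r) < ∞
  pos : ∀ (x : M) (r : ℝ), 0 < r → 0 < μ (Metric.ball x r)

/-- Local finiteness gives one ball of finite measure around each point; doubling spreads finiteness
to all radii. -/
theorem VolumeDoubling.exists_isDoublingWith {M : Type*} [MetricSpace M] [MeasurableSpace M]
    [BorelSpace M] {μ : Measure M} [IsLocallyFiniteMeasure μ] [μ.IsOpenPosMeasure]
    (hμ : VolumeDoubling μ) : ∃ D : ℝ≥0, IsDoublingWith μ D := by
  obtain ⟨C, hC⟩ := hμ
  refine ⟨max 1 C, le_max_left _ _, fun x r hr => (hC x r hr).trans ?_, fun x r => ?_,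
    fun x r hr => Metric.measure_ball_pos μ x hr⟩
  · gcongr
    exact le_max_right _ _
  · obtain ⟨s, hs, hfin⟩ := μ.exists_isOpen_measure_lt_top x
    obtain ⟨ε, hε, hball⟩ := Metric.isOpen_iff.1 hfin.1 x hs
    have hpow : ∀ n : ℕ, μ (Metric.ball x (2 ^ n * ε)) < ∞ := by
      intro n
      induction n with
      | zero => simpa using (measure_mono hball).trans_lt hfin.2
      | succ n ih =>
        have h := hC x (2 ^ n * ε) (by positivity)
        rw [← mul_assoc, ← pow_succ'] at h
        exact h.trans_lt (ENNReal.mul_lt_top (by simp) ih)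
    obtain ⟨n, hn⟩ := pow_unbounded_of_one_lt (r / ε) (one_lt_two (α := ℝ))
    refine (measure_mono (Metric.ball_subset_ball ?_)).trans_lt (hpow n)
    exact ((div_lt_iff₀ hε).1 hn).le

/-- Selects the dyadic shell of a point. The `+ 1` accommodates `n = 0`, where `ρ` has no lower
bound. -/
theorem exists_lt_two_pow (ρ : ℝ) (hρ : 0 ≤ ρ) : ∃ n : ℕ, ρ < 2 ^ n ∧ (2 : ℝ) ^ n ≤ 2 * ρ + 1 := by
  have hex : ∃ n : ℕ, ρ < 2 ^ n := pow_unbounded_of_one_lt ρ (by norm_num)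
  classical
  refine ⟨Nat.find hex, Nat.find_spec hex, ?_⟩
  rcases Nat.eq_zero_or_pos (Nat.find hex) with h | h
  · rw [h]; simp; exact hρ
  · have := Nat.find_min hex (Nat.sub_lt h one_pos)
    push Not at this
    obtain ⟨k, hk⟩ : ∃ k, Nat.find hex = k + 1 := ⟨Nat.find hex - 1, by omega⟩
    rw [hk] at this ⊢
    rw [pow_succ]
    simp at this
    linarith

/-- The factor `exp(-κ 4^n)` is at most a constant times `4^{-nN}` for any `N`; choosing `4^N > R`
leaves a geometric series. -/
theorem summable_pow_mul_exp_neg (R κ : ℝ) (hR : 0 ≤ R) (hκ : 0 < κ) :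
    Summable fun n : ℕ => R ^ n * Real.exp (-(κ * 4 ^ n)) := by
  obtain ⟨N, hN⟩ : ∃ N : ℕ, R < 4 ^ N := pow_unbounded_of_one_lt R (by norm_num)
  have hgeo : Summable fun n : ℕ => (N.factorial : ℝ) * (κ ^ N)⁻¹ * (R / 4 ^ N) ^ n :=
    (summable_geometric_of_lt_one (by positivity) (by
      rw [div_lt_one (by positivity)]; exact hN)).mul_left _
  refine Summable.of_nonneg_of_le (fun n => by positivity) (fun n => ?_) hgeo
  have h := Real.pow_div_factorial_le_exp (κ * 4 ^ n) (by positivity) N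
  have h1 : Real.exp (-(κ * 4 ^ n)) ≤ (N.factorial : ℝ) * ((κ * 4 ^ n) ^ N)⁻¹ := by
    rw [Real.exp_neg, ← inv_inv (N.factorial : ℝ), ← mul_inv]
    apply inv_anti₀ (by positivity)
    rw [mul_comm]; exact h
  calc R ^ n * Real.exp (-(κ * 4 ^ n)) ≤ R ^ n * ((N.factorial : ℝ) * ((κ * 4 ^ n) ^ N)⁻¹) := by
        gcongr
    _ = _ := by
        rw [mul_pow, div_pow, ← pow_mul, ← pow_mul, mul_comm n N]
        field_simp

section

variable {M : Type*} [MetricSpace M] [MeasurableSpace M] [BorelSpace M] {μ : Measure M} {D : ℝ≥0}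

theorem IsDoublingWith.pow (hD : IsDoublingWith μ D) (x : M) {r : ℝ} (hr : 0 < r) (n : ℕ) :
    μ (Metric.ball x (2 ^ n * r)) ≤ (D : ℝ≥0∞) ^ n * μ (Metric.ball x r) := by
  induction n with
  | zero => simp
  | succ n ih =>
    calc μ (Metric.ball x (2 ^ (n + 1) * r)) = μ (Metric.ball x (2 * (2 ^ n * r))) := by
          rw [pow_succ]; ring_nf
      _ ≤ D * μ (Metric.ball x (2 ^ n * r)) := hD.doubling _ _ (by positivity)
      _ ≤ D * ((D : ℝ≥0∞) ^ n * μ (Metric.ball x r)) := by gcongr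
      _ = _ := by rw [pow_succ]; ring

/-- `F` lies below the sum of the constants `b n` on the dyadic balls. Full balls serve as well as
shells, since overcounting only enlarges the sum. -/
theorem IsDoublingWith.lintegral_le_tsum (hD : IsDoublingWith μ D) (x : M) {r : ℝ} (hr : 0 < r)
    (F : M → ℝ≥0∞) (b : ℕ → ℝ≥0∞)
    (h : ∀ y, ∃ n : ℕ, dist y x < 2 ^ n * r ∧ F y ≤ b n) :
    ∫⁻ y, F y ∂μ ≤ ∑' n, b n * ((D : ℝ≥0∞) ^ n * μ (Metric.ball x r)) := by
  calc ∫⁻ y, F y ∂μ ≤ ∫⁻ y, ∑' n, (Metric.ball x (2 ^ n * r)).indicator (fun _ => b n) y ∂μ := by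
        refine lintegral_mono fun y => ?_
        obtain ⟨n, hn, hF⟩ := h y
        refine hF.trans (le_trans ?_ (ENNReal.le_tsum n))
        rw [indicator_of_mem (Metric.mem_ball.2 hn)]
    _ = ∑' n, ∫⁻ y, (Metric.ball x (2 ^ n * r)).indicator (fun _ => b n) y ∂μ :=
        lintegral_tsum fun n => (measurable_const.indicator Metric.isOpen_ball.measurableSet).aemeasurable
    _ ≤ _ := by
        refine ENNReal.tsum_le_tsum fun n => ?_
        rw [lintegral_indicator_const Metric.isOpen_ball.measurableSet]
        gcongr
        exact hD.pow x hr n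

theorem IsDoublingWith.real_pos (hD : IsDoublingWith μ D) (x : M) {r : ℝ} (hr : 0 < r) :
    0 < μ.real (Metric.ball x r) :=
  ENNReal.toReal_pos (hD.pos x r hr).ne' (hD.finite x r).ne

theorem IsDoublingWith.real_le (hD : IsDoublingWith μ D) (x y : M) {r : ℝ} (hr : 0 < r) (n : ℕ)
    (h : dist y x < 2 ^ n * r) :
    μ.real (Metric.ball x r) ≤ D ^ (n + 1) * μ.real (Metric.ball y r) := by
  have h1 : μ (Metric.ball x r) ≤ (D : ℝ≥0∞) ^ (n + 1) * μ (Metric.ball y r) := by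
    refine le_trans (measure_mono ?_) (hD.pow y hr (n + 1))
    refine Metric.ball_subset_ball' ?_
    rw [dist_comm, pow_succ]
    have : (1 : ℝ) ≤ 2 ^ n := one_le_pow₀ (by norm_num)
    nlinarith
  have h2 := ENNReal.toReal_mono (by
    exact ENNReal.mul_ne_top (by simp) (hD.finite y r).ne) h1
  simpa [ENNReal.toReal_mul, Measure.real] using h2

/-- Gaussian kernels with a polynomial weight. -/
def gaussKernel (μ : Measure M) (c : ℝ) (m : ℕ) (t : ℝ) (x y : M) : ℝ :=
  (1 + dist x y) ^ m * (√(μ.real (Metric.ball x (√t)) * μ.real (Metric.ball y (√t))))⁻¹ *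
    Real.exp (-c * dist x y ^ 2 / t)

theorem gaussKernel_nonneg (c : ℝ) (m : ℕ) (t : ℝ) (x y : M) : 0 ≤ gaussKernel μ c m t x y := by
  unfold gaussKernel; positivity

theorem gaussKernel_comm (c : ℝ) (m : ℕ) (t : ℝ) (x y : M) :
    gaussKernel μ c m t x y = gaussKernel μ c m t y x := by
  unfold gaussKernel; rw [dist_comm, mul_comm (μ.real _)]

theorem measurable_gaussKernel [SecondCountableTopology M] [SFinite μ] (c : ℝ) (m : ℕ) (t : ℝ) :
    Measurable (Function.uncurry (gaussKernel μ c m t)) := by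
  have hb : Measurable fun x : M => μ.real (Metric.ball x (√t)) := by
    have hs : MeasurableSet {z : M × M | dist z.2 z.1 < √t} :=
      measurableSet_lt (by fun_prop) measurable_const
    exact (measurable_measure_prodMk_left hs).ennreal_toReal
  have h1 : Measurable fun z : M × M => μ.real (Metric.ball z.1 (√t)) := hb.comp measurable_fst
  have h2 : Measurable fun z : M × M => μ.real (Metric.ball z.2 (√t)) := hb.comp measurable_snd
  unfold gaussKernel Function.uncurry
  have hd : Measurable fun z : M × M => dist z.1 z.2 := by fun_prop
  exact (((measurable_const.add hd).pow_const m).mul (h1.mul h2).sqrt.inv).mul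
    (((hd.pow_const 2).const_mul (-c)).div_const t).exp

/-- At distance about `2^n √t`, the weight costs a power of `2^n` (as `√t ≤ 1`), and doubling costs
powers of `D^n` for comparing volumes and for the ball measure. The Gaussian factor `exp(-c 4^n /
16)` absorbs all of them, uniformly in `t` and `x`. -/
theorem IsDoublingWith.exists_lintegral_gaussKernel_le (hD : IsDoublingWith μ D) {c : ℝ}
    (hc : 0 < c) (m : ℕ) :
    ∃ S : ℝ≥0, ∀ t ∈ Ioc (0 : ℝ) 1, ∀ x : M,
      ∫⁻ y, ENNReal.ofReal (gaussKernel μ c m t x y) ∂μ ≤ S := by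
  set B : ℕ → ℝ := fun n =>
    (D : ℝ) ^ (n + 1) * 2 ^ ((n + 1) * m) * (Real.exp (c / 16) * Real.exp (-(c / 16 * 4 ^ n)))
    with hB
  have hsum : Summable fun n => B n * (D : ℝ) ^ n := by
    have h := (summable_pow_mul_exp_neg ((D : ℝ) ^ 2 * 2 ^ m) (c / 16) (by positivity)
      (by positivity)).mul_left ((D : ℝ) * 2 ^ m * Real.exp (c / 16))
    refine h.congr fun n => ?_
    simp only [hB, mul_pow, ← pow_mul]
    ring
  refine ⟨(∑' n, B n * (D : ℝ) ^ n).toNNReal, fun t ht x => ?_⟩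
  have hr : 0 < √t := Real.sqrt_pos.2 ht.1
  have hr1 : √t ≤ 1 := Real.sqrt_le_one.2 ht.2
  have hVx := hD.real_pos x hr
  refine (hD.lintegral_le_tsum x hr _ (fun n => ENNReal.ofReal ((μ.real (Metric.ball x (√t)))⁻¹ *
    B n)) fun y => ?_).trans ?_
  · obtain ⟨n, hn, hn'⟩ := exists_lt_two_pow (dist y x / √t) (by positivity)
    have hlt : dist y x < 2 ^ n * √t := (div_lt_iff₀ hr).1 hn
    refine ⟨n, hlt, ENNReal.ofReal_le_ofReal ?_⟩
    have hVy := hD.real_pos y hr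
    have hV := hD.real_le x y hr n hlt
    have e1 : (1 + dist x y) ^ m ≤ (2 : ℝ) ^ ((n + 1) * m) := by
      rw [pow_mul]
      refine pow_le_pow_left₀ (by positivity) ?_ m
      have h2n : (1 : ℝ) ≤ 2 ^ n := one_le_pow₀ (by norm_num)
      rw [dist_comm, pow_succ]
      have : (2 : ℝ) ^ n * √t ≤ 2 ^ n * 1 := by gcongr
      linarith
    have e2 : (√(μ.real (Metric.ball x (√t)) * μ.real (Metric.ball y (√t))))⁻¹ ≤
        (μ.real (Metric.ball x (√t)))⁻¹ * (D : ℝ) ^ (n + 1) := by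
      have hD1 : (1 : ℝ) ≤ (D : ℝ) ^ (n + 1) := one_le_pow₀ (by exact_mod_cast hD.one_le)
      rw [inv_le_comm₀ (by positivity) (by positivity), mul_inv, inv_inv]
      refine Real.le_sqrt_of_sq_le ?_
      rw [mul_pow, sq, mul_assoc]
      refine mul_le_mul_of_nonneg_left ?_ hVx.le
      rw [sq, ← div_eq_mul_inv, ← mul_div_assoc, ← div_eq_mul_inv, div_div, div_le_iff₀ (by positivity)]
      calc _ ≤ _ := hV
        _ ≤ _ := by nlinarith [mul_le_mul_of_nonneg_left hD1 (mul_pos (by positivity : (0:ℝ) < (D : ℝ) ^ (n + 1)) hVy).le]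
    have e3 : Real.exp (-c * dist x y ^ 2 / t) ≤
        Real.exp (c / 16) * Real.exp (-(c / 16 * 4 ^ n)) := by
      rw [← Real.exp_add, Real.exp_le_exp]
      have h1 : -c * dist x y ^ 2 / t = -c * (dist y x / √t) ^ 2 := by
        rw [div_pow, Real.sq_sqrt ht.1.le, dist_comm]; ring
      have h2 : (1 : ℝ) ≤ 2 ^ n := one_le_pow₀ (by norm_num)
      have h3 : ((4 : ℝ) ^ n) = (2 ^ n) ^ 2 := by rw [← pow_mul, mul_comm, pow_mul]; norm_num
      rw [h1, h3]
      set ρ := dist y x / √t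
      -- For `n ≥ 1`, `2^n ≤ 2ρ + 1` forces `2^n ≤ 4ρ`, whence the `16`. The `-1` handles `n = 0`
      -- and is paid by the factor `exp(c/16)`.
      have : ((2 : ℝ) ^ n) ^ 2 - 1 ≤ 16 * ρ ^ 2 := by
        rcases n with _ | n
        · simp; positivity
        · have h5 : (2 : ℝ) ≤ 2 ^ (n + 1) := by
            rw [pow_succ]; nlinarith [one_le_pow₀ (n := n) (by norm_num : (1 : ℝ) ≤ 2)]
          have : (2 : ℝ) ^ (n + 1) ≤ 4 * ρ := by linarith
          nlinarith
      nlinarith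
    calc gaussKernel μ c m t x y ≤ (2 : ℝ) ^ ((n + 1) * m) *
          ((μ.real (Metric.ball x (√t)))⁻¹ * (D : ℝ) ^ (n + 1)) *
          (Real.exp (c / 16) * Real.exp (-(c / 16 * 4 ^ n))) := by
            unfold gaussKernel; gcongr
      _ = _ := by simp only [hB]; ring
  · have hle : ∀ n, ENNReal.ofReal ((μ.real (Metric.ball x (√t)))⁻¹ * B n) *
        ((D : ℝ≥0∞) ^ n * μ (Metric.ball x (√t))) = ENNReal.ofReal (B n * (D : ℝ) ^ n) := by
      intro n
      have e : (D : ℝ≥0∞) ^ n * μ (Metric.ball x (√t)) =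
          ENNReal.ofReal ((D : ℝ) ^ n * μ.real (Metric.ball x (√t))) := by
        rw [ENNReal.ofReal_mul (by positivity), Measure.real,
          ENNReal.ofReal_toReal (hD.finite _ _).ne, ENNReal.ofReal_pow (by positivity)]
        simp
      have hB0 : 0 ≤ B n := by simp only [hB]; positivity
      rw [e, ← ENNReal.ofReal_mul (by positivity)]
      congr 1
      field_simp
    simp_rw [hle]
    rw [← ENNReal.ofReal_tsum_of_nonneg (fun n => by simp only [hB]; positivity) hsum]
    rfl

/-- Volumes grow at most like `D^n` at distance `2^n`, so `4^m > D` suffices. This embeds weighted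
`L²`, and so the test functions, into `L¹`. -/
theorem IsDoublingWith.exists_lintegral_weight_lt_top (hD : IsDoublingWith μ D) (o : M) :
    ∃ m : ℕ, ∫⁻ x, ENNReal.ofReal (((1 + dist o x) ^ m)⁻¹ ^ 2) ∂μ < ∞ := by
  obtain ⟨m, hm⟩ : ∃ m : ℕ, (D : ℝ) < 4 ^ m := pow_unbounded_of_one_lt _ (by norm_num)
  refine ⟨m, (hD.lintegral_le_tsum o one_pos _
    (fun n => ENNReal.ofReal (((2 : ℝ) ^ m) ^ 2 * ((4 : ℝ) ^ m)⁻¹ ^ n)) fun y => ?_).trans_lt ?_⟩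
  · obtain ⟨n, hn, hn'⟩ := exists_lt_two_pow (dist y o) dist_nonneg
    refine ⟨n, by simpa using hn, ENNReal.ofReal_le_ofReal ?_⟩
    have h1 : (2 : ℝ) ^ n ≤ 2 * (1 + dist o y) := by
      rw [dist_comm]; linarith [dist_nonneg (x := y) (y := o)]
    have h2 : ((2 : ℝ) ^ n) ^ m ≤ (2 * (1 + dist o y)) ^ m := pow_le_pow_left₀ (by positivity) h1 m
    have h3 : ((1 + dist o y) ^ m)⁻¹ ≤ 2 ^ m * ((2 : ℝ) ^ n ^ 1)⁻¹ ^ m := by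
      rw [inv_pow, ← div_eq_mul_inv, inv_le_comm₀ (by positivity) (by positivity), inv_div,
        div_le_iff₀ (by positivity)]
      rw [mul_pow] at h2
      simp; linarith
    calc ((1 + dist o y) ^ m)⁻¹ ^ 2 ≤ (2 ^ m * ((2 : ℝ) ^ n ^ 1)⁻¹ ^ m) ^ 2 := by gcongr
      _ = _ := by
        rw [mul_pow, show (4 : ℝ) = 2 ^ 2 by norm_num]
        simp only [inv_pow, ← pow_mul, pow_one]
        congr 3
        ring
  · have e : ∀ n : ℕ, ENNReal.ofReal (((2 : ℝ) ^ m) ^ 2 * ((4 : ℝ) ^ m)⁻¹ ^ n) *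
        ((D : ℝ≥0∞) ^ n * μ (Metric.ball o 1)) =
        ENNReal.ofReal (((2 : ℝ) ^ m) ^ 2 * ((D : ℝ) / 4 ^ m) ^ n) * μ (Metric.ball o 1) := by
      intro n
      rw [← mul_assoc]
      congr 1
      have : (D : ℝ≥0∞) ^ n = ENNReal.ofReal ((D : ℝ) ^ n) := by
        rw [ENNReal.ofReal_pow (by positivity)]; simp
      rw [this, ← ENNReal.ofReal_mul (by positivity), div_eq_mul_inv, mul_pow]
      congr 1
      ring
    simp_rw [e]
    rw [ENNReal.tsum_mul_right, ← ENNReal.ofReal_tsum_of_nonneg (fun n => by positivity)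
      ((summable_geometric_of_lt_one (by positivity)
        (by rw [div_lt_one (by positivity)]; exact hm)).mul_left _)]
    exact ENNReal.mul_lt_top ENNReal.ofReal_lt_top (hD.finite _ _)

end

/-! ### Schur test -/

section Schur

variable {X : Type*} [MeasurableSpace X] {μ : Measure X}

/-- Cauchy–Schwarz for the measure with density `k`. -/
theorem lintegral_mul_sq_le (k F : X → ℝ≥0∞) (hk : AEMeasurable k μ) (hF : AEMeasurable F μ) :
    (∫⁻ y, k y * F y ∂μ) ^ 2 ≤ (∫⁻ y, k y ∂μ) * ∫⁻ y, k y * F y ^ 2 ∂μ := by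
  have hs : ∀ a : ℝ≥0∞, a ^ (1 / 2 : ℝ) * a ^ (1 / 2 : ℝ) = a := fun a => by
    rw [← ENNReal.rpow_add_of_nonneg _ _ (by norm_num) (by norm_num)]; norm_num
  have hq : ∀ a : ℝ≥0∞, (a ^ (1 / 2 : ℝ)) ^ 2 = a := fun a => by rw [sq, hs]
  have h := ENNReal.lintegral_mul_le_Lp_mul_Lq μ Real.HolderConjugate.two_two
    (hk.pow_const (1 / 2 : ℝ)) ((hk.pow_const (1 / 2 : ℝ)).mul hF)
  calc (∫⁻ y, k y * F y ∂μ) ^ 2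
      = (∫⁻ y, ((fun y => k y ^ (1 / 2 : ℝ)) * (fun y => k y ^ (1 / 2 : ℝ) * F y)) y ∂μ) ^ 2 := by
        congr 2; ext y; simp only [Pi.mul_apply]; rw [← mul_assoc, hs]
    _ ≤ _ := pow_le_pow_left' h 2
    _ = _ := by
        rw [mul_pow, hq, hq]
        simp only [Pi.mul_apply, ENNReal.rpow_two, mul_pow, hq]

theorem schur_sq [SFinite μ] (k : X → X → ℝ≥0∞) (hk : Measurable (Function.uncurry k)) (S : ℝ≥0∞)
    (h1 : ∀ x, ∫⁻ y, k x y ∂μ ≤ S) (h2 : ∀ y, ∫⁻ x, k x y ∂μ ≤ S) (F : X → ℝ≥0∞)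
    (hF : AEMeasurable F μ) :
    ∫⁻ x, (∫⁻ y, k x y * F y ∂μ) ^ 2 ∂μ ≤ S ^ 2 * ∫⁻ y, F y ^ 2 ∂μ := by
  wlog hF' : Measurable F generalizing F
  · have e1 : ∀ x, ∫⁻ y, k x y * F y ∂μ = ∫⁻ y, k x y * hF.mk F y ∂μ := fun x =>
      lintegral_congr_ae (by filter_upwards [hF.ae_eq_mk] with y hy; rw [hy])
    have e2 : ∫⁻ y, F y ^ 2 ∂μ = ∫⁻ y, hF.mk F y ^ 2 ∂μ :=
      lintegral_congr_ae (by filter_upwards [hF.ae_eq_mk] with y hy; rw [hy])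
    simp_rw [e1, e2]
    exact this _ hF.measurable_mk.aemeasurable hF.measurable_mk
  have hkx : ∀ x, Measurable (k x) := fun x => hk.of_uncurry_left
  have hky : ∀ y, Measurable fun x => k x y := fun y => hk.of_uncurry_right
  calc ∫⁻ x, (∫⁻ y, k x y * F y ∂μ) ^ 2 ∂μ ≤ ∫⁻ x, S * ∫⁻ y, k x y * F y ^ 2 ∂μ ∂μ := by
        refine lintegral_mono fun x => ?_
        refine (lintegral_mul_sq_le _ _ (hkx x).aemeasurable hF).trans ?_
        gcongr
        exact h1 x
    _ = S * ∫⁻ x, ∫⁻ y, k x y * F y ^ 2 ∂μ ∂μ := by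
        refine lintegral_const_mul _ ?_
        exact (hk.mul ((hF'.pow_const 2).comp measurable_snd)).lintegral_prod_right'
    _ = S * ∫⁻ y, (∫⁻ x, k x y ∂μ) * F y ^ 2 ∂μ := by
        rw [lintegral_lintegral_swap]
        · congr 2; ext y
          rw [lintegral_mul_const _ (hky y)]
        · exact (hk.mul ((hF'.pow_const 2).comp measurable_snd)).aemeasurable
    _ ≤ S * ∫⁻ y, S * F y ^ 2 ∂μ := by
        gcongr with y
        exact h2 y
    _ = _ := by rw [lintegral_const_mul _ (hF'.pow_const 2), sq, mul_assoc]

theorem schur_one [SFinite μ] (k : X → X → ℝ≥0∞) (hk : Measurable (Function.uncurry k)) (S : ℝ≥0∞)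
    (h2 : ∀ y, ∫⁻ x, k x y ∂μ ≤ S) (F : X → ℝ≥0∞)
    (hF : AEMeasurable F μ) :
    ∫⁻ x, (∫⁻ y, k x y * F y ∂μ) ∂μ ≤ S * ∫⁻ y, F y ∂μ := by
  wlog hF' : Measurable F generalizing F
  · have e1 : ∀ x, ∫⁻ y, k x y * F y ∂μ = ∫⁻ y, k x y * hF.mk F y ∂μ := fun x =>
      lintegral_congr_ae (by filter_upwards [hF.ae_eq_mk] with y hy; rw [hy])
    simp_rw [e1, lintegral_congr_ae hF.ae_eq_mk]
    exact this _ hF.measurable_mk.aemeasurable hF.measurable_mk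
  have hky : ∀ y, Measurable fun x => k x y := fun y => hk.of_uncurry_right
  rw [lintegral_lintegral_swap]
  · calc ∫⁻ y, ∫⁻ x, k x y * F y ∂μ ∂μ ≤ ∫⁻ y, S * F y ∂μ := by
          refine lintegral_mono fun y => ?_
          rw [lintegral_mul_const _ (hky y)]
          gcongr
          exact h2 y
      _ = _ := lintegral_const_mul _ hF'
  · exact (hk.mul (hF'.comp measurable_snd)).aemeasurable

end Schur

/-! ### Kernel domination -/

theorem eLpNorm_two_sq {X : Type*} [MeasurableSpace X] {μ : Measure X} (f : X → ℝ) :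
    eLpNorm f 2 μ ^ 2 = ∫⁻ x, ‖f x‖ₑ ^ 2 ∂μ := by
  simpa using eLpNorm_nnreal_pow_eq_lintegral (f := f) (μ := μ) (p := 2) (by norm_num)

theorem lintegral_enorm_sq {X : Type*} [MeasurableSpace X] {μ : Measure X} (f : Lp ℝ 2 μ) :
    ∫⁻ x, ‖f x‖ₑ ^ 2 ∂μ = ‖f‖ₑ ^ 2 := by
  rw [Lp.enorm_def, eLpNorm_two_sq]

theorem ennreal_add_sq_le (a b : ℝ≥0∞) : (a + b) ^ 2 ≤ 4 * (a ^ 2 + b ^ 2) := by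
  have key : ∀ a b : ℝ≥0∞, a ≤ b → (a + b) ^ 2 ≤ 4 * (a ^ 2 + b ^ 2) := by
    intro a b h
    calc (a + b) ^ 2 ≤ (b + b) ^ 2 := by gcongr
      _ = 4 * b ^ 2 := by ring
      _ ≤ _ := by gcongr; exact le_add_self
  rcases le_total a b with h | h
  · exact key a b h
  · rw [add_comm a b, add_comm (a ^ 2)]; exact key b a h

section Domination

variable {X : Type*} [MeasurableSpace X] {μ : Measure X} [SFinite μ]

theorem measurable_lintegral_kernel (k : X → X → ℝ≥0∞) (hk : Measurable (Function.uncurry k))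
    (f : Lp ℝ 2 μ) : Measurable fun x => ∫⁻ y, k x y * ‖f y‖ₑ ∂μ :=
  (hk.mul ((Lp.stronglyMeasurable f).measurable.enorm.comp measurable_snd)).lintegral_prod_right'

/-- A pointwise kernel bound for a bounded operator extends from a dense set to all of `L²`. -/
theorem ae_enorm_le_of_dense (k : X → X → ℝ≥0∞) (hk : Measurable (Function.uncurry k))
    (S : ℝ≥0) (h1 : ∀ x, ∫⁻ y, k x y ∂μ ≤ S) (h2 : ∀ y, ∫⁻ x, k x y ∂μ ≤ S)
    (A : Lp ℝ 2 μ →L[ℝ] Lp ℝ 2 μ) (s : Set (Lp ℝ 2 μ)) (hs : Dense s)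
    (h : ∀ g ∈ s, ∀ᵐ x ∂μ, ‖A g x‖ₑ ≤ ∫⁻ y, k x y * ‖g y‖ₑ ∂μ) (f : Lp ℝ 2 μ) :
    ∀ᵐ x ∂μ, ‖A f x‖ₑ ≤ ∫⁻ y, k x y * ‖f y‖ₑ ∂μ := by
  have hkx : ∀ x, Measurable (k x) := fun x => hk.of_uncurry_left
  have hm : ∀ g : Lp ℝ 2 μ, Measurable fun y => ‖g y‖ₑ := fun g =>
    (Lp.stronglyMeasurable g).measurable.enorm
  -- `u` is the amount by which the bound fails (truncated subtraction). Comparison with a nearby `g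
  -- ∈ s` bounds its `L²` norm by a multiple of `‖f - g‖`, so it vanishes.
  set u : X → ℝ≥0∞ := fun x => ‖A f x‖ₑ - ∫⁻ y, k x y * ‖f y‖ₑ ∂μ with hu
  have hum : Measurable u := (hm (A f)).sub (measurable_lintegral_kernel k hk f)
  have key : ∀ g ∈ s, ∫⁻ x, u x ^ 2 ∂μ ≤ 4 * ((S : ℝ≥0∞) ^ 2 + ‖A‖ₑ ^ 2) * ‖f - g‖ₑ ^ 2 := by
    intro g hg
    have hle : ∀ᵐ x ∂μ, u x ^ 2 ≤
        4 * ((∫⁻ y, k x y * ‖(f - g) y‖ₑ ∂μ) ^ 2 + ‖A (f - g) x‖ₑ ^ 2) := by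
      have e0 : A f = A g + A (f - g) := by simp
      have e1 : ∀ᵐ x ∂μ, A f x = A g x + A (f - g) x := by
        filter_upwards [Lp.coeFn_add (A g) (A (f - g))] with x hx
        rw [e0, hx]; rfl
      have e2 : ∀ᵐ y ∂μ, ‖g y‖ₑ ≤ ‖f y‖ₑ + ‖(f - g) y‖ₑ := by
        filter_upwards [Lp.coeFn_sub f g] with y hy
        rw [hy]
        have : g y = f y - (f y - g y) := by ring
        calc ‖g y‖ₑ = ‖f y - (f y - g y)‖ₑ := by rw [← this]
          _ ≤ _ := enorm_sub_le
      filter_upwards [e1, h g hg] with x hx1 hx2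
      refine le_trans ?_ (ennreal_add_sq_le _ _)
      gcongr
      rw [hu]
      simp only
      rw [tsub_le_iff_left, hx1]
      have e3 : ∫⁻ y, k x y * ‖g y‖ₑ ∂μ ≤ ∫⁻ y, k x y * ‖f y‖ₑ ∂μ + ∫⁻ y, k x y * ‖(f - g) y‖ₑ ∂μ := by
        have hadd := lintegral_add_left (μ := μ) (f := fun y => k x y * ‖f y‖ₑ) ((hkx x).mul (hm f))
          (fun y => k x y * ‖(f - g) y‖ₑ)
        rw [← hadd]
        refine lintegral_mono_ae ?_
        filter_upwards [e2] with y hy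
        rw [← mul_add]
        gcongr
      calc ‖A g x + A (f - g) x‖ₑ ≤ ‖A g x‖ₑ + ‖A (f - g) x‖ₑ := enorm_add_le _ _
        _ ≤ (∫⁻ y, k x y * ‖f y‖ₑ ∂μ + ∫⁻ y, k x y * ‖(f - g) y‖ₑ ∂μ) + ‖A (f - g) x‖ₑ := by
          gcongr; exact hx2.trans e3
        _ = _ := by rw [add_assoc]
    calc ∫⁻ x, u x ^ 2 ∂μ ≤ ∫⁻ x, 4 * ((∫⁻ y, k x y * ‖(f - g) y‖ₑ ∂μ) ^ 2 + ‖A (f - g) x‖ₑ ^ 2) ∂μ :=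
          lintegral_mono_ae hle
      _ = 4 * (∫⁻ x, (∫⁻ y, k x y * ‖(f - g) y‖ₑ ∂μ) ^ 2 ∂μ + ∫⁻ x, ‖A (f - g) x‖ₑ ^ 2 ∂μ) := by
          rw [lintegral_const_mul' _ _ (by simp), lintegral_add_left
            ((measurable_lintegral_kernel k hk _).pow_const 2)]
      _ ≤ 4 * ((S : ℝ≥0∞) ^ 2 * ‖f - g‖ₑ ^ 2 + (‖A‖ₑ * ‖f - g‖ₑ) ^ 2) := by
          gcongr
          · rw [← lintegral_enorm_sq]
            exact schur_sq k hk S h1 h2 _ (hm _).aemeasurable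
          · rw [lintegral_enorm_sq]
            gcongr
            exact A.le_opENorm _
      _ = _ := by rw [mul_pow]; ring
  obtain ⟨g, hgs, hg⟩ := mem_closure_iff_seq_limit.1 (hs f)
  have hlim : Tendsto (fun n => 4 * ((S : ℝ≥0∞) ^ 2 + ‖A‖ₑ ^ 2) * ‖f - g n‖ₑ ^ 2) atTop (𝓝 0) := by
    have h0 : Tendsto (fun n => ‖f - g n‖ₑ) atTop (𝓝 0) := by
      have := (tendsto_const_nhds (x := f)).sub hg
      rw [sub_self] at this
      simpa using this.enorm
    have h3 := ENNReal.Tendsto.pow (n := 2) h0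
    have h4 := ENNReal.Tendsto.const_mul (a := 4 * ((S : ℝ≥0∞) ^ 2 + ‖A‖ₑ ^ 2)) h3
      (Or.inr (ENNReal.mul_ne_top (by simp) (by simp)))
    simpa using h4
  have h0 : ∫⁻ x, u x ^ 2 ∂μ = 0 :=
    le_antisymm (ge_of_tendsto' hlim fun n => key _ (hgs n)) (zero_le)
  rw [lintegral_eq_zero_iff (hum.pow_const 2)] at h0
  filter_upwards [h0] with x hx
  have : u x = 0 := by simpa using hx
  exact tsub_eq_zero_iff_le.1 this

end Domination

/-! ### Weighted norms -/

section WeightedNorm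

variable {M : Type*} [MetricSpace M] [MeasurableSpace M] [BorelSpace M] {μ : Measure M} {D : ℝ≥0}

/-- The norm of `(1 + d(o,·))^m v` in `L^q`. -/
def wnorm (q : ℝ≥0∞) (o : M) (m : ℕ) (v : Lp ℝ 2 μ) : ℝ≥0∞ :=
  eLpNorm (fun x => (1 + dist o x) ^ m * v x) q μ

theorem measurable_weight (o : M) (m : ℕ) : Measurable fun x : M => (1 + dist o x) ^ m := by
  have : Continuous fun x : M => (1 + dist o x) ^ m := by fun_prop
  exact this.measurable

theorem aestronglyMeasurable_weight_mul (o : M) (m : ℕ) (v : Lp ℝ 2 μ) :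
    AEStronglyMeasurable (fun x => (1 + dist o x) ^ m * v x) μ :=
  (measurable_weight o m).aestronglyMeasurable.mul (Lp.aestronglyMeasurable v)

theorem wnorm_smul (q : ℝ≥0∞) (o : M) (m : ℕ) (r : ℝ) (v : Lp ℝ 2 μ) :
    wnorm q o m (r • v) = ‖r‖ₑ * wnorm q o m v := by
  rw [wnorm, wnorm, ← eLpNorm_const_smul]
  refine eLpNorm_congr_ae ?_
  filter_upwards [Lp.coeFn_smul r v] with x hx
  rw [hx]; simp; ring

theorem wnorm_add_le {q : ℝ≥0∞} (hq : 1 ≤ q) (o : M) (m : ℕ) (u v : Lp ℝ 2 μ) :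
    wnorm q o m (u + v) ≤ wnorm q o m u + wnorm q o m v := by
  refine le_trans (le_of_eq ?_) (eLpNorm_add_le (aestronglyMeasurable_weight_mul o m u)
    (aestronglyMeasurable_weight_mul o m v) hq)
  refine eLpNorm_congr_ae ?_
  filter_upwards [Lp.coeFn_add u v] with x hx
  rw [hx]; simp; ring

theorem wnorm_sub_le {q : ℝ≥0∞} (hq : 1 ≤ q) (o : M) (m : ℕ) (u v : Lp ℝ 2 μ) :
    wnorm q o m (u - v) ≤ wnorm q o m u + wnorm q o m v := by
  have h : u - v = u + (-1 : ℝ) • v := by simp [sub_eq_add_neg]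
  rw [h]
  refine (wnorm_add_le hq o m _ _).trans ?_
  rw [wnorm_smul]; simp

/-- Fatou along an a.e. convergent subsequence. With convexity, this lets weighted bounds pass to
`L²` limits and to averages of `L²`-valued integrals, also for `q = 1`. -/
theorem isClosed_wnorm_le (q : ℝ≥0∞) (o : M) (m : ℕ) (R : ℝ≥0∞) :
    IsClosed {v : Lp ℝ 2 μ | wnorm q o m v ≤ R} := by
  refine IsSeqClosed.isClosed fun v u hv hu => ?_
  have hmeas := tendstoInMeasure_of_tendsto_Lp hu
  obtain ⟨ns, hns, hae⟩ := hmeas.exists_seq_tendsto_ae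
  have h := Lp.eLpNorm_lim_le_liminf_eLpNorm (p := q) (μ := μ)
    (f := fun n x => (1 + dist o x) ^ m * v (ns n) x)
    (fun n => aestronglyMeasurable_weight_mul o m _) (fun x => (1 + dist o x) ^ m * u x) (by
      filter_upwards [hae] with x hx
      exact hx.const_mul _)
  refine h.trans ?_
  refine (liminf_le_liminf (Eventually.of_forall fun n => hv (ns n))).trans ?_
  simp

theorem convex_wnorm_le {q : ℝ≥0∞} (hq : 1 ≤ q) (o : M) (m : ℕ) (R : ℝ≥0∞) :
    Convex ℝ {v : Lp ℝ 2 μ | wnorm q o m v ≤ R} := by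
  intro u hu v hv a b ha hb hab
  simp only [mem_ofPred_eq] at *
  calc wnorm q o m (a • u + b • v) ≤ ‖a‖ₑ * wnorm q o m u + ‖b‖ₑ * wnorm q o m v := by
        refine (wnorm_add_le hq o m _ _).trans ?_
        rw [wnorm_smul, wnorm_smul]
    _ ≤ ‖a‖ₑ * R + ‖b‖ₑ * R := by gcongr
    _ = R := by
        rw [← add_mul, Real.enorm_of_nonneg ha, Real.enorm_of_nonneg hb,
          ← ENNReal.ofReal_add ha hb, hab]
        simp

/-- The weight is moved from `x` to `y` by `1 + d(o,x) ≤ (1 + d(x,y)) (1 + d(o,y))`; the factor in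
`d(x,y)` joins the kernel. -/
theorem weight_mul_gaussKernel_le (o x y : M) (c : ℝ) (m : ℕ) (t : ℝ) :
    (1 + dist o x) ^ m * gaussKernel μ c 0 t x y ≤ gaussKernel μ c m t x y * (1 + dist o y) ^ m := by
  unfold gaussKernel
  have h : (1 + dist o x) ^ m ≤ (1 + dist x y) ^ m * (1 + dist o y) ^ m := by
    rw [← mul_pow]
    refine pow_le_pow_left₀ (by positivity) ?_ m
    have := dist_triangle o y x
    rw [dist_comm y x] at this
    nlinarith [mul_nonneg (dist_nonneg (x := x) (y := y)) (dist_nonneg (x := o) (y := y))]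
  set E := Real.exp (-c * dist x y ^ 2 / t)
  set V := (√(μ.real (Metric.ball x (√t)) * μ.real (Metric.ball y (√t))))⁻¹
  have hE : 0 ≤ V * E := by positivity
  calc (1 + dist o x) ^ m * ((1 + dist x y) ^ 0 * V * E) = (1 + dist o x) ^ m * (V * E) := by ring
    _ ≤ ((1 + dist x y) ^ m * (1 + dist o y) ^ m) * (V * E) := by gcongr
    _ = _ := by ring

/-- Functions dominated by a Gaussian average of `f` inherit the weighted bounds of `f`. -/
theorem IsDoublingWith.exists_wnorm_le [SecondCountableTopology M] [SFinite μ]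
    (hD : IsDoublingWith μ D) {c : ℝ} (hc : 0 < c) {q : ℝ≥0∞} (hq : q = 1 ∨ q = 2) (m : ℕ) :
    ∃ S : ℝ≥0, ∀ t ∈ Ioc (0 : ℝ) 1, ∀ (o : M) (K : ℝ≥0) (f v : Lp ℝ 2 μ),
      (∀ᵐ x ∂μ, ‖v x‖ₑ ≤ ∫⁻ y, (K * ENNReal.ofReal (gaussKernel μ c 0 t x y)) * ‖f y‖ₑ ∂μ) →
        wnorm q o m v ≤ K * S * wnorm q o m f := by
  obtain ⟨S, hS⟩ := hD.exists_lintegral_gaussKernel_le hc m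
  refine ⟨S, fun t ht o K f v h => ?_⟩
  set k : M → M → ℝ≥0∞ := fun x y => K * ENNReal.ofReal (gaussKernel μ c m t x y) with hk
  have hkm : Measurable (Function.uncurry k) :=
    ((measurable_gaussKernel c m t).ennreal_ofReal).const_mul _
  have h1 : ∀ x, ∫⁻ y, k x y ∂μ ≤ K * S := fun x => by
    simp only [hk]
    rw [lintegral_const_mul' _ _ (by simp)]
    gcongr
    exact hS t ht x
  have h2 : ∀ y, ∫⁻ x, k x y ∂μ ≤ K * S := fun y => by
    simp only [hk]
    rw [lintegral_const_mul' _ _ (by simp)]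
    simp_rw [gaussKernel_comm c m t _ y]
    gcongr
    exact hS t ht y
  set F : M → ℝ≥0∞ := fun y => ‖(1 + dist o y) ^ m * f y‖ₑ with hF
  have hFm : AEMeasurable F μ := (aestronglyMeasurable_weight_mul o m f).enorm
  have hv : ∀ᵐ x ∂μ, ‖(1 + dist o x) ^ m * v x‖ₑ ≤ ∫⁻ y, k x y * F y ∂μ := by
    filter_upwards [h] with x hx
    rw [enorm_mul]
    refine (mul_le_mul' le_rfl hx).trans ?_
    rw [← lintegral_const_mul' _ _ (by simp)]
    refine lintegral_mono fun y => ?_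
    simp only [hk, hF, enorm_mul]
    have e : ∀ z : M, ‖(1 + dist o z) ^ m‖ₑ = ENNReal.ofReal ((1 + dist o z) ^ m) := fun z =>
      Real.enorm_of_nonneg (by positivity)
    rw [e, e]
    calc ENNReal.ofReal ((1 + dist o x) ^ m) *
          (K * ENNReal.ofReal (gaussKernel μ c 0 t x y) * ‖f y‖ₑ)
        = K * ENNReal.ofReal ((1 + dist o x) ^ m * gaussKernel μ c 0 t x y) * ‖f y‖ₑ := by
          rw [ENNReal.ofReal_mul (by positivity)]; ring
      _ ≤ K * ENNReal.ofReal (gaussKernel μ c m t x y * (1 + dist o y) ^ m) * ‖f y‖ₑ := by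
          refine mul_le_mul' (mul_le_mul' le_rfl (ENNReal.ofReal_le_ofReal ?_)) le_rfl
          exact weight_mul_gaussKernel_le o x y c m t
      _ = _ := by
          rw [ENNReal.ofReal_mul (gaussKernel_nonneg _ _ _ _ _)]; ring
  rcases hq with rfl | rfl
  · rw [wnorm, wnorm, eLpNorm_one_eq_lintegral_enorm, eLpNorm_one_eq_lintegral_enorm]
    exact (lintegral_mono_ae hv).trans (schur_one k hkm _ h2 F hFm)
  · have h3 : wnorm 2 o m v ^ 2 ≤ (K * S * wnorm 2 o m f) ^ 2 := by
      rw [mul_pow, wnorm, wnorm, eLpNorm_two_sq, eLpNorm_two_sq]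
      refine (lintegral_mono_ae (g := fun x => (∫⁻ y, k x y * F y ∂μ) ^ 2) ?_).trans
        (schur_sq k hkm _ h1 h2 F hFm)
      filter_upwards [hv] with x hx
      gcongr
    exact (ENNReal.pow_le_pow_left_iff two_ne_zero).1 h3

end WeightedNorm

/-! ### Consequences of the Gaussian bounds -/

section HeatKernel

variable {M : Type*} [MetricSpace M] [MeasurableSpace M] [BorelSpace M] {μ : Measure M} {D : ℝ≥0}
  {p : ℝ → M → M → ℝ}

theorem gaussKernel_mono (c c' : ℝ) (hc : c' ≤ c) (m : ℕ) {t : ℝ} (ht : 0 < t) (x y : M) :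
    gaussKernel μ c m t x y ≤ gaussKernel μ c' m t x y := by
  unfold gaussKernel
  gcongr

/-- The kernel estimate at each time holds off a null set depending on that time, so only countably
many times can be used at once. Continuity of the derivative extends the bound from rational times,
and the mean value inequality applies. -/
theorem norm_sub_le_of_derivWithin_rat {f : ℝ → ℝ}
    (hf : ContDiffOn ℝ ((⊤ : ℕ∞) : WithTop ℕ∞) f (Ioc 0 1)) {t₀ : ℝ} (h0 : 0 < t₀)
    (h1 : 2 * t₀ ≤ 1) {H : ℝ}
    (hH : ∀ r : ℚ, (r : ℝ) ∈ Ioo t₀ (2 * t₀) → |derivWithin f (Ioc 0 1) r| ≤ H) {s u : ℝ}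
    (hs : s ∈ Ioo t₀ (2 * t₀)) (hu : u ∈ Ioo t₀ (2 * t₀)) : |f s - f u| ≤ H * |s - u| := by
  have hsub : Ioo t₀ (2 * t₀) ⊆ Ioc 0 1 := fun x hx => ⟨h0.trans hx.1, hx.2.le.trans h1⟩
  have hcont : ContinuousOn (derivWithin f (Ioc 0 1)) (Ioo t₀ (2 * t₀)) :=
    (hf.continuousOn_derivWithin (uniqueDiffOn_Ioc 0 1) (by simp)).mono hsub
  have hall : ∀ r ∈ Ioo t₀ (2 * t₀), |derivWithin f (Ioc 0 1) r| ≤ H := by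
    intro r hr
    by_contra! hlt
    have hopen : IsOpen (Ioo t₀ (2 * t₀) ∩ (fun r => |derivWithin f (Ioc 0 1) r|) ⁻¹' Ioi H) :=
      hcont.abs.isOpen_inter_preimage isOpen_Ioo isOpen_Ioi
    obtain ⟨q, hq⟩ := Rat.isDenseEmbedding_coe_real.dense.exists_mem_open hopen ⟨r, hr, hlt⟩
    have := hH q hq.1
    have h3 := hq.2
    simp only [mem_preimage, mem_Ioi] at h3
    linarith
  have hd : ∀ r ∈ Ioo t₀ (2 * t₀),
      HasDerivWithinAt f (derivWithin f (Ioc 0 1) r) (Ioo t₀ (2 * t₀)) r := fun r hr =>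
    ((hf.differentiableOn (by simp) r (hsub hr)).hasDerivWithinAt).mono hsub
  exact Convex.norm_image_sub_le_of_norm_hasDerivWithin_le hd hall (convex_Ioo _ _) hu hs

theorem GaussianUpperBound.exists_bounds (h : GaussianUpperBound μ p) (hD : IsDoublingWith μ D) :
    ∃ c : ℝ, 0 < c ∧ ∃ C : ℝ≥0,
      (∀ t ∈ Ioc (0 : ℝ) 1, ∀ᵐ z ∂(μ.prod μ), |p t z.1 z.2| ≤ C * gaussKernel μ c 0 t z.1 z.2) ∧
      ∀ t₀ : ℝ, 0 < t₀ → 2 * t₀ ≤ 1 → ∀ s ∈ Ioo t₀ (2 * t₀), ∀ u ∈ Ioo t₀ (2 * t₀),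
        ∀ᵐ z ∂(μ.prod μ), |p s z.1 z.2 - p u z.1 z.2| ≤
          (C * (|s - u| / t₀)) * gaussKernel μ c 0 t₀ z.1 z.2 := by
  obtain ⟨c, hc, hb⟩ := h.bound
  obtain ⟨C0, hC0⟩ := hb 0
  obtain ⟨C1, hC1⟩ := hb 1
  -- For `r` in `(t₀, 2t₀)` one has `c/r ≥ (c/2)/t₀`, so halving the constant dominates all
  -- Gaussians of this window by the one at time `t₀`.
  refine ⟨c / 2, by positivity, max C0.toNNReal C1.toNNReal, fun t ht => ?_,
    fun t₀ h0 h1 s hs u hu => ?_⟩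
  · filter_upwards [hC0 t ht] with z hz
    simp only [iteratedDerivWithin_zero, pow_zero, inv_one, mul_one] at hz
    refine hz.trans ?_
    have e : C0 * (√(μ.real (Metric.ball z.1 (√t)) * μ.real (Metric.ball z.2 (√t))))⁻¹ *
        Real.exp (-c * dist z.1 z.2 ^ 2 / t) = C0 * gaussKernel μ c 0 t z.1 z.2 := by
      unfold gaussKernel; ring
    rw [e]
    have h1 : C0 ≤ ((max C0.toNNReal C1.toNNReal : ℝ≥0) : ℝ) :=
      (Real.le_coe_toNNReal C0).trans (by exact_mod_cast le_max_left _ _)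
    exact mul_le_mul h1 (gaussKernel_mono _ _ (by linarith) _ ht.1 _ _)
      (gaussKernel_nonneg _ _ _ _ _) (NNReal.coe_nonneg _)
  · have hsub : Ioo t₀ (2 * t₀) ⊆ Ioc 0 1 := fun x hx => ⟨h0.trans hx.1, hx.2.le.trans h1⟩
    have hrat : ∀ᵐ z ∂(μ.prod μ), ∀ r : ℚ, (r : ℝ) ∈ Ioo t₀ (2 * t₀) →
        |iteratedDerivWithin 1 (fun s => p s z.1 z.2) (Ioc 0 1) r| ≤
        C1 * ((r : ℝ) ^ 1)⁻¹ *
        (√(μ.real (Metric.ball z.1 (√r)) * μ.real (Metric.ball z.2 (√r))))⁻¹ *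
        Real.exp (-c * dist z.1 z.2 ^ 2 / r) := by
      rw [ae_all_iff]
      intro r
      by_cases hr : (r : ℝ) ∈ Ioo t₀ (2 * t₀)
      · filter_upwards [hC1 r (hsub hr)] with z hz _ using hz
      · exact Eventually.of_forall fun z hz => absurd hz hr
    filter_upwards [hrat, h.smooth] with z hz hsm
    have h2 : C1 ≤ ((max C0.toNNReal C1.toNNReal : ℝ≥0) : ℝ) :=
      (Real.le_coe_toNNReal C1).trans (by exact_mod_cast le_max_right _ _)
    set C : ℝ≥0 := max C0.toNNReal C1.toNNReal
    have hder : ∀ r : ℚ, (r : ℝ) ∈ Ioo t₀ (2 * t₀) →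
        |derivWithin (fun s => p s z.1 z.2) (Ioc 0 1) r| ≤
          C * t₀⁻¹ * gaussKernel μ (c / 2) 0 t₀ z.1 z.2 := by
      intro r hr
      have h3 := hz r hr
      rw [iteratedDerivWithin_one, pow_one] at h3
      refine h3.trans ?_
      have hr0 : (0 : ℝ) < r := h0.trans hr.1
      have hV : ∀ x : M, μ.real (Metric.ball x (√t₀)) ≤ μ.real (Metric.ball x (√r)) := fun x =>
        measureReal_mono (Metric.ball_subset_ball (Real.sqrt_le_sqrt hr.1.le)) (hD.finite _ _).ne
      have hp1 := hD.real_pos z.1 (Real.sqrt_pos.2 h0)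
      have hp2 := hD.real_pos z.2 (Real.sqrt_pos.2 h0)
      have e1 : (√(μ.real (Metric.ball z.1 (√r)) * μ.real (Metric.ball z.2 (√r))))⁻¹ ≤
          (√(μ.real (Metric.ball z.1 (√t₀)) * μ.real (Metric.ball z.2 (√t₀))))⁻¹ := by
        apply inv_anti₀ (Real.sqrt_pos.2 (by positivity))
        apply Real.sqrt_le_sqrt
        exact mul_le_mul (hV _) (hV _) hp2.le (hp1.le.trans (hV _))
      have e2 : Real.exp (-c * dist z.1 z.2 ^ 2 / r) ≤
          Real.exp (-(c / 2) * dist z.1 z.2 ^ 2 / t₀) := by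
        rw [Real.exp_le_exp, div_le_div_iff₀ hr0 h0]
        nlinarith [mul_nonneg (mul_nonneg hc.le (sq_nonneg (dist z.1 z.2)))
          (by linarith [hr.2] : 0 ≤ 2 * t₀ - r)]
      have e3 : (r : ℝ)⁻¹ ≤ t₀⁻¹ := inv_anti₀ h0 hr.1.le
      calc _ ≤ C * t₀⁻¹ * (√(μ.real (Metric.ball z.1 (√t₀)) * μ.real (Metric.ball z.2 (√t₀))))⁻¹ *
            Real.exp (-(c / 2) * dist z.1 z.2 ^ 2 / t₀) := by gcongr
        _ = _ := by unfold gaussKernel; ring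
    refine (norm_sub_le_of_derivWithin_rat hsm h0 h1 hder hs hu).trans (le_of_eq ?_)
    ring

end HeatKernel

/-! ### The heat semigroup of a self-adjoint operator -/

section Semigroup

variable {X : Type*} [MeasurableSpace X] {μ : Measure X}
  {L : Lp ℝ 2 μ →ₗ.[ℝ] Lp ℝ 2 μ} {T : ℝ → Lp ℝ 2 μ →L[ℝ] Lp ℝ 2 μ}

theorem IsHeatSemigroup.tendsto_applyL (hT : IsHeatSemigroup L T) {f : Lp ℝ 2 μ}
    (hf : f ∈ L.domain) : Tendsto (fun t : ℝ => t⁻¹ • (f - T t f)) (𝓝[>] 0) (𝓝 (applyL L f)) :=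
  (hT.generator f _).1 ⟨hf, (applyL_of_mem L hf).symm⟩

theorem IsHeatSemigroup.add_apply (hT : IsHeatSemigroup L T) {s t : ℝ} (hs : 0 ≤ s) (ht : 0 ≤ t)
    (f : Lp ℝ 2 μ) : T (s + t) f = T s (T t f) := by rw [hT.add s t hs ht]; rfl

theorem IsHeatSemigroup.comm_apply (hT : IsHeatSemigroup L T) {s t : ℝ} (hs : 0 ≤ s) (ht : 0 ≤ t)
    (f : Lp ℝ 2 μ) : T s (T t f) = T t (T s f) := by
  rw [← hT.add_apply hs ht, ← hT.add_apply ht hs, add_comm]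

theorem IsHeatSemigroup.domain_and_comm (hT : IsHeatSemigroup L T) {s : ℝ} (hs : 0 ≤ s)
    {f : Lp ℝ 2 μ} (hf : f ∈ L.domain) :
    T s f ∈ L.domain ∧ applyL L (T s f) = T s (applyL L f) := by
  have h : Tendsto (fun t : ℝ => t⁻¹ • (T s f - T t (T s f))) (𝓝[>] 0) (𝓝 (T s (applyL L f))) := by
    refine (((T s).continuous.tendsto _).comp (hT.tendsto_applyL hf)).congr' ?_
    filter_upwards [self_mem_nhdsWithin] with t ht
    simp only [Function.comp, map_smul, map_sub]
    rw [hT.comm_apply hs (le_of_lt ht)]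
  obtain ⟨h1, h2⟩ := (hT.generator _ _).2 h
  exact ⟨h1, by rw [applyL_of_mem L h1, h2]⟩

theorem IsHeatSemigroup.hasDerivWithinAt_right (hT : IsHeatSemigroup L T) {s : ℝ} (hs : 0 ≤ s)
    {f : Lp ℝ 2 μ} (hf : f ∈ L.domain) :
    HasDerivWithinAt (fun t => T t f) (-T s (applyL L f)) (Ioi s) s := by
  rw [hasDerivWithinAt_iff_tendsto_slope' (by simp)]
  obtain ⟨h1, h2⟩ := hT.domain_and_comm hs hf
  have h := (hT.tendsto_applyL h1).neg
  rw [h2] at h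
  have hsub : Tendsto (fun t : ℝ => t - s) (𝓝[>] s) (𝓝[>] 0) := by
    refine tendsto_nhdsWithin_iff.2 ⟨?_, ?_⟩
    · have : Tendsto (fun t : ℝ => t - s) (𝓝 s) (𝓝 (s - s)) := tendsto_id.sub_const s
      rw [sub_self] at this
      exact this.mono_left nhdsWithin_le_nhds
    · filter_upwards [self_mem_nhdsWithin] with t ht
      exact sub_pos.2 (mem_Ioi.1 ht)
  refine (h.comp hsub).congr' ?_
  filter_upwards [self_mem_nhdsWithin] with t ht
  have ht' : 0 ≤ t - s := (sub_pos.2 (mem_Ioi.1 ht)).le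
  simp only [Function.comp, slope_def_module]
  rw [← hT.add_apply ht' hs, sub_add_cancel, ← smul_neg, neg_sub]

theorem IsHeatSemigroup.integral_eq (hT : IsHeatSemigroup L T) {s t : ℝ} (hs : 0 ≤ s) (hst : s ≤ t)
    {f : Lp ℝ 2 μ} (hf : f ∈ L.domain) :
    ∫ r in s..t, T r (applyL L f) = T s f - T t f := by
  have hsub : uIcc s t ⊆ Ici 0 := by
    rw [uIcc_of_le hst]; exact fun x hx => hs.trans hx.1
  have h := intervalIntegral.integral_eq_sub_of_hasDeriv_right
    (f := fun t => T t f) (f' := fun t => -T t (applyL L f)) (a := s) (b := t)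
    ((hT.continuousOn f).mono hsub)
    (fun x hx => hT.hasDerivWithinAt_right (by
      rw [min_eq_left hst] at hx; exact hs.trans hx.1.le) hf)
    (((hT.continuousOn (applyL L f)).mono hsub).neg.intervalIntegrable)
  rw [intervalIntegral.integral_neg] at h
  rw [← neg_inj, h, neg_sub]

theorem IsHeatSemigroup.hasDerivAt (hT : IsHeatSemigroup L T) {s : ℝ} (hs : 0 < s)
    {f : Lp ℝ 2 μ} (hf : f ∈ L.domain) :
    HasDerivAt (fun t => T t f) (-T s (applyL L f)) s := by
  have hcont := hT.continuousOn (applyL L f)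
  have h := intervalIntegral.integral_hasDerivAt_right (f := fun r => T r (applyL L f))
    (a := 0) (b := s)
    ((hcont.mono (by rw [uIcc_of_le hs.le]; exact fun x hx => hx.1)).intervalIntegrable)
    ((hcont.mono (Ioi_subset_Ici le_rfl)).stronglyMeasurableAtFilter isOpen_Ioi s hs)
    (hcont.continuousAt (Ici_mem_nhds hs))
  refine (h.neg.const_add f).congr_of_eventuallyEq ?_
  filter_upwards [Ioi_mem_nhds hs] with r hr
  have := hT.integral_eq le_rfl (le_of_lt hr) hf
  simp only [Pi.neg_apply]
  rw [this, hT.zero]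
  simp

/-! ### Symmetry of the semigroup and a criterion for membership in the domain -/

theorem IsNonnegSelfAdjoint.inner_comm (hL : IsNonnegSelfAdjoint L) {f g : Lp ℝ 2 μ}
    (hf : f ∈ L.domain) (hg : g ∈ L.domain) :
    inner ℝ (applyL L f) g = inner ℝ f (applyL L g) := by
  have h := LinearPMap.adjoint_isFormalAdjoint hL.dense_domain
  rw [show L.adjoint = L from hL.selfAdjoint] at h
  rw [applyL_of_mem L hf, applyL_of_mem L hg]
  exact h ⟨f, hf⟩ ⟨g, hg⟩

/-- For `f`, `g` in the domain, `s ↦ ⟨T_s f, T_{t-s} g⟩` has zero right derivative by the symmetry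
of `L`; its values at `s = t` and `s = 0` are the two sides. Density does the rest. -/
theorem IsHeatSemigroup.inner_comm (hT : IsHeatSemigroup L T) (hL : IsNonnegSelfAdjoint L) {t : ℝ}
    (ht : 0 ≤ t) (f g : Lp ℝ 2 μ) : inner ℝ (T t f) g = inner ℝ f (T t g) := by
  have hdom : ∀ f ∈ L.domain, ∀ g ∈ L.domain, inner ℝ (T t f) g = inner ℝ f (T t g) := by
    intro f hf g hg
    have hsub : ContinuousOn (fun s => T (t - s) g) (Icc 0 t) :=
      (hT.continuousOn g).comp (by fun_prop) fun x hx => by simpa using hx.2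
    have hc : ContinuousOn (fun s => inner ℝ (T s f) (T (t - s) g)) (Icc 0 t) :=
      ((hT.continuousOn f).mono fun x hx => hx.1).inner hsub
    have h := constant_of_has_deriv_right_zero hc (fun s hs => by
      have h1 : HasDerivWithinAt (fun s => T s f) (-T s (applyL L f)) (Ici s) s :=
        (hT.hasDerivWithinAt_right hs.1 hf).Ici_of_Ioi
      have h2 : HasDerivAt (fun s => T (t - s) g) ((-1 : ℝ) • -T (t - s) (applyL L g)) s :=
        HasDerivAt.scomp s (hT.hasDerivAt (sub_pos.2 hs.2) hg)
          ((hasDerivAt_id s).const_sub t)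
      have h3 := h1.inner ℝ h2.hasDerivWithinAt
      refine h3.congr_deriv ?_
      obtain ⟨d1, e1⟩ := hT.domain_and_comm hs.1 hf
      obtain ⟨d2, e2⟩ := hT.domain_and_comm (sub_nonneg.2 hs.2.le) hg
      rw [← e1, ← e2]
      simp only [smul_neg, neg_smul, one_smul, neg_neg, inner_neg_left]
      rw [hL.inner_comm d1 d2]
      simp) t ⟨ht, le_rfl⟩
    simpa [hT.zero] using h
  have h1 : ∀ f ∈ L.domain, ∀ g, inner ℝ (T t f) g = inner ℝ f (T t g) := by
    intro f hf g
    have hcl : IsClosed {g : Lp ℝ 2 μ | inner ℝ (T t f) g = inner ℝ f (T t g)} :=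
      isClosed_eq (by fun_prop) (by fun_prop)
    exact (hcl.closure_subset_iff.2 (fun g hg => hdom f hf g hg)) (hL.dense_domain g)
  have hcl : IsClosed {f : Lp ℝ 2 μ | inner ℝ (T t f) g = inner ℝ f (T t g)} :=
    isClosed_eq (by fun_prop) (by fun_prop)
  exact (hcl.closure_subset_iff.2 (fun f hf => h1 f hf g)) (hL.dense_domain f)

/-- `⟨u, Lφ⟩` is the limit of `⟨(u - T_h u)/h, φ⟩`, hence at most `K ‖φ‖` in absolute value. So `u`
lies in the domain of the adjoint, which is `L` itself. -/
theorem IsHeatSemigroup.mem_domain_of_lipschitz (hT : IsHeatSemigroup L T)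
    (hL : IsNonnegSelfAdjoint L) {u : Lp ℝ 2 μ} {K : ℝ}
    (hu : ∀ᶠ h : ℝ in 𝓝[>] 0, ‖u - T h u‖ ≤ K * h) : u ∈ L.domain := by
  have e : L.adjoint = L := hL.selfAdjoint
  rw [← e]
  rw [LinearPMap.mem_adjoint_domain_iff]
  have hb : ∀ φ : L.domain, ‖((innerₛₗ ℝ u).comp L.toFun) φ‖ ≤ K * ‖φ‖ := by
    intro φ
    have h1 : Tendsto (fun t : ℝ => ‖inner ℝ u (t⁻¹ • ((φ : Lp ℝ 2 μ) - T t φ))‖) (𝓝[>] 0)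
        (𝓝 ‖inner ℝ u (L φ)‖) := by
      have := hT.tendsto_applyL φ.2
      rw [applyL_of_mem L φ.2] at this
      exact (tendsto_const_nhds.inner this).norm
    refine le_of_tendsto h1 ?_
    filter_upwards [hu, self_mem_nhdsWithin] with t ht ht0
    have ht0' : (0 : ℝ) < t := ht0
    have e2 : inner ℝ u (t⁻¹ • ((φ : Lp ℝ 2 μ) - T t φ)) =
        t⁻¹ * inner ℝ (u - T t u) (φ : Lp ℝ 2 μ) := by
      rw [inner_smul_right, inner_sub_right, inner_sub_left, hT.inner_comm hL ht0'.le]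
    rw [e2, norm_mul, Real.norm_of_nonneg (inv_nonneg.2 ht0'.le)]
    calc t⁻¹ * ‖inner ℝ (u - T t u) (φ : Lp ℝ 2 μ)‖ ≤ t⁻¹ * (K * t * ‖(φ : Lp ℝ 2 μ)‖) := by
          gcongr
          exact (norm_inner_le_norm _ _).trans (by gcongr)
      _ = K * ‖φ‖ := by field_simp; rfl
  exact AddMonoidHomClass.continuous_of_bound _ K hb

/-! ### Powers of the generator -/

theorem powL_add_apply (j k : ℕ) (f : Lp ℝ 2 μ) : powL L (j + k) f = powL L j (powL L k f) :=
  Function.iterate_add_apply _ _ _ _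

theorem IsHeatSemigroup.powL_comm (hT : IsHeatSemigroup L T) {s : ℝ} (hs : 0 ≤ s) (n : ℕ)
    {g : Lp ℝ 2 μ} (hg : ∀ j < n, powL L j g ∈ L.domain) :
    powL L n (T s g) = T s (powL L n g) := by
  induction n with
  | zero => rfl
  | succ n ih =>
    rw [powL_succ, powL_succ, ih fun j hj => hg j (by omega),
      (hT.domain_and_comm hs (hg n (by omega))).2]

/-- Halving the time: one factor `T_{t/2}` absorbs the lower powers of `L`, the other puts the
result in the domain. -/
theorem IsHeatSemigroup.powL_mem (hT : IsHeatSemigroup L T)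
    (hs : ∀ t : ℝ, 0 < t → ∀ f, T t f ∈ L.domain) (n : ℕ) {t : ℝ} (ht : 0 < t) (f : Lp ℝ 2 μ) :
    powL L n (T t f) ∈ L.domain := by
  induction n using Nat.strong_induction_on generalizing t f with
  | _ n ih =>
    have e : T t f = T (t / 2) (T (t / 2) f) := by
      rw [← hT.add_apply (by positivity) (by positivity), add_halves]
    rw [e, hT.powL_comm (by positivity) n fun j hj => ih j hj (half_pos ht) f]
    exact hs _ (half_pos ht) _

end Semigroup

/-! ### The setting of the estimates -/

section Setting

variable {M : Type*} [MetricSpace M] [MeasurableSpace M] [BorelSpace M] {μ : Measure M} {D : ℝ≥0}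
  {L : Lp ℝ 2 μ →ₗ.[ℝ] Lp ℝ 2 μ} {T : ℝ → Lp ℝ 2 μ →L[ℝ] Lp ℝ 2 μ} {p : ℝ → M → M → ℝ}

/-- What the proof uses of the heat semigroup: smoothing and weighted bounds. -/
structure HeatSetting (L : Lp ℝ 2 μ →ₗ.[ℝ] Lp ℝ 2 μ) (T : ℝ → Lp ℝ 2 μ →L[ℝ] Lp ℝ 2 μ) :
    Prop where
  integrable_weight : ∀ o : M, ∃ m : ℕ, ∫⁻ x, ENNReal.ofReal (((1 + dist o x) ^ m)⁻¹ ^ 2) ∂μ < ∞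
  semigroup : IsHeatSemigroup L T
  smoothing : ∀ t : ℝ, 0 < t → ∀ f, T t f ∈ L.domain
  -- Times up to `2`, because a product of operators at times `s, t ≤ 1` lives at time `s + t`. The
  -- case `q = 1` serves duality, `q = 2` the topology of test functions.
  bound : ∀ q : ℝ≥0∞, q = 1 ∨ q = 2 → ∀ m k : ℕ, ∃ S : ℝ≥0, ∀ t ∈ Ioc (0 : ℝ) 2,
    ∀ (o : M) (f : Lp ℝ 2 μ), wnorm q o m (opQ L T k t f) ≤ S * wnorm q o m f

theorem wnorm_two_zero (o : M) (v : Lp ℝ 2 μ) : wnorm 2 o 0 v = ‖v‖ₑ := by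
  simp [wnorm, Lp.enorm_def]

/-- Pointwise Gaussian domination of the semigroup and of its increments. -/
theorem exists_kernel_domination [SecondCountableTopology M] [SFinite μ]
    (hD : IsDoublingWith μ D) (hL : IsNonnegSelfAdjoint L)
    (hp : IsHeatKernel L T p) (hUE : GaussianUpperBound μ p) :
    ∃ c : ℝ, 0 < c ∧ ∃ C : ℝ≥0,
      (∀ t ∈ Ioc (0 : ℝ) 1, ∀ f : Lp ℝ 2 μ, ∀ᵐ x ∂μ,
        ‖T t f x‖ₑ ≤ ∫⁻ y, (C * ENNReal.ofReal (gaussKernel μ c 0 t x y)) * ‖f y‖ₑ ∂μ) ∧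
      ∀ t₀ : ℝ, 0 < t₀ → 2 * t₀ ≤ 1 → ∀ s ∈ Ioo t₀ (2 * t₀), ∀ u ∈ Ioo t₀ (2 * t₀),
        ∀ f : Lp ℝ 2 μ, ∀ᵐ x ∂μ, ‖(T s f - T u f) x‖ₑ ≤
          ∫⁻ y, (((C * (|s - u| / t₀).toNNReal : ℝ≥0) : ℝ≥0∞) *
            ENNReal.ofReal (gaussKernel μ c 0 t₀ x y)) * ‖f y‖ₑ ∂μ := by
  obtain ⟨c, hc, C, h1, h2⟩ := hUE.exists_bounds hD
  obtain ⟨S, hS⟩ := hD.exists_lintegral_gaussKernel_le hc 0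
  have hS1 : ∀ (K : ℝ≥0), ∀ t ∈ Ioc (0 : ℝ) 1, ∀ x,
      ∫⁻ y, (K : ℝ≥0∞) * ENNReal.ofReal (gaussKernel μ c 0 t x y) ∂μ ≤ ((K * S : ℝ≥0) : ℝ≥0∞) := by
    intro K t ht x
    rw [lintegral_const_mul' _ _ (by simp)]
    push_cast
    gcongr
    exact hS t ht x
  have hS2 : ∀ (K : ℝ≥0), ∀ t ∈ Ioc (0 : ℝ) 1, ∀ y,
      ∫⁻ x, (K : ℝ≥0∞) * ENNReal.ofReal (gaussKernel μ c 0 t x y) ∂μ ≤ ((K * S : ℝ≥0) : ℝ≥0∞) := by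
    intro K t ht y
    simp_rw [gaussKernel_comm c 0 t _ y]
    exact hS1 K t ht y
  have hkm : ∀ (K : ℝ≥0) (t : ℝ), Measurable (Function.uncurry
      fun x y : M => (K : ℝ≥0∞) * ENNReal.ofReal (gaussKernel μ c 0 t x y)) := fun K t =>
    ((measurable_gaussKernel c 0 t).ennreal_ofReal).const_mul _
  have hfm : ∀ f : Lp ℝ 2 μ, Measurable fun y => ‖f y‖ₑ := fun g =>
    (Lp.stronglyMeasurable g).measurable.enorm
  have hfin : ∀ t ∈ Ioc (0 : ℝ) 1, ∀ f : Lp ℝ 2 μ, ∀ᵐ x ∂μ,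
      ∫⁻ y, (C * ENNReal.ofReal (gaussKernel μ c 0 t x y)) * ‖f y‖ₑ ∂μ < ∞ := by
    intro t ht f
    have h3 := schur_sq _ (hkm C t) _ (hS1 C t ht) (hS2 C t ht) _ (hfm f).aemeasurable
    rw [lintegral_enorm_sq] at h3
    have h4 := ae_lt_top ((measurable_lintegral_kernel _ (hkm C t) f).pow_const 2)
      (ne_of_lt (h3.trans_lt (by finiteness)))
    filter_upwards [h4] with x hx
    exact ((ENNReal.pow_lt_top_iff).1 hx).resolve_right (by simp)
  have hpt : ∀ t ∈ Ioc (0 : ℝ) 1, ∀ᵐ x ∂μ, ∀ᵐ y ∂μ,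
      ‖p t x y‖ₑ ≤ C * ENNReal.ofReal (gaussKernel μ c 0 t x y) := by
    intro t ht
    filter_upwards [Measure.ae_ae_of_ae_prod (h1 t ht)] with x hx
    filter_upwards [hx] with y hy
    rw [Real.enorm_eq_ofReal_abs]
    refine (ENNReal.ofReal_le_ofReal hy).trans ?_
    rw [ENNReal.ofReal_mul (by positivity)]
    simp
  refine ⟨c, hc, C, fun t ht f => ?_, fun t₀ h0 h01 s hs u hu f => ?_⟩
  · refine ae_enorm_le_of_dense _ (hkm C t) _ (hS1 C t ht) (hS2 C t ht) (T t) _ hL.dense_domain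
      (fun g hg => ?_) f
    filter_upwards [hp.repr t ht.1 g hg, hpt t ht] with x hx hx2
    rw [hx]
    refine (enorm_integral_le_lintegral_enorm _).trans (lintegral_mono_ae ?_)
    filter_upwards [hx2] with y hy
    rw [enorm_mul]
    gcongr
  · have hsub : Ioo t₀ (2 * t₀) ⊆ Ioc 0 1 := fun x hx => ⟨h0.trans hx.1, hx.2.le.trans h01⟩
    have ht₀ : t₀ ∈ Ioc (0 : ℝ) 1 := ⟨h0, by linarith⟩
    have h := ae_enorm_le_of_dense _ (hkm (C * (|s - u| / t₀).toNNReal) t₀) _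
      (hS1 _ t₀ ht₀) (hS2 _ t₀ ht₀) (T s - T u) _ hL.dense_domain (fun g hg => ?_) f
    · exact h
    -- Integrability is needed before the two kernel integrals can be merged into one with kernel `p
    -- s - p u`.
    · have hint : ∀ t ∈ Ioc (0 : ℝ) 1, ∀ᵐ x ∂μ, Integrable (fun y => p t x y * g y) μ := by
        intro t ht
        filter_upwards [hpt t ht, hfin t ht g] with x hx hx2
        refine ⟨(((hp.measurable t ht.1).of_uncurry_left).aestronglyMeasurable).mul
          (Lp.aestronglyMeasurable g), ?_⟩
        refine lt_of_le_of_lt (lintegral_mono_ae ?_) hx2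
        filter_upwards [hx] with y hy
        rw [enorm_mul]
        gcongr
      filter_upwards [hp.repr s (hsub hs).1 g hg, hp.repr u (hsub hu).1 g hg,
        hint s (hsub hs), hint u (hsub hu), Lp.coeFn_sub (T s g) (T u g),
        Measure.ae_ae_of_ae_prod (h2 t₀ h0 h01 s hs u hu)] with x x1 x2 x3 x4 x5 x6
      have e : (T s - T u) g = T s g - T u g := rfl
      rw [e, x5, Pi.sub_apply, x1, x2, ← integral_sub x3 x4]
      refine (enorm_integral_le_lintegral_enorm _).trans (lintegral_mono_ae ?_)
      filter_upwards [x6] with y hy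
      rw [← sub_mul, enorm_mul]
      gcongr
      rw [Real.enorm_eq_ofReal_abs]
      refine (ENNReal.ofReal_le_ofReal hy).trans ?_
      rw [ENNReal.ofReal_mul (by positivity), ENNReal.ofReal_mul (by positivity)]
      simp only [ENNReal.ofReal_coe_nnreal, ENNReal.coe_mul]
      rfl

/-- The coefficient is small when `s` and `t` are far apart; it is the source of the factor
`min(t/s, s/t)` in the final estimate. -/
theorem IsHeatSemigroup.opQ_comp (hT : IsHeatSemigroup L T)
    (hs : ∀ t : ℝ, 0 < t → ∀ f, T t f ∈ L.domain) (j k : ℕ) {s t : ℝ} (hs0 : 0 < s) (ht0 : 0 < t)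
    (f : Lp ℝ 2 μ) :
    opQ L T j s (opQ L T k t f) = (s ^ j * t ^ k / (s + t) ^ (j + k)) • opQ L T (j + k) (s + t) f := by
  unfold opQ
  have h1 : ∀ n, powL L n (powL L k (T t f)) ∈ L.domain := fun n => by
    rw [← powL_add_apply]; exact hT.powL_mem hs _ ht0 f
  rw [map_smul, powL_smul L j _ fun n => hT.powL_mem hs n hs0 _,
    hT.powL_comm hs0.le j fun n _ => h1 n, ← powL_add_apply, hT.add_apply hs0.le ht0.le,
    hT.powL_comm hs0.le (j + k) fun n _ => hT.powL_mem hs n ht0 f, smul_smul, smul_smul]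
  congr 1
  have : 0 < s + t := by positivity
  field_simp

/-- Kernel increments make `h ↦ T_h T_t f` Lipschitz at `0`, so `T_t f` is in the domain. Dividing
by `h` and letting `h → 0` bounds `tL e^{-tL}`, and an induction composing factors reaches every
order. -/
theorem heatSetting [SecondCountableTopology M] [SFinite μ] (o : M)
    (hD : IsDoublingWith μ D) (hL : IsNonnegSelfAdjoint L) (hT : IsHeatSemigroup L T)
    (hp : IsHeatKernel L T p) (hUE : GaussianUpperBound μ p) : HeatSetting L T := by
  obtain ⟨c, hc, C, h1, h2⟩ := exists_kernel_domination hD hL hp hUE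
  -- increments at a fixed time
  have hinc : ∀ t ∈ Ioc (0 : ℝ) (1 / 2), ∀ h ∈ Ioo (0 : ℝ) (t / 3), ∀ q : ℝ≥0∞, q = 1 ∨ q = 2 →
      ∀ (m : ℕ) (S : ℝ≥0), (∀ t ∈ Ioc (0 : ℝ) 1, ∀ (o : M) (K : ℝ≥0) (f v : Lp ℝ 2 μ),
        (∀ᵐ x ∂μ, ‖v x‖ₑ ≤ ∫⁻ y, (K * ENNReal.ofReal (gaussKernel μ c 0 t x y)) * ‖f y‖ₑ ∂μ) →
        wnorm q o m v ≤ K * S * wnorm q o m f) → ∀ (o : M) (f : Lp ℝ 2 μ),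
      wnorm q o m (T t f - T h (T t f)) ≤
        ((C * (h / (2 * t / 3)).toNNReal : ℝ≥0) : ℝ≥0∞) * S * wnorm q o m f := by
    intro t ht h hh q hq m S hS o f
    have ht0 : 0 < t := ht.1
    -- With `t₀ = 2t/3` both `t` and `t + h` lie in `(t₀, 2t₀)` because `h < t/3`; `t ≤ 1/2` keeps
    -- `2t₀` below `1`.
    have := h2 (2 * t / 3) (by positivity) (by linarith [ht.2]) t
      ⟨by linarith, by linarith⟩ (h + t) ⟨by linarith [hh.1], by linarith [hh.2]⟩ f
    have e : |t - (h + t)| = h := by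
      rw [show t - (h + t) = -h by ring, abs_neg, abs_of_pos hh.1]
    rw [e, hT.add_apply hh.1.le ht0.le] at this
    exact hS (2 * t / 3) ⟨by positivity, by linarith [ht.2]⟩ o _ f _ this
  have hsm2 : ∀ t ∈ Ioc (0 : ℝ) (1 / 2), ∀ f, T t f ∈ L.domain := by
    intro t ht f
    obtain ⟨S, hS⟩ := hD.exists_wnorm_le hc (q := 2) (Or.inr rfl) 0
    refine hT.mem_domain_of_lipschitz hL (K := C * (2 * t / 3)⁻¹ * S * ‖f‖) ?_
    have ht3 : (0 : ℝ) < t / 3 := by linarith [ht.1]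
    filter_upwards [Ioo_mem_nhdsGT ht3] with h hh
    have h3 := hinc t ht h hh 2 (Or.inr rfl) 0 S hS o f
    rw [wnorm_two_zero, wnorm_two_zero] at h3
    have h4 := ENNReal.toReal_mono (by finiteness) h3
    rw [toReal_enorm] at h4
    refine h4.trans (le_of_eq ?_)
    have ht0 := ht.1
    have hh0 := hh.1
    have hpos : 0 ≤ h / (2 * t / 3) := by positivity
    simp only [ENNReal.toReal_mul, toReal_enorm, ENNReal.coe_toReal, NNReal.coe_mul]
    rw [Real.coe_toNNReal _ hpos]
    ring
  have hsm : ∀ t : ℝ, 0 < t → ∀ f, T t f ∈ L.domain := by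
    intro t ht f
    rcases le_total t (1 / 2) with h | h
    · exact hsm2 t ⟨ht, h⟩ f
    · have e : T t f = T (t - 1 / 2) (T (1 / 2) f) := by
        rw [← hT.add_apply (by linarith) (by norm_num)]; ring_nf
      rw [e]
      exact (hT.domain_and_comm (by linarith) (hsm2 _ ⟨by norm_num, le_rfl⟩ f)).1
  refine ⟨hD.exists_lintegral_weight_lt_top, hT, hsm, fun q hq m => ?_⟩
  obtain ⟨S, hS⟩ := hD.exists_wnorm_le hc hq m
  have hb0 : ∀ t ∈ Ioc (0 : ℝ) 1, ∀ (o : M) (f : Lp ℝ 2 μ),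
      wnorm q o m (T t f) ≤ (C * S : ℝ≥0∞) * wnorm q o m f := fun t ht o f =>
    hS t ht o C f _ (h1 t ht f)
  have hb1 : ∀ t ∈ Ioc (0 : ℝ) (1 / 2), ∀ (o : M) (f : Lp ℝ 2 μ),
      wnorm q o m (opQ L T 1 t f) ≤ (2 * C * S : ℝ≥0∞) * wnorm q o m f := by
    intro t ht o f
    have ht0 := ht.1
    have hlim := (hT.tendsto_applyL (hsm t ht.1 f)).const_smul t
    have e : opQ L T 1 t f = t • applyL L (T t f) := by simp [opQ, powL]
    rw [e]
    -- The weighted bound holds for the difference quotients, with constant `3/2` rounded up to `2`,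
    -- and survives their `L²` limit.
    refine (isClosed_wnorm_le q o m _).mem_of_tendsto hlim ?_
    have ht3 : (0 : ℝ) < t / 3 := by linarith [ht.1]
    filter_upwards [Ioo_mem_nhdsGT ht3] with h hh
    show wnorm q o m _ ≤ _
    have hh0 := hh.1
    rw [smul_smul, wnorm_smul]
    refine (mul_le_mul' le_rfl (hinc t ht h hh q hq m S hS o f)).trans ?_
    rw [← mul_assoc, ← mul_assoc]
    refine mul_le_mul' (mul_le_mul' ?_ le_rfl) le_rfl
    have : ‖t * h⁻¹‖ₑ * ((C * (h / (2 * t / 3)).toNNReal : ℝ≥0) : ℝ≥0∞) =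
        ENNReal.ofReal (3 / 2) * C := by
      rw [Real.enorm_of_nonneg (by positivity), ENNReal.coe_mul, mul_comm (C : ℝ≥0∞), ← mul_assoc]
      congr 1
      rw [← ENNReal.ofReal, ← ENNReal.ofReal_mul (by positivity)]
      congr 1
      field_simp
    rw [this]
    gcongr
    rw [show (2 : ℝ≥0∞) = ENNReal.ofReal 2 by simp]
    exact ENNReal.ofReal_le_ofReal (by norm_num)
  intro k
  induction k with
  | zero =>
    refine ⟨(C * S) * (C * S), fun t ht o f => ?_⟩
    have e : opQ L T 0 t f = T (t / 2) (T (t / 2) f) := by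
      rw [← hT.add_apply (by linarith [ht.1]) (by linarith [ht.1]), add_halves]
      simp [opQ, powL]
    have h2 : t / 2 ∈ Ioc (0 : ℝ) 1 := ⟨by linarith [ht.1], by linarith [ht.2]⟩
    rw [e]
    refine (hb0 _ h2 o _).trans ?_
    push_cast
    rw [mul_assoc (C * S : ℝ≥0∞)]
    gcongr
    exact hb0 _ h2 o _
  | succ k ih =>
    obtain ⟨S', hS'⟩ := ih
    refine ⟨4 * (4 / 3) ^ k * (2 * C * S) * S', fun t ht o f => ?_⟩
    have ht0 := ht.1
    -- For `t ≤ 2` the quarter `t/4` is in the range of `hb1`, and `3t/4` is in that of the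
    -- induction hypothesis.
    have hc := hT.opQ_comp hsm 1 k (s := t / 4) (t := 3 * t / 4) (by positivity) (by positivity) f
    have e : opQ L T (k + 1) t f = (4 * (4 / 3) ^ k : ℝ) • opQ L T 1 (t / 4) (opQ L T k (3 * t / 4) f) := by
      rw [hc, smul_smul, show t / 4 + 3 * t / 4 = t by ring, add_comm 1 k]
      have : (4 * (4 / 3) ^ k : ℝ) * ((t / 4) ^ 1 * (3 * t / 4) ^ k / t ^ (k + 1)) = 1 := by
        rw [show (3 * t / 4) = (4 / 3 : ℝ)⁻¹ * t by ring, mul_pow, inv_pow, pow_succ]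
        field_simp
        ring
      rw [this, one_smul]
    rw [e, wnorm_smul, Real.enorm_of_nonneg (by positivity)]
    have e2 : ENNReal.ofReal (4 * (4 / 3) ^ k : ℝ) = ((4 * (4 / 3) ^ k : ℝ≥0) : ℝ≥0∞) := by
      rw [← ENNReal.ofReal_coe_nnreal]; simp
    rw [e2]
    calc _ ≤ ((4 * (4 / 3) ^ k : ℝ≥0) : ℝ≥0∞) * ((2 * C * S : ℝ≥0∞) * (S' * wnorm q o m f)) := by
          gcongr
          refine (hb1 _ ⟨by positivity, by linarith [ht.2]⟩ o _).trans ?_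
          gcongr
          exact hS' _ ⟨by positivity, by linarith [ht.2]⟩ o f
      _ = _ := by push_cast; ring

end Setting

/-! ### Weighted interpolation -/

section Interpolation

variable {M : Type*} [MetricSpace M] [MeasurableSpace M] [BorelSpace M] {μ : Measure M}
  {L : Lp ℝ 2 μ →ₗ.[ℝ] Lp ℝ 2 μ} {T : ℝ → Lp ℝ 2 μ →L[ℝ] Lp ℝ 2 μ} {o : M}

/-- Cauchy–Schwarz. It upgrades plain `L²` convergence to weighted convergence whenever the norm of
doubled weight stays bounded. -/
theorem wnorm_sq_le (o : M) (m : ℕ) (v : Lp ℝ 2 μ) :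
    wnorm 2 o m v ^ 2 ≤ ‖v‖ₑ * wnorm 2 o (2 * m) v := by
  refine (ENNReal.pow_le_pow_left_iff (two_ne_zero)).1 ?_
  rw [mul_pow, ← lintegral_enorm_sq, wnorm, wnorm, eLpNorm_two_sq, eLpNorm_two_sq]
  refine le_trans (le_of_eq ?_) ((lintegral_mul_sq_le (μ := μ) (fun x => ‖v x‖ₑ ^ 2)
    (fun x => ‖(1 + dist o x) ^ m‖ₑ ^ 2)
    ((Lp.stronglyMeasurable v).measurable.enorm.pow_const 2).aemeasurable
    ((measurable_weight o m).enorm.pow_const 2).aemeasurable).trans (le_of_eq ?_))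
  · congr 2; ext x
    rw [enorm_mul]; ring
  · congr 2; ext x
    simp only [enorm_mul, enorm_pow]; ring

theorem exists_wnorm_one_le {m : ℕ}
    (hm : ∫⁻ x, ENNReal.ofReal (((1 + dist o x) ^ m)⁻¹ ^ 2) ∂μ < ∞) :
    ∃ C : ℝ≥0, ∀ v : Lp ℝ 2 μ, wnorm 1 o 0 v ≤ C * wnorm 2 o m v := by
  set I := ∫⁻ x, ENNReal.ofReal (((1 + dist o x) ^ m)⁻¹ ^ 2) ∂μ
  refine ⟨NNReal.sqrt I.toNNReal, fun v => ?_⟩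
  refine (ENNReal.pow_le_pow_left_iff (two_ne_zero)).1 ?_
  have hI : ((NNReal.sqrt I.toNNReal : ℝ≥0) : ℝ≥0∞) ^ 2 = I := by
    rw [← ENNReal.coe_pow, NNReal.sq_sqrt, ENNReal.coe_toNNReal hm.ne]
  rw [mul_pow, hI, wnorm, wnorm, eLpNorm_two_sq, eLpNorm_one_eq_lintegral_enorm]
  refine le_trans (le_of_eq ?_) ((lintegral_mul_sq_le (μ := μ)
    (fun x => ENNReal.ofReal (((1 + dist o x) ^ m)⁻¹ ^ 2))
    (fun x => ENNReal.ofReal (((1 + dist o x) ^ m) ^ 2) * ‖v x‖ₑ)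
    (((measurable_weight o m).inv.pow_const 2).ennreal_ofReal).aemeasurable
    ((((measurable_weight o m).pow_const 2).ennreal_ofReal).mul
      (Lp.stronglyMeasurable v).measurable.enorm).aemeasurable).trans (le_of_eq ?_))
  · congr 2; ext x
    have hw : 0 < (1 + dist o x) ^ m := by positivity
    rw [← mul_assoc, ← ENNReal.ofReal_mul (by positivity), ← mul_pow, inv_mul_cancel₀ hw.ne']
    simp
  · congr 2; ext x
    have hw : 0 < (1 + dist o x) ^ m := by positivity
    rw [mul_pow, ← mul_assoc, enorm_mul, mul_pow, Real.enorm_of_nonneg hw.le,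
      ← ENNReal.ofReal_pow (by positivity), ← ENNReal.ofReal_pow hw.le,
      ← ENNReal.ofReal_mul (by positivity)]
    congr 2
    field_simp

/-- `(T_s f - T_t f)/(t - s)` is the average of `T_r L f` over `(s, t]`; the averaged vectors lie in
a closed convex set of `L²`, hence so does the average. -/
theorem HeatSetting.exists_wnorm_sub_le (h : HeatSetting L T) {q : ℝ≥0∞} (hq : q = 1 ∨ q = 2)
    (m : ℕ) : ∃ S : ℝ≥0, ∀ (o : M) (f : Lp ℝ 2 μ), f ∈ L.domain → ∀ s t : ℝ, 0 < s → s ≤ t → t ≤ 2 →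
      wnorm q o m (T s f - T t f) ≤ S * ENNReal.ofReal (t - s) * wnorm q o m (applyL L f) := by
  obtain ⟨S, hS⟩ := h.bound q hq m 0
  refine ⟨S, fun o f hf s t hs hst ht => ?_⟩
  have hq1 : 1 ≤ q := by rcases hq with rfl | rfl <;> norm_num
  rcases hst.eq_or_lt with rfl | hlt
  · have : wnorm q o m (0 : Lp ℝ 2 μ) = 0 := by
      have := wnorm_smul q o m 0 (0 : Lp ℝ 2 μ)
      simpa using this
    simp [this]
  have hint := h.semigroup.integral_eq hs.le hst hf
  rw [intervalIntegral.integral_of_le hst] at hint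
  have hav := Convex.set_average_mem (μ := volume) (t := Ioc s t)
    (f := fun r => T r (applyL L f))
    (convex_wnorm_le hq1 o m (S * wnorm q o m (applyL L f))) (isClosed_wnorm_le q o m _)
    (by simp [hlt]) (by simp) (by
      filter_upwards [ae_restrict_mem measurableSet_Ioc] with r hr
      have := hS r ⟨hs.trans hr.1, hr.2.trans ht⟩ o (applyL L f)
      simpa [opQ, powL] using this) (by
      have hc : ContinuousOn (fun r => T r (applyL L f)) (Icc s t) :=
        (h.semigroup.continuousOn _).mono fun r hr => hs.le.trans hr.1
      exact (hc.integrableOn_Icc).mono_set Ioc_subset_Icc_self)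
  rw [setAverage_eq, hint] at hav
  have hvol : volume.real (Ioc s t) = t - s := by simp [hst]
  rw [hvol] at hav
  have e : T s f - T t f = (t - s) • ((t - s)⁻¹ • (T s f - T t f)) := by
    rw [smul_smul, mul_inv_cancel₀ (sub_pos.2 hlt).ne', one_smul]
  rw [e, wnorm_smul, Real.enorm_of_nonneg (sub_nonneg.2 hst)]
  calc _ ≤ ENNReal.ofReal (t - s) * (S * wnorm q o m (applyL L f)) := by
        gcongr; exact hav
    _ = _ := by ring

end Interpolation

/-! ### Test functions -/

section Test

variable {M : Type*} [MetricSpace M] [MeasurableSpace M] [BorelSpace M] {μ : Measure M}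
  {L : Lp ℝ 2 μ →ₗ.[ℝ] Lp ℝ 2 μ} {T : ℝ → Lp ℝ 2 μ →L[ℝ] Lp ℝ 2 μ} {o : M}

theorem withSeminorms_test : WithSeminorms (testSeminorm L o) := ⟨rfl⟩

instance : IsTopologicalAddGroup (TestFun L o) := withSeminorms_test.topologicalAddGroup

instance : ContinuousSMul ℝ (TestFun L o) := withSeminorms_test.continuousSMul

theorem TestFun.ext {φ ψ : TestFun L o} (h : φ.toL2 = ψ.toL2) : φ = ψ := Subtype.ext h

theorem TestFun.toL2_add (φ ψ : TestFun L o) : (φ + ψ).toL2 = φ.toL2 + ψ.toL2 := rfl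

theorem TestFun.toL2_smul (r : ℝ) (φ : TestFun L o) : (r • φ).toL2 = r • φ.toL2 := rfl

theorem TestFun.powL_mem (φ : TestFun L o) (n : ℕ) : powL L n φ.toL2 ∈ L.domain := (φ.mem n).1

theorem TestFun.wnorm_lt_top (φ : TestFun L o) (m n : ℕ) : wnorm 2 o m (powL L n φ.toL2) < ∞ :=
  ((φ.mem n).2 m).2

theorem testSeminorm_apply (m n : ℕ) (φ : TestFun L o) :
    testSeminorm L o (m, n) φ = (wnorm 2 o m (powL L n φ.toL2)).toReal :=
  Lp.norm_toLp _ ((φ.mem n).2 m)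

theorem mem_testSubmodule {f : Lp ℝ 2 μ} (h1 : ∀ n, powL L n f ∈ L.domain)
    (h2 : ∀ m n, wnorm 2 o m (powL L n f) < ∞) : f ∈ testSubmodule L o :=
  fun n => ⟨h1 n, fun m => ⟨aestronglyMeasurable_weight_mul o m _, h2 m n⟩⟩

/-- `L` acting on test functions. -/
def TestFun.lap (φ : TestFun L o) : TestFun L o :=
  (⟨applyL L φ.toL2, fun n => φ.mem (n + 1)⟩ : testSubmodule L o)

theorem TestFun.powL_lap (n : ℕ) (φ : TestFun L o) :
    powL L n φ.lap.toL2 = powL L (n + 1) φ.toL2 := rfl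

theorem TestFun.toL2_lap_iterate (k : ℕ) (φ : TestFun L o) :
    (TestFun.lap^[k] φ).toL2 = powL L k φ.toL2 := by
  induction k generalizing φ with
  | zero => rfl
  | succ k ih => rw [Function.iterate_succ_apply, ih]; rfl

theorem mapTest_of_mem (A : Lp ℝ 2 μ → Lp ℝ 2 μ) (φ : TestFun L o)
    (h : A φ.toL2 ∈ testSubmodule L o) : mapTest A φ = (⟨A φ.toL2, h⟩ : testSubmodule L o) :=
  dif_pos h

theorem TestFun.powL_add (n : ℕ) (φ ψ : TestFun L o) :
    powL L n (φ + ψ).toL2 = powL L n φ.toL2 + powL L n ψ.toL2 :=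
  SemigroupPara.powL_add L n φ.powL_mem ψ.powL_mem

theorem TestFun.powL_smul (n : ℕ) (r : ℝ) (φ : TestFun L o) :
    powL L n (r • φ).toL2 = r • powL L n φ.toL2 :=
  SemigroupPara.powL_smul L n r φ.powL_mem

/-- `Q_t^{(k)}` acting on test functions, `0 < t ≤ 2`. -/
def testQ (T : ℝ → Lp ℝ 2 μ →L[ℝ] Lp ℝ 2 μ) (k : ℕ) (t : ℝ) (φ : TestFun L o) : TestFun L o :=
  mapTest (opQ L T k t) φ

theorem HeatSetting.powL_opQ (h : HeatSetting L T) (k n : ℕ) {t : ℝ} (ht : 0 < t) (u : Lp ℝ 2 μ) :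
    powL L n (opQ L T k t u) = (t ^ n)⁻¹ • opQ L T (n + k) t u := by
  unfold opQ
  rw [powL_smul L n _ fun j => ?_, ← powL_add_apply, smul_smul]
  · congr 1; field_simp; ring
  · rw [← powL_add_apply]; exact h.semigroup.powL_mem h.smoothing _ ht u

/-- `u` needs decay but no smoothness, so truncated bounded functions already produce test
functions; the uniqueness of bounded representatives relies on this. -/
theorem HeatSetting.opQ_mem (h : HeatSetting L T) (k : ℕ) {t : ℝ} (ht : t ∈ Ioc (0 : ℝ) 2)
    {u : Lp ℝ 2 μ} (hu : ∀ m, wnorm 2 o m u < ∞) : opQ L T k t u ∈ testSubmodule L o := by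
  refine mem_testSubmodule (fun n => ?_) fun m n => ?_
  · rw [h.powL_opQ k n ht.1]
    exact L.domain.smul_mem _ (L.domain.smul_mem _ (h.semigroup.powL_mem h.smoothing _ ht.1 u))
  · rw [h.powL_opQ k n ht.1, wnorm_smul]
    obtain ⟨S, hS⟩ := h.bound 2 (Or.inr rfl) m (n + k)
    have := hu m
    exact ENNReal.mul_lt_top (by simp) ((hS t ht o u).trans_lt (by finiteness))

theorem HeatSetting.toL2_testQ (h : HeatSetting L T) (k : ℕ) {t : ℝ} (ht : t ∈ Ioc (0 : ℝ) 2)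
    (φ : TestFun L o) : (testQ T k t φ).toL2 = opQ L T k t φ.toL2 := by
  have hm : opQ L T k t φ.toL2 ∈ testSubmodule L o :=
    h.opQ_mem k ht fun m => φ.wnorm_lt_top m 0
  rw [testQ, mapTest_of_mem _ _ hm]
  rfl

theorem HeatSetting.powL_testQ (h : HeatSetting L T) (k n : ℕ) {t : ℝ} (ht : t ∈ Ioc (0 : ℝ) 2)
    (φ : TestFun L o) : powL L n (testQ T k t φ).toL2 = opQ L T k t (powL L n φ.toL2) := by
  rw [h.toL2_testQ k ht, h.powL_opQ k n ht.1]
  unfold opQ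
  rw [h.semigroup.powL_comm ht.1.le _ fun j _ => φ.powL_mem j, h.semigroup.powL_comm ht.1.le _
    fun j _ => by rw [← powL_add_apply]; exact φ.powL_mem _, ← powL_add_apply, smul_smul,
    add_comm k n]
  congr 1
  have := ht.1
  field_simp
  rw [pow_add]

theorem HeatSetting.testQ_add (h : HeatSetting L T) (k : ℕ) {t : ℝ} (ht : t ∈ Ioc (0 : ℝ) 2)
    (φ ψ : TestFun L o) : testQ T k t (φ + ψ) = testQ T k t φ + testQ T k t ψ := by
  apply TestFun.ext
  rw [TestFun.toL2_add, h.toL2_testQ k ht, h.toL2_testQ k ht, h.toL2_testQ k ht, TestFun.toL2_add]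
  unfold opQ
  rw [map_add, powL_add L k (fun n => h.semigroup.powL_mem h.smoothing n ht.1 _)
    (fun n => h.semigroup.powL_mem h.smoothing n ht.1 _), smul_add]

theorem HeatSetting.testQ_smul (h : HeatSetting L T) (k : ℕ) {t : ℝ} (ht : t ∈ Ioc (0 : ℝ) 2)
    (r : ℝ) (φ : TestFun L o) : testQ T k t (r • φ) = r • testQ T k t φ := by
  apply TestFun.ext
  rw [TestFun.toL2_smul, h.toL2_testQ k ht, h.toL2_testQ k ht, TestFun.toL2_smul]
  unfold opQ
  rw [map_smul, powL_smul L k r (fun n => h.semigroup.powL_mem h.smoothing n ht.1 _), smul_comm]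

/-- Moves the powers of `L` onto `φ`, so that regularity in `t` need only be proved for `e^{-tL}` on
a fixed test function. -/
theorem HeatSetting.testQ_eq (h : HeatSetting L T) (k : ℕ) {t : ℝ} (ht : t ∈ Ioc (0 : ℝ) 2)
    (φ : TestFun L o) : testQ T k t φ = t ^ k • testQ T 0 t (TestFun.lap^[k] φ) := by
  apply TestFun.ext
  rw [TestFun.toL2_smul, h.toL2_testQ k ht, h.toL2_testQ 0 ht, TestFun.toL2_lap_iterate]
  unfold opQ
  rw [h.semigroup.powL_comm ht.1.le _ fun j _ => φ.powL_mem j]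
  simp [powL]

theorem HeatSetting.testQ_comp (h : HeatSetting L T) (j k : ℕ) {s t : ℝ} (hs : 0 < s) (ht : 0 < t)
    (hst : s + t ≤ 2) (φ : TestFun L o) :
    testQ T j s (testQ T k t φ) = (s ^ j * t ^ k / (s + t) ^ (j + k)) • testQ T (j + k) (s + t) φ := by
  apply TestFun.ext
  rw [TestFun.toL2_smul, h.toL2_testQ j ⟨hs, by linarith⟩, h.toL2_testQ k ⟨ht, by linarith⟩,
    h.toL2_testQ _ ⟨by linarith, hst⟩, h.semigroup.opQ_comp h.smoothing j k hs ht]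

theorem HeatSetting.wnorm_one_lt_top (h : HeatSetting L T) (φ : TestFun L o) :
    wnorm 1 o 0 φ.toL2 < ∞ := by
  obtain ⟨m, hm⟩ := h.integrable_weight o
  obtain ⟨C, hC⟩ := exists_wnorm_one_le hm
  have := φ.wnorm_lt_top m 0
  exact (hC φ.toL2).trans_lt (ENNReal.mul_lt_top (by simp) this)

/-- The `L¹` norm on test functions. -/
def HeatSetting.l1 (h : HeatSetting L T) : Seminorm ℝ (TestFun L o) :=
  Seminorm.of (fun φ => (wnorm 1 o 0 φ.toL2).toReal)
    (fun φ ψ => by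
      have h1 := h.wnorm_one_lt_top φ
      have h2 := h.wnorm_one_lt_top ψ
      rw [← ENNReal.toReal_add h1.ne h2.ne]
      exact ENNReal.toReal_mono (by finiteness) (wnorm_add_le le_rfl o 0 _ _))
    (fun r φ => by
      rw [TestFun.toL2_smul, wnorm_smul, ENNReal.toReal_mul, toReal_enorm])

theorem HeatSetting.l1_apply (h : HeatSetting L T) (φ : TestFun L o) :
    h.l1 φ = (wnorm 1 o 0 φ.toL2).toReal := rfl

theorem HeatSetting.exists_l1_testQ_le (h : HeatSetting L T) (o : M) (k : ℕ) :
    ∃ S : ℝ≥0, ∀ t ∈ Ioc (0 : ℝ) 2, ∀ φ : TestFun L o, h.l1 (testQ T k t φ) ≤ S * h.l1 φ := by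
  obtain ⟨S, hS⟩ := h.bound 1 (Or.inl rfl) 0 k
  refine ⟨S, fun t ht φ => ?_⟩
  have h1 := h.wnorm_one_lt_top φ
  have := ENNReal.toReal_mono (by finiteness) (hS t ht o φ.toL2)
  rw [h.l1_apply, h.toL2_testQ k ht, h.l1_apply]
  simpa using this

theorem HeatSetting.exists_l1_le (h : HeatSetting L T) (o : M) :
    ∃ (m : ℕ) (C : ℝ≥0), ∀ φ : TestFun L o, h.l1 φ ≤ C * testSeminorm L o (m, 0) φ := by
  obtain ⟨m, hm⟩ := h.integrable_weight o
  obtain ⟨C, hC⟩ := exists_wnorm_one_le hm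
  refine ⟨m, C, fun φ => ?_⟩
  have h1 : wnorm 2 o m φ.toL2 < ∞ := φ.wnorm_lt_top m 0
  have := ENNReal.toReal_mono (by finiteness) (hC φ.toL2)
  rw [h.l1_apply, testSeminorm_apply, show powL L 0 φ.toL2 = φ.toL2 from rfl]
  simpa using this

theorem HeatSetting.exists_testSeminorm_sub_le (h : HeatSetting L T) (o : M) (m : ℕ) :
    ∃ S : ℝ≥0, ∀ (n : ℕ) (ψ : TestFun L o), ∀ s ∈ Ioc (0 : ℝ) 2, ∀ t ∈ Ioc (0 : ℝ) 2,
      testSeminorm L o (m, n) (testQ T 0 s ψ - testQ T 0 t ψ) ≤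
        S * |s - t| * testSeminorm L o (m, n + 1) ψ := by
  obtain ⟨S, hS⟩ := h.exists_wnorm_sub_le (q := 2) (Or.inr rfl) m
  refine ⟨S, fun n ψ => ?_⟩
  have key : ∀ s ∈ Ioc (0 : ℝ) 2, ∀ t ∈ Ioc (0 : ℝ) 2, s ≤ t →
      testSeminorm L o (m, n) (testQ T 0 s ψ - testQ T 0 t ψ) ≤
        S * |s - t| * testSeminorm L o (m, n + 1) ψ := by
    intro s hs t ht hst
    rw [testSeminorm_apply, testSeminorm_apply]
    have e : powL L n (testQ T 0 s ψ - testQ T 0 t ψ).toL2 =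
        T s (powL L n ψ.toL2) - T t (powL L n ψ.toL2) := by
      have e1 : testQ T 0 s ψ - testQ T 0 t ψ = testQ T 0 s ψ + (-1 : ℝ) • testQ T 0 t ψ := by
        rw [neg_one_smul, sub_eq_add_neg]
      rw [e1, TestFun.powL_add, TestFun.powL_smul, h.powL_testQ 0 n hs, h.powL_testQ 0 n ht]
      simp [opQ, powL, sub_eq_add_neg]
    rw [e]
    have h2 := hS o _ (ψ.powL_mem n) s t hs.1 hst ht.2
    rw [← powL_succ] at h2
    have h3 := ψ.wnorm_lt_top m (n + 1)
    have h4 := ENNReal.toReal_mono (by finiteness) h2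
    rw [abs_sub_comm, abs_of_nonneg (sub_nonneg.2 hst)]
    refine h4.trans (le_of_eq ?_)
    rw [ENNReal.toReal_mul, ENNReal.toReal_mul, ENNReal.toReal_ofReal (sub_nonneg.2 hst)]
    rfl
  intro s hs t ht
  rcases le_total s t with hst | hst
  · exact key s hs t ht hst
  · rw [← map_neg_eq_map, neg_sub, abs_sub_comm]
    exact key t ht s hs hst

theorem testSeminorm_sq_le (m n : ℕ) (φ : TestFun L o) :
    testSeminorm L o (m, n) φ ^ 2 ≤ ‖powL L n φ.toL2‖ * testSeminorm L o (2 * m, n) φ := by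
  rw [testSeminorm_apply, testSeminorm_apply]
  have h1 := φ.wnorm_lt_top (2 * m) n
  have := ENNReal.toReal_mono (by finiteness) (wnorm_sq_le o m (powL L n φ.toL2))
  simpa using this

/-- In `L²` this is the derivative of the semigroup. The remainder stays bounded in the seminorm of
weight `2m`, and `testSeminorm_sq_le` turns the `L²` limit into one in the seminorm of weight `m`.
-/
theorem HeatSetting.tendsto_slope_testQ (h : HeatSetting L T) (ψ : TestFun L o) {t : ℝ}
    (ht : t ∈ Ioo (0 : ℝ) 2) :
    Tendsto (fun r : ℝ => (r - t)⁻¹ • (testQ T 0 r ψ - testQ T 0 t ψ) + testQ T 0 t ψ.lap)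
      (𝓝[>] t) (𝓝 0) := by
  rw [withSeminorms_test.tendsto_nhds]
  rintro ⟨m, n⟩
  have hlt : ∀ᶠ r in 𝓝[>] t, r ∈ Ioo t 2 := Ioo_mem_nhdsGT ht.2
  set G : ℝ → TestFun L o := fun r =>
    (r - t)⁻¹ • (testQ T 0 r ψ - testQ T 0 t ψ) + testQ T 0 t ψ.lap with hG
  have hL2 : Tendsto (fun r => ‖powL L n (G r).toL2‖) (𝓝[>] t) (𝓝 0) := by
    have hd := h.semigroup.hasDerivWithinAt_right ht.1.le (ψ.powL_mem n)
    rw [hasDerivWithinAt_iff_tendsto_slope' (by simp)] at hd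
    have h2 := (hd.add_const (T t (applyL L (powL L n ψ.toL2)))).norm
    rw [neg_add_cancel, norm_zero] at h2
    refine h2.congr' ?_
    filter_upwards [hlt] with r hr
    have hr' : r ∈ Ioc (0 : ℝ) 2 := ⟨ht.1.trans hr.1, hr.2.le⟩
    have ht' : t ∈ Ioc (0 : ℝ) 2 := ⟨ht.1, ht.2.le⟩
    have e1 : G r = (r - t)⁻¹ • testQ T 0 r ψ + ((-(r - t)⁻¹) • testQ T 0 t ψ + testQ T 0 t ψ.lap) := by
      simp only [hG]; module
    rw [e1, TestFun.powL_add, TestFun.powL_add, TestFun.powL_smul, TestFun.powL_smul, h.powL_testQ 0 n hr',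
      h.powL_testQ 0 n ht', h.powL_testQ 0 n ht', TestFun.powL_lap, powL_succ, slope_def_module]
    simp only [opQ, powL, pow_zero, one_smul, Function.iterate_zero, id]
    congr 1
    module
  obtain ⟨S, hS⟩ := h.exists_testSeminorm_sub_le o (2 * m)
  set B := S * testSeminorm L o (2 * m, n + 1) ψ + testSeminorm L o (2 * m, n) (testQ T 0 t ψ.lap)
  have hbd : ∀ᶠ r in 𝓝[>] t, testSeminorm L o (2 * m, n) (G r) ≤ B := by
    filter_upwards [hlt] with r hr
    have hrt : 0 < r - t := sub_pos.2 hr.1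
    refine (map_add_le_add _ _ _).trans (add_le_add ?_ le_rfl)
    rw [map_smul_eq_mul, Real.norm_of_nonneg (inv_nonneg.2 hrt.le), inv_mul_le_iff₀ hrt]
    refine (hS n ψ r ⟨ht.1.trans hr.1, hr.2.le⟩ t ⟨ht.1, ht.2.le⟩).trans (le_of_eq ?_)
    rw [abs_of_pos hrt]; ring
  have hsq : Tendsto (fun r => testSeminorm L o (m, n) (G r) ^ 2) (𝓝[>] t) (𝓝 0) := by
    have h5 := hL2.mul_const B
    rw [zero_mul] at h5
    refine squeeze_zero' (Eventually.of_forall fun r => by positivity) ?_ h5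
    filter_upwards [hbd] with r hr
    refine (testSeminorm_sq_le m n (G r)).trans ?_
    gcongr
  have h6 := hsq.sqrt
  intro ε hε
  rw [Real.sqrt_zero] at h6
  filter_upwards [h6.eventually_lt_const hε] with r hr
  rw [Real.sqrt_sq (apply_nonneg _ _)] at hr
  simpa using hr

theorem HeatSetting.continuousOn_testQ (h : HeatSetting L T) (ψ : TestFun L o) :
    ContinuousOn (fun t => testQ T 0 t ψ) (Ioc (0 : ℝ) 2) := by
  intro t ht
  unfold ContinuousWithinAt
  rw [withSeminorms_test.tendsto_nhds]
  rintro ⟨m, n⟩ ε hε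
  obtain ⟨S, hS⟩ := h.exists_testSeminorm_sub_le o m
  have hlim : Tendsto (fun s => S * |s - t| * testSeminorm L o (m, n + 1) ψ) (𝓝[Ioc 0 2] t)
      (𝓝 0) := by
    have : Continuous fun s => S * |s - t| * testSeminorm L o (m, n + 1) ψ := by fun_prop
    have h2 := this.tendsto t
    simp only [sub_self, abs_zero, mul_zero, zero_mul] at h2
    exact h2.mono_left nhdsWithin_le_nhds
  filter_upwards [hlim.eventually_lt_const hε, self_mem_nhdsWithin] with s hs hs2
  exact (hS n ψ s hs2 t ht).trans_lt hs

theorem HeatSetting.hasDerivWithinAt_testQ (h : HeatSetting L T) (f : Distribution L o)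
    (ψ : TestFun L o) {t : ℝ} (ht : t ∈ Ioo (0 : ℝ) 2) :
    HasDerivWithinAt (fun r => f (testQ T 0 r ψ)) (-f (testQ T 0 t ψ.lap)) (Ioi t) t := by
  rw [hasDerivWithinAt_iff_tendsto_slope' (by simp)]
  have h1 := ((f.continuous.tendsto _).comp (h.tendsto_slope_testQ ψ ht)).sub_const
    (f (testQ T 0 t ψ.lap))
  simp only [map_zero, zero_sub] at h1
  refine h1.congr fun r => ?_
  simp [slope_def_module]

end Test

/-! ### Functionals bounded in `L¹` and bounded functions -/

section Duality

variable {M : Type*} [MetricSpace M] [MeasurableSpace M] [BorelSpace M] {μ : Measure M}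
  {L : Lp ℝ 2 μ →ₗ.[ℝ] Lp ℝ 2 μ} {T : ℝ → Lp ℝ 2 μ →L[ℝ] Lp ℝ 2 μ} {o : M}

theorem ae_norm_le_norm (g : Lp ℝ ∞ μ) : ∀ᵐ x ∂μ, ‖g x‖ ≤ ‖g‖ := by
  filter_upwards [ae_le_eLpNormEssSup (f := g) (μ := μ)] with x hx
  have h : ‖g‖ₑ = eLpNormEssSup g μ := by rw [Lp.enorm_def, eLpNorm_exponent_top]
  rw [← h] at hx
  have := ENNReal.toReal_mono (by finiteness) hx
  simpa using this

theorem integrable_mul_of_wnorm {v : Lp ℝ 2 μ} (hv : wnorm 1 o 0 v < ∞) (g : Lp ℝ ∞ μ) :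
    Integrable (fun x => g x * v x) μ ∧ |∫ x, g x * v x ∂μ| ≤ ‖g‖ * (wnorm 1 o 0 v).toReal := by
  have e : wnorm 1 o 0 v = eLpNorm v 1 μ := by simp [wnorm]
  rw [e] at hv ⊢
  have hvi : Integrable v μ := memLp_one_iff_integrable.1 ⟨Lp.aestronglyMeasurable v, hv⟩
  have hae : ∀ᵐ x ∂μ, ‖g x * v x‖ ≤ ‖g‖ * ‖v x‖ := by
    filter_upwards [ae_norm_le_norm g] with x hx
    rw [norm_mul]; gcongr
  have hint : Integrable (fun x => ‖g‖ * ‖v x‖) μ := hvi.norm.const_mul _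
  refine ⟨hint.mono' ((Lp.aestronglyMeasurable g).mul (Lp.aestronglyMeasurable v)) hae, ?_⟩
  refine (norm_integral_le_of_norm_le hint hae).trans (le_of_eq ?_)
  rw [integral_const_mul, integral_norm_eq_lintegral_enorm (Lp.aestronglyMeasurable v),
    eLpNorm_one_eq_lintegral_enorm]

theorem HeatSetting.abs_ofLinfty_le (h : HeatSetting L T) (g : Lp ℝ ∞ μ) (φ : TestFun L o) :
    |ofLinfty g φ| ≤ ‖g‖ * h.l1 φ :=
  (integrable_mul_of_wnorm (h.wnorm_one_lt_top φ) g).2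

/-- The linear functional attached to a bounded function. -/
def HeatSetting.linftyLinear (h : HeatSetting L T) (o : M) (g : Lp ℝ ∞ μ) :
    TestFun L o →ₗ[ℝ] ℝ where
  toFun := ofLinfty g
  map_add' φ ψ := by
    have h1 := (integrable_mul_of_wnorm (h.wnorm_one_lt_top φ) g).1
    have h2 := (integrable_mul_of_wnorm (h.wnorm_one_lt_top ψ) g).1
    unfold ofLinfty
    rw [← integral_add h1 h2]
    refine integral_congr_ae ?_
    filter_upwards [Lp.coeFn_add φ.toL2 ψ.toL2] with x hx
    rw [TestFun.toL2_add, hx, Pi.add_apply, mul_add]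
  map_smul' r φ := by
    unfold ofLinfty
    rw [RingHom.id_apply, smul_eq_mul, ← integral_const_mul]
    refine integral_congr_ae ?_
    filter_upwards [Lp.coeFn_smul r φ.toL2] with x hx
    rw [TestFun.toL2_smul, hx, Pi.smul_apply, smul_eq_mul]; ring

theorem continuous_of_testSeminorm_le (u : TestFun L o →ₗ[ℝ] ℝ) (i : ℕ × ℕ) (C : ℝ≥0)
    (hu : ∀ φ, |u φ| ≤ C * testSeminorm L o i φ) : Continuous u := by
  refine withSeminorms_test.continuous_normedSpace_rng _ u ⟨{i}, C, fun φ => ?_⟩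
  rw [Finset.sup_singleton]
  exact hu φ

/-- The distribution attached to a bounded function. -/
def HeatSetting.linftyDistribution (h : HeatSetting L T) (o : M) (g : Lp ℝ ∞ μ) :
    Distribution L o where
  toLinearMap := h.linftyLinear o g
  cont := by
    obtain ⟨m, C, hC⟩ := h.exists_l1_le o
    refine continuous_of_testSeminorm_le _ (m, 0) (‖g‖₊ * C) fun φ => ?_
    refine (h.abs_ofLinfty_le g φ).trans ?_
    change _ ≤ (‖g‖ * C) * testSeminorm L o (m, 0) φ
    rw [mul_assoc]
    gcongr
    exact hC φ

/-- The `L¹` norm is controlled by weighted `L²`, and that by interpolation between the `L²` norm,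
which tends to `0`, and a bounded norm of doubled weight. -/
theorem HeatSetting.tendsto_wnorm_one (h : HeatSetting L T) {u : Lp ℝ 2 μ}
    (hu : ∀ m, wnorm 2 o m u < ∞) :
    Tendsto (fun t : ℝ => wnorm 1 o 0 (u - T t u)) (𝓝[>] 0) (𝓝 0) := by
  obtain ⟨m, hm⟩ := h.integrable_weight o
  obtain ⟨C, hC⟩ := exists_wnorm_one_le hm
  obtain ⟨S, hS⟩ := h.bound 2 (Or.inr rfl) (2 * m) 0
  set B := wnorm 2 o (2 * m) u + S * wnorm 2 o (2 * m) u
  have hB : B ≠ ∞ := by have := hu (2 * m); finiteness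
  have h0 : Tendsto (fun t : ℝ => ‖u - T t u‖ₑ) (𝓝[>] 0) (𝓝 0) := by
    have h1 : Tendsto (fun t => T t u) (𝓝[>] 0) (𝓝 (T 0 u)) :=
      (h.semigroup.continuousOn u 0 (by simp)).mono_left (nhdsWithin_mono _ Ioi_subset_Ici_self)
    rw [h.semigroup.zero] at h1
    have := ((tendsto_const_nhds (x := u)).sub h1).enorm
    simpa using this
  have hsq : Tendsto (fun t : ℝ => wnorm 1 o 0 (u - T t u) ^ 2) (𝓝[>] 0) (𝓝 0) := by
    have h2 := ENNReal.Tendsto.mul_const (b := (C : ℝ≥0∞) ^ 2 * B) h0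
      (Or.inr (ENNReal.mul_ne_top (by simp) hB))
    rw [zero_mul] at h2
    refine tendsto_of_tendsto_of_tendsto_of_le_of_le' tendsto_const_nhds h2
      (Eventually.of_forall fun _ => zero_le) ?_
    filter_upwards [Ioc_mem_nhdsGT (show (0 : ℝ) < 2 by norm_num)] with t ht
    calc wnorm 1 o 0 (u - T t u) ^ 2 ≤ (C * wnorm 2 o m (u - T t u)) ^ 2 := by gcongr; exact hC _
      _ = C ^ 2 * wnorm 2 o m (u - T t u) ^ 2 := by rw [mul_pow]
      _ ≤ C ^ 2 * (‖u - T t u‖ₑ * B) := by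
        gcongr
        refine (wnorm_sq_le o m _).trans ?_
        gcongr
        refine (wnorm_sub_le (by norm_num) o _ _ _).trans ?_
        have := hS t ht o u
        simp only [opQ, powL, pow_zero, one_smul, Function.iterate_zero, id] at this
        exact add_le_add le_rfl this
      _ = _ := by ring
  have h3 := hsq.ennrpow_const (1 / 2)
  rw [ENNReal.zero_rpow_of_pos (by norm_num)] at h3
  refine h3.congr fun t => ?_
  rw [← ENNReal.rpow_natCast, ← ENNReal.rpow_mul]
  norm_num

/-- Test functions separate bounded functions. -/
theorem HeatSetting.eq_of_ofLinfty_eq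
    (hfin : ∀ n : ℕ, μ (Metric.ball o n) < ∞) (h : HeatSetting L T) {g₁ g₂ : Lp ℝ ∞ μ}
    (he : (ofLinfty g₁ : TestFun L o → ℝ) = ofLinfty g₂) : g₁ = g₂ := by
  rw [← sub_eq_zero]
  set g := g₁ - g₂ with hg
  have hz : ∀ φ : TestFun L o, ofLinfty g φ = 0 := by
    intro φ
    have h1 := (integrable_mul_of_wnorm (h.wnorm_one_lt_top φ) g₁).1
    have h2 := (integrable_mul_of_wnorm (h.wnorm_one_lt_top φ) g₂).1
    have h3 : ofLinfty g φ = ofLinfty g₁ φ - ofLinfty g₂ φ := by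
      unfold ofLinfty
      rw [← integral_sub h1 h2]
      refine integral_congr_ae ?_
      filter_upwards [Lp.coeFn_sub g₁ g₂] with x hx
      rw [hx, Pi.sub_apply, sub_mul]
    rw [h3, he, sub_self]
  -- Orthogonality extends from test functions to all rapidly decaying `u`, since `T_t u` is a test
  -- function and tends to `u` in `L¹`.
  have key : ∀ u : Lp ℝ 2 μ, (∀ m, wnorm 2 o m u < ∞) → ∫ x, g x * u x ∂μ = 0 := by
    intro u hu
    obtain ⟨m, hm⟩ := h.integrable_weight o
    obtain ⟨C, hC⟩ := exists_wnorm_one_le hm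
    have hu1 : wnorm 1 o 0 u < ∞ := (hC u).trans_lt (ENNReal.mul_lt_top (by simp) (hu m))
    have hle : ∀ t ∈ Ioc (0 : ℝ) 2,
        |∫ x, g x * u x ∂μ| ≤ ‖g‖ * (wnorm 1 o 0 (u - T t u)).toReal := by
      intro t ht
      let φ : TestFun L o := (⟨opQ L T 0 t u, h.opQ_mem 0 ht hu⟩ : testSubmodule L o)
      have hφ : φ.toL2 = T t u := by
        change opQ L T 0 t u = _
        simp [opQ, powL]
      have h1 := h.wnorm_one_lt_top φ
      rw [hφ] at h1
      have h2 : wnorm 1 o 0 (u - T t u) < ∞ :=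
        (wnorm_sub_le le_rfl o 0 _ _).trans_lt (ENNReal.add_lt_top.2 ⟨hu1, h1⟩)
      have h3 := hz φ
      unfold ofLinfty at h3
      rw [hφ] at h3
      have h4 : ∫ x, g x * u x ∂μ = ∫ x, g x * (u - T t u) x ∂μ := by
        rw [← sub_zero (∫ x, g x * u x ∂μ), ← h3,
          ← integral_sub (integrable_mul_of_wnorm hu1 g).1 (integrable_mul_of_wnorm h1 g).1]
        refine integral_congr_ae ?_
        filter_upwards [Lp.coeFn_sub u (T t u)] with x hx
        rw [hx, Pi.sub_apply, mul_sub]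
      rw [h4]
      exact (integrable_mul_of_wnorm h2 g).2
    have hlim : Tendsto (fun t : ℝ => ‖g‖ * (wnorm 1 o 0 (u - T t u)).toReal) (𝓝[>] 0) (𝓝 0) := by
      have := ((ENNReal.tendsto_toReal ENNReal.zero_ne_top).comp
        (h.tendsto_wnorm_one hu)).const_mul ‖g‖
      simpa using this
    have := ge_of_tendsto hlim (by
      filter_upwards [Ioc_mem_nhdsGT (show (0 : ℝ) < 2 by norm_num)] with t ht using hle t ht)
    exact abs_nonpos_iff.1 this
  -- Taking for `u` the truncation of `g` to a ball makes the pairing the integral of `g²` over that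
  -- ball.
  have hball : ∀ n : ℕ, ∀ᵐ x ∂μ, x ∈ Metric.ball o n → g x = 0 := by
    intro n
    have hmb : MeasurableSet (Metric.ball o (n : ℝ)) := Metric.isOpen_ball.measurableSet
    have hmem : ∀ m : ℕ, MemLp ((Metric.ball o (n : ℝ)).indicator
        fun x => (1 + dist o x) ^ m * g x) 2 μ := by
      intro m
      rw [memLp_indicator_iff_restrict hmb]
      have : IsFiniteMeasure (μ.restrict (Metric.ball o (n : ℝ))) := ⟨by simpa using hfin n⟩
      refine MemLp.of_bound (((measurable_weight o m).aestronglyMeasurable.mul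
        (Lp.aestronglyMeasurable g)).restrict) ((1 + n) ^ m * ‖g‖) ?_
      filter_upwards [ae_restrict_of_ae (ae_norm_le_norm g), ae_restrict_mem hmb] with x hx hxb
      rw [norm_mul, Real.norm_of_nonneg (by positivity)]
      have : dist o x ≤ n := by rw [dist_comm]; exact (Metric.mem_ball.1 hxb).le
      gcongr
    set u : Lp ℝ 2 μ := (hmem 0).toLp with hudef
    have hu : ∀ᵐ x ∂μ, u x = (Metric.ball o (n : ℝ)).indicator g x := by
      filter_upwards [(hmem 0).coeFn_toLp] with x hx
      rw [hx]; simp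
    have hu2 : ∀ m, wnorm 2 o m u < ∞ := by
      intro m
      refine lt_of_eq_of_lt ?_ (hmem m).2
      refine eLpNorm_congr_ae ?_
      filter_upwards [hu] with x hx
      rw [hx]
      by_cases hxb : x ∈ Metric.ball o (n : ℝ) <;> simp [hxb]
    have h0 := key u hu2
    obtain ⟨m, hm⟩ := h.integrable_weight o
    obtain ⟨C, hC⟩ := exists_wnorm_one_le hm
    have hu1 : wnorm 1 o 0 u < ∞ := (hC u).trans_lt (ENNReal.mul_lt_top (by simp) (hu2 m))
    have hpos : 0 ≤ᵐ[μ] fun x => g x * u x := by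
      filter_upwards [hu] with x hx
      rw [hx]
      by_cases hxb : x ∈ Metric.ball o (n : ℝ)
      · simp only [hxb, indicator_of_mem, Pi.zero_apply]; exact mul_self_nonneg _
      · simp [hxb]
    rw [integral_eq_zero_iff_of_nonneg_ae hpos (integrable_mul_of_wnorm hu1 g).1] at h0
    filter_upwards [h0, hu] with x hx1 hx2 hxb
    rw [hx2, indicator_of_mem hxb] at hx1
    simpa using hx1
  rw [← ae_all_iff] at hball
  apply Lp.ext
  filter_upwards [hball, Lp.coeFn_zero ℝ ∞ μ] with x hx hx0
  obtain ⟨n, hn⟩ := exists_nat_gt (dist x o)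
  rw [hx0]
  exact hx n (Metric.mem_ball.2 hn)

/-- Tested against `e = sign(γ) (|γ| - v)₊`, the hypothesis says that the integral of `(|γ| - v)₊²`
is nonpositive. -/
theorem lp_two_abs_le_of_inner_le (γ v : Lp ℝ 2 μ) (hv : ∀ᵐ x ∂μ, 0 ≤ v x)
    (h : ∀ g : Lp ℝ 2 μ, ∫ x, γ x * g x ∂μ ≤ ∫ x, v x * |g x| ∂μ) : ∀ᵐ x ∂μ, |γ x| ≤ v x := by
  set e : M → ℝ := fun x => SignType.sign (γ x) * max (|γ x| - v x) 0 with he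
  have habs : ∀ x, |e x| ≤ max (|γ x| - v x) 0 := by
    intro x
    simp only [he]
    rw [abs_mul, abs_of_nonneg (le_max_right (|γ x| - v x) 0)]
    refine mul_le_of_le_one_left (le_max_right _ _) ?_
    rcases lt_trichotomy (γ x) 0 with h | h | h <;> simp [h]
  have hem : AEStronglyMeasurable e μ := by
    have h1 : Measurable γ := (Lp.stronglyMeasurable γ).measurable
    have h2 : Measurable v := (Lp.stronglyMeasurable v).measurable
    have hs : Measurable fun x => ((SignType.sign (γ x) : SignType) : ℝ) := by
      have : (fun x => ((SignType.sign (γ x) : SignType) : ℝ)) =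
          fun x => if 0 < γ x then (1 : ℝ) else if γ x < 0 then -1 else 0 := by
        funext x
        rcases lt_trichotomy (γ x) 0 with h | h | h
        · simp [h, h.not_gt]
        · simp [h]
        · simp [h]
      rw [this]
      exact Measurable.ite (measurableSet_lt measurable_const h1) measurable_const
        (Measurable.ite (measurableSet_lt h1 measurable_const) measurable_const measurable_const)
    exact (hs.mul ((h1.abs.sub h2).max measurable_const)).aestronglyMeasurable
  have hmem : MemLp e 2 μ := by
    refine MemLp.of_le (Lp.memLp γ) hem ?_
    filter_upwards [hv] with x hx
    refine (habs x).trans (max_le ?_ (norm_nonneg _))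
    rw [Real.norm_eq_abs]; linarith
  set E : Lp ℝ 2 μ := hmem.toLp with hE
  have hEe : ∀ᵐ x ∂μ, E x = e x := hmem.coeFn_toLp
  have h1 := h E
  have i1 : Integrable (fun x => γ x * E x) μ := by
    have := L2.integrable_inner (𝕜 := ℝ) γ E
    simpa [mul_comm] using this
  have i2 : Integrable (fun x => v x * |E x|) μ := by
    have := (L2.integrable_inner (𝕜 := ℝ) v E).norm
    refine this.congr ?_
    filter_upwards [hv] with x hx
    simp [abs_of_nonneg hx, mul_comm]
  rw [← sub_nonpos, ← integral_sub i1 i2] at h1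
  have hae : ∀ᵐ x ∂μ, γ x * E x - v x * |E x| = max (|γ x| - v x) 0 ^ 2 := by
    filter_upwards [hEe, hv] with x hx hvx
    rw [hx]
    simp only [he]
    rcases le_total (|γ x| - v x) 0 with h | h
    · rw [max_eq_right h]; simp
    · rw [max_eq_left h]
      rcases lt_trichotomy (γ x) 0 with h2 | h2 | h2
      · rw [abs_of_neg h2] at h ⊢
        simp only [h2, sign_neg, SignType.coe_neg_one, neg_mul, one_mul, abs_neg]
        rw [abs_of_nonneg h]; ring
      · rw [h2] at h ⊢
        simp only [abs_zero, zero_sub] at h ⊢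
        have : v x = 0 := by linarith
        simp [this]
      · rw [abs_of_pos h2] at h ⊢
        simp only [h2, sign_pos, SignType.coe_one, one_mul]
        rw [abs_of_nonneg h]; ring
  have hpos : 0 ≤ᵐ[μ] fun x => γ x * E x - v x * |E x| := by
    filter_upwards [hae] with x hx
    rw [hx]; simp only [Pi.zero_apply]; positivity
  have h2 := le_antisymm h1 (integral_nonneg_of_ae hpos)
  rw [integral_eq_zero_iff_of_nonneg_ae hpos (i1.sub i2)] at h2
  filter_upwards [h2, hae] with x hx1 hx2
  rw [hx2] at hx1
  have h5 : max (|γ x| - v x) 0 = 0 := by simpa using hx1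
  have := le_max_left (|γ x| - v x) 0
  linarith

/-- A linear functional on test functions that is bounded in `L¹` is a bounded function. -/
theorem HeatSetting.exists_ofLinfty_eq (h : HeatSetting L T) (u : TestFun L o →ₗ[ℝ] ℝ) {K : ℝ}
    (hK : 0 ≤ K) (hu : ∀ φ, |u φ| ≤ K * h.l1 φ) :
    ∃ g : Lp ℝ ∞ μ, ⇑u = ofLinfty g ∧ ‖g‖ ≤ K := by
  obtain ⟨m, hm⟩ := h.integrable_weight o
  have hwpos : ∀ x : M, 0 < (1 + dist o x) ^ m := fun x => by positivity
  have hvm : MemLp (fun x => ((1 + dist o x) ^ m)⁻¹) 2 μ := by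
    refine ⟨(measurable_weight o m).inv.aestronglyMeasurable, ?_⟩
    have h1 : eLpNorm (fun x => ((1 + dist o x) ^ m)⁻¹) 2 μ ^ 2 < ∞ := by
      rw [eLpNorm_two_sq]
      refine lt_of_eq_of_lt (lintegral_congr fun x => ?_) hm
      rw [Real.enorm_of_nonneg (inv_nonneg.2 (hwpos x).le), ENNReal.ofReal_pow
        (inv_nonneg.2 (hwpos x).le)]
    exact (ENNReal.pow_lt_top_iff.1 h1).resolve_right (by simp)
  set v : Lp ℝ 2 μ := hvm.toLp with hv
  have hvae : ∀ᵐ x ∂μ, v x = ((1 + dist o x) ^ m)⁻¹ := hvm.coeFn_toLp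
  set W := weightedPow L o m 0 with hW
  have hWae : ∀ φ : TestFun L o, ∀ᵐ x ∂μ, W φ x = (1 + dist o x) ^ m * φ.toL2 x := fun φ =>
    ((φ.mem 0).2 m).coeFn_toLp
  have hinj : Function.Injective W := by
    intro φ ψ hφψ
    apply TestFun.ext
    apply Lp.ext
    filter_upwards [hWae φ, hWae ψ] with x h1 h2
    rw [hφψ, h2] at h1
    exact (mul_left_cancel₀ (hwpos x).ne' h1).symm
  -- The functional is transported to weighted functions in `L²`, so that Hahn–Banach and the Riesz
  -- theorem in Hilbert space replace the duality of `L¹` and `L^∞`.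
  let F : Lp ℝ 2 μ →ₗ.[ℝ] ℝ :=
    { domain := LinearMap.range W
      toFun := u.comp (LinearEquiv.ofInjective W hinj).symm.toLinearMap }
  have hF : ∀ φ, F ⟨W φ, LinearMap.mem_range_self W φ⟩ = u φ := by
    intro φ
    change u ((LinearEquiv.ofInjective W hinj).symm ⟨W φ, _⟩) = u φ
    congr 1
    rw [LinearEquiv.symm_apply_eq]
    rfl
  have hi : ∀ f : Lp ℝ 2 μ, Integrable (fun x => v x * |f x|) μ := by
    intro f
    refine ((L2.integrable_inner (𝕜 := ℝ) v f).norm).congr ?_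
    filter_upwards [hvae] with x hx
    simp only [RCLike.inner_apply, conj_trivial, norm_mul, Real.norm_eq_abs]
    rw [hx, abs_of_nonneg (inv_nonneg.2 (hwpos x).le), mul_comm]
  -- With `v` the inverse weight, `N (W φ)` equals `K ‖φ‖₁`; `N` is finite on all of `L²` because `v
  -- ∈ L²`.
  set N : Lp ℝ 2 μ → ℝ := fun f => K * ∫ x, v x * |f x| ∂μ with hN
  have hFN : ∀ x : F.domain, F x ≤ N x := by
    rintro ⟨_, φ, rfl⟩
    rw [hF]
    refine (le_abs_self _).trans ((hu φ).trans (le_of_eq ?_))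
    simp only [hN]
    congr 1
    have e1 : ∫ x, v x * |W φ x| ∂μ = ∫ x, ‖φ.toL2 x‖ ∂μ := by
      refine integral_congr_ae ?_
      filter_upwards [hvae, hWae φ] with x h1 h2
      rw [h1, h2, abs_mul, abs_of_pos (hwpos x), ← mul_assoc, inv_mul_cancel₀ (hwpos x).ne',
        one_mul, Real.norm_eq_abs]
    rw [e1, h.l1_apply, integral_norm_eq_lintegral_enorm (Lp.aestronglyMeasurable _), wnorm,
      eLpNorm_one_eq_lintegral_enorm]
    simp
  obtain ⟨G, hG1, hG2⟩ := exists_extension_of_le_sublinear F N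
    (fun c hc f => by
      simp only [hN]
      rw [mul_left_comm, ← integral_const_mul c]
      refine congrArg (K * ·) (integral_congr_ae ?_)
      filter_upwards [Lp.coeFn_smul c f] with x hx
      rw [hx, Pi.smul_apply, smul_eq_mul, abs_mul, abs_of_pos hc]; ring)
    (fun f g => by
      simp only [hN]
      rw [← mul_add, ← integral_add (hi f) (hi g)]
      refine mul_le_mul_of_nonneg_left (integral_mono_ae (hi _) ((hi f).add (hi g)) ?_) hK
      filter_upwards [Lp.coeFn_add f g, hvae] with x hx hvx
      rw [hx, Pi.add_apply, ← mul_add, hvx]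
      have := abs_add_le (f x) (g x)
      have := inv_nonneg.2 (hwpos x).le
      gcongr) hFN
  have hNle : ∀ f, N f ≤ K * ‖v‖ * ‖f‖ := by
    intro f
    simp only [hN]
    rw [mul_assoc]
    refine mul_le_mul_of_nonneg_left ?_ hK
    have e : ∫ x, v x * |f x| ∂μ = inner ℝ v |f| := by
      rw [L2.inner_def]
      refine integral_congr_ae ?_
      filter_upwards [Lp.coeFn_abs f] with x hx
      simp [hx, mul_comm]
    rw [e]
    refine (real_inner_le_norm _ _).trans (le_of_eq ?_)
    rw [norm_abs_eq_norm]
  have hGb : ∀ f, ‖G f‖ ≤ K * ‖v‖ * ‖f‖ := by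
    intro f
    rw [Real.norm_eq_abs, abs_le']
    refine ⟨(hG2 f).trans (hNle f), ?_⟩
    rw [← map_neg]
    refine (hG2 (-f)).trans ((hNle _).trans (by rw [norm_neg]))
  set γ : Lp ℝ 2 μ := (InnerProductSpace.toDual ℝ (Lp ℝ 2 μ)).symm (G.mkContinuous _ hGb) with hγ
  have hγG : ∀ f, ∫ x, γ x * f x ∂μ = G f := by
    intro f
    have : inner ℝ γ f = G f := by
      rw [hγ, InnerProductSpace.toDual_symm_apply]; rfl
    rw [← this, L2.inner_def]
    refine integral_congr_ae (Eventually.of_forall fun x => ?_)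
    simp [mul_comm]
  -- Domination of the extension by `N` gives a pointwise bound of its Riesz vector; multiplying by
  -- the weight yields a function bounded by `K`.
  have hγle : ∀ᵐ x ∂μ, |γ x| ≤ (K • v) x := by
    refine lp_two_abs_le_of_inner_le γ (K • v) ?_ fun f => ?_
    · filter_upwards [Lp.coeFn_smul K v, hvae] with x h1 h2
      rw [h1, Pi.smul_apply, h2, smul_eq_mul]
      have := hwpos x
      positivity
    · rw [hγG]
      refine (hG2 f).trans (le_of_eq ?_)
      simp only [hN]
      rw [← integral_const_mul]
      refine integral_congr_ae ?_
      filter_upwards [Lp.coeFn_smul K v] with x h1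
      rw [h1, Pi.smul_apply, smul_eq_mul, mul_assoc]
  have hgb : ∀ᵐ x ∂μ, ‖(1 + dist o x) ^ m * γ x‖ ≤ K := by
    filter_upwards [hγle, Lp.coeFn_smul K v, hvae] with x h1 h2 h3
    rw [h2, Pi.smul_apply, h3, smul_eq_mul] at h1
    rw [norm_mul, Real.norm_of_nonneg (hwpos x).le, Real.norm_eq_abs]
    calc _ ≤ (1 + dist o x) ^ m * (K * ((1 + dist o x) ^ m)⁻¹) :=
          mul_le_mul_of_nonneg_left h1 (hwpos x).le
      _ = K := by have := (hwpos x).ne'; field_simp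
  have hgm : MemLp (fun x => (1 + dist o x) ^ m * γ x) ∞ μ :=
    memLp_top_of_bound (aestronglyMeasurable_weight_mul o m γ) K hgb
  refine ⟨hgm.toLp, ?_, ?_⟩
  · funext φ
    rw [← hF φ, ← hG1 ⟨W φ, _⟩, ← hγG]
    refine integral_congr_ae ?_
    filter_upwards [hWae φ, hgm.coeFn_toLp] with x h1 h2
    rw [h1, h2]; ring
  · rw [Lp.norm_toLp, eLpNorm_exponent_top]
    refine ENNReal.toReal_le_of_le_ofReal hK ?_
    exact eLpNormEssSup_le_of_ae_bound hgb

theorem HeatSetting.abs_le_of_linftyNorm (h : HeatSetting L T) {u : TestFun L o → ℝ} {K : ℝ≥0∞}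
    (hK : K ≠ ∞) (hu : linftyNorm u ≤ K) (φ : TestFun L o) : |u φ| ≤ K.toReal * h.l1 φ := by
  refine le_of_forall_pos_le_add fun ε hε => ?_
  set δ := ε / (h.l1 φ + 1)
  have hl : 0 ≤ h.l1 φ := apply_nonneg _ _
  have hδ : 0 < δ := by positivity
  have hlt : linftyNorm u < K + ENNReal.ofReal δ :=
    hu.trans_lt (ENNReal.lt_add_right hK (by simpa using hδ))
  unfold linftyNorm at hlt
  simp only [iInf_lt_iff] at hlt
  obtain ⟨g, rfl, hg⟩ := hlt
  have hg' := ENNReal.toReal_mono (by finiteness) hg.le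
  rw [toReal_enorm, ENNReal.toReal_add hK (by simp), ENNReal.toReal_ofReal hδ.le] at hg'
  calc |ofLinfty g φ| ≤ ‖g‖ * h.l1 φ := h.abs_ofLinfty_le g φ
    _ ≤ (K.toReal + δ) * h.l1 φ := by gcongr
    _ = K.toReal * h.l1 φ + δ * h.l1 φ := by ring
    _ ≤ K.toReal * h.l1 φ + ε := by
      gcongr
      rw [div_mul_eq_mul_div, div_le_iff₀ (by positivity)]
      nlinarith

theorem HeatSetting.linftyNorm_le (h : HeatSetting L T) (u : TestFun L o →ₗ[ℝ] ℝ) {K : ℝ}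
    (hK : 0 ≤ K) (hu : ∀ φ, |u φ| ≤ K * h.l1 φ) : linftyNorm ⇑u ≤ ENNReal.ofReal K := by
  obtain ⟨g, hg, hgK⟩ := h.exists_ofLinfty_eq u hK hu
  refine (iInf₂_le g hg).trans ?_
  rw [← ofReal_norm]
  exact ENNReal.ofReal_le_ofReal hgK

end Duality

/-! ### Decay of the heat flow of Hölder distributions -/

section Decay

variable {M : Type*} [MetricSpace M] [MeasurableSpace M] [BorelSpace M] {μ : Measure M}
  {L : Lp ℝ 2 μ →ₗ.[ℝ] Lp ℝ 2 μ} {T : ℝ → Lp ℝ 2 μ →L[ℝ] Lp ℝ 2 μ} {o : M}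

theorem opQ_zero (t : ℝ) : opQ L T 0 t = ⇑(T t) := by
  funext f; simp [opQ, powL]

/-- The linear functional `Q_t^{(k)} f`. -/
def HeatSetting.evalQ (h : HeatSetting L T) (f : TestFun L o →ₗ[ℝ] ℝ) (k : ℕ) {t : ℝ}
    (ht : t ∈ Ioc (0 : ℝ) 2) : TestFun L o →ₗ[ℝ] ℝ where
  toFun φ := f (testQ T k t φ)
  map_add' φ ψ := by rw [h.testQ_add k ht, map_add]
  map_smul' r φ := by rw [h.testQ_smul k ht, map_smul]; rfl

/-- The differentiated function is `t^{-k} f(Q_t^{(k)} φ)`, so its derivative involves only the next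
order `k + 1`. -/
theorem HeatSetting.hasDerivWithinAt_flow (h : HeatSetting L T) (f : Distribution L o) (k : ℕ)
    (φ : TestFun L o) {t : ℝ} (ht : t ∈ Ioo (0 : ℝ) 2) :
    HasDerivWithinAt (fun r => f (testQ T 0 r (TestFun.lap^[k] φ)))
      (-((t ^ (k + 1))⁻¹ * f (testQ T (k + 1) t φ))) (Ici t) t := by
  have h1 := (h.hasDerivWithinAt_testQ f (TestFun.lap^[k] φ) ht).Ici_of_Ioi
  refine h1.congr_deriv ?_
  rw [h.testQ_eq (k + 1) ⟨ht.1, ht.2.le⟩, map_smul, smul_eq_mul, ← mul_assoc,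
    inv_mul_cancel₀ (pow_pos ht.1 _).ne', one_mul, Function.iterate_succ_apply']

theorem HeatSetting.continuousOn_flow (h : HeatSetting L T) (f : Distribution L o) (k : ℕ)
    (φ : TestFun L o) :
    ContinuousOn (fun r => f (testQ T 0 r (TestFun.lap^[k] φ))) (Ioc (0 : ℝ) 2) :=
  f.continuous.comp_continuousOn (h.continuousOn_testQ _)

/-- Integrating from `t` to `2` costs `A ∫_t^2 r^{σ/2-k-1} dr`. Since `k > σ/2` this is at most `A
t^{σ/2-k}/(k - σ/2)`, and multiplying by `t^k` restores `t^{σ/2}`. -/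
theorem HeatSetting.flow_bound_of_succ (h : HeatSetting L T) (f : Distribution L o) (k : ℕ)
    {σ A E : ℝ} (hk : σ / 2 < k) (hA : 0 ≤ A) (hE : 0 ≤ E) (φ : TestFun L o)
    (hsucc : ∀ t ∈ Ioc (0 : ℝ) 2, |f (testQ T (k + 1) t φ)| ≤ A * t ^ (σ / 2))
    (htwo : |f (testQ T k 2 φ)| ≤ 2 ^ k * E) {t : ℝ} (ht : t ∈ Ioc (0 : ℝ) 2) :
    |f (testQ T k t φ)| ≤ (E * 2 ^ (k - σ / 2) + A / (k - σ / 2)) * t ^ (σ / 2) := by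
  set κ : ℝ := k - σ / 2 with hκ
  have hκ0 : 0 < κ := sub_pos.2 hk
  have ht0 := ht.1
  set F : ℝ → ℝ := fun r => f (testQ T 0 r (TestFun.lap^[k] φ)) with hF
  have hQ : ∀ r ∈ Ioc (0 : ℝ) 2, f (testQ T k r φ) = r ^ k * F r := fun r hr => by
    rw [h.testQ_eq k hr, map_smul]; rfl
  have hB : ∀ r : ℝ, 0 < r → HasDerivAt (fun r : ℝ => A / κ * (t ^ (-κ) - r ^ (-κ)))
      (A * r ^ (-κ - 1)) r := by
    intro r hr
    have := ((Real.hasDerivAt_rpow_const (p := -κ) (Or.inl hr.ne')).const_sub (t ^ (-κ))).const_mul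
      (A / κ)
    refine this.congr_deriv ?_
    field_simp
  -- The comparison function is the primitive of `A r^{-κ-1}` vanishing at `r = t`.
  have hmv := image_norm_le_of_norm_deriv_right_le_deriv_boundary'
    (f := fun r => F r - F t) (a := t) (b := 2)
    (f' := fun r => -((r ^ (k + 1))⁻¹ * f (testQ T (k + 1) r φ)))
    (B := fun r : ℝ => A / κ * (t ^ (-κ) - r ^ (-κ))) (B' := fun r => A * r ^ (-κ - 1))
    (((h.continuousOn_flow f k φ).mono fun r hr => ⟨ht0.trans_le hr.1, hr.2⟩).sub
      continuousOn_const)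
    (fun r hr => (h.hasDerivWithinAt_flow f k φ ⟨ht0.trans_le hr.1, hr.2⟩).sub_const _)
    (by simp)
    (fun r hr => (hB r (ht0.trans_le hr.1)).continuousAt.continuousWithinAt)
    (fun r hr => (hB r (ht0.trans_le hr.1)).hasDerivWithinAt)
    (fun r hr => by
      have hr0 : 0 < r := ht0.trans_le hr.1
      rw [norm_neg, norm_mul, Real.norm_of_nonneg (by positivity), Real.norm_eq_abs]
      refine (mul_le_mul_of_nonneg_left (hsucc r ⟨hr0, hr.2.le⟩) (by positivity)).trans (le_of_eq ?_)
      rw [← Real.rpow_natCast, ← Real.rpow_neg hr0.le, mul_left_comm, ← Real.rpow_add hr0]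
      congr 2
      rw [hκ]; push_cast; ring) (right_mem_Icc.2 ht.2)
  have h2 : |F 2| ≤ E := by
    rw [hQ 2 (by norm_num), abs_mul, abs_of_pos (by positivity)] at htwo
    exact le_of_mul_le_mul_left htwo (by positivity)
  have hFt : |F t| ≤ E + A / κ * t ^ (-κ) := by
    have h3 : A / κ * (t ^ (-κ) - 2 ^ (-κ)) ≤ A / κ * t ^ (-κ) := by
      have : 0 ≤ A / κ * (2 : ℝ) ^ (-κ) := by positivity
      rw [mul_sub]; linarith
    have h4 : |F t| ≤ |F 2| + |F 2 - F t| := by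
      have := abs_sub (F 2) (F 2 - F t)
      rwa [sub_sub_cancel] at this
    rw [Real.norm_eq_abs] at hmv
    linarith
  rw [hQ t ht, abs_mul, abs_of_pos (by positivity)]
  have e1 : t ^ k = t ^ (σ / 2) * t ^ κ := by
    rw [← Real.rpow_natCast, ← Real.rpow_add ht0, hκ]; congr 1; ring
  calc t ^ k * |F t| ≤ t ^ k * (E + A / κ * t ^ (-κ)) := by gcongr
    _ = (E * t ^ κ + A / κ * (t ^ κ * t ^ (-κ))) * t ^ (σ / 2) := by rw [e1]; ring
    _ = (E * t ^ κ + A / κ) * t ^ (σ / 2) := by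
      rw [← Real.rpow_add ht0, add_neg_cancel, Real.rpow_zero, mul_one]
    _ ≤ _ := by
      gcongr
      exact ht.2

/-- `Q_t^{(k)} f` decays like `t^{σ/2}` for all `k > σ/2` if `f` has Hölder norm at most `N`. -/
theorem HeatSetting.exists_decay (h : HeatSetting L T) (o : M) (a : ℕ) (σ : ℝ) (k : ℕ)
    (hk : σ / 2 < k) :
    ∃ C : ℝ≥0, ∀ (f : Distribution L o) (N : ℝ), 0 ≤ N →
      (∀ φ, |f (testQ T 0 1 φ)| ≤ N * h.l1 φ) →
      (∀ t ∈ Ioc (0 : ℝ) 1, ∀ φ, |f (testQ T a t φ)| ≤ N * t ^ (σ / 2) * h.l1 φ) →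
      ∀ t ∈ Ioc (0 : ℝ) 2, ∀ φ, |f (testQ T k t φ)| ≤ C * N * t ^ (σ / 2) * h.l1 φ := by
  -- Induction on `j`, which bounds how far `k` may lie below `a`; each step descends from order `k
  -- + 1` to `k`.
  suffices H : ∀ j k : ℕ, a ≤ k + j → σ / 2 < k → ∃ C : ℝ≥0, ∀ (f : Distribution L o) (N : ℝ), 0 ≤ N →
      (∀ φ, |f (testQ T 0 1 φ)| ≤ N * h.l1 φ) →
      (∀ t ∈ Ioc (0 : ℝ) 1, ∀ φ, |f (testQ T a t φ)| ≤ N * t ^ (σ / 2) * h.l1 φ) →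
      ∀ t ∈ Ioc (0 : ℝ) 2, ∀ φ, |f (testQ T k t φ)| ≤ C * N * t ^ (σ / 2) * h.l1 φ from
    H a k (by omega) hk
  intro j
  induction j with
  | zero =>
    intro k hak hk
    -- For `k ≥ a`, `Q_t^{(k)} = 2^k Q_{t/2}^{(a)} Q_{t/2}^{(i)}`; for `t ≤ 2` the time `t/2` is one
    -- at which the Hölder norm gives information.
    obtain ⟨i, rfl⟩ : ∃ i, k = a + i := ⟨k - a, by omega⟩
    obtain ⟨S, hS⟩ := h.exists_l1_testQ_le o i
    refine ⟨2 ^ (a + i) * ((1 / 2 : ℝ) ^ (σ / 2)).toNNReal * S, fun f N hN h1 h2 t ht φ => ?_⟩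
    have ht0 := ht.1
    have e := h.testQ_comp a i (half_pos ht0) (half_pos ht0) (by rw [add_halves]; exact ht.2) φ
    rw [add_halves] at e
    have e2 : testQ T (a + i) t φ = (2 : ℝ) ^ (a + i) • testQ T a (t / 2) (testQ T i (t / 2) φ) := by
      rw [e, smul_smul]
      have : (2 : ℝ) ^ (a + i) * ((t / 2) ^ a * (t / 2) ^ i / t ^ (a + i)) = 1 := by
        rw [← pow_add, div_pow]; field_simp
      rw [this, one_smul]
    rw [e2, map_smul, smul_eq_mul, abs_mul, abs_of_pos (by positivity)]
    have h3 := h2 (t / 2) ⟨by positivity, by linarith [ht.2]⟩ (testQ T i (t / 2) φ)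
    have h4 := hS (t / 2) ⟨by positivity, by linarith [ht.2]⟩ φ
    have e3 : (t / 2) ^ (σ / 2) = (1 / 2 : ℝ) ^ (σ / 2) * t ^ (σ / 2) := by
      rw [← Real.mul_rpow (by norm_num) ht0.le]; congr 1; ring
    push_cast
    rw [Real.coe_toNNReal _ (by positivity)]
    calc _ ≤ (2 : ℝ) ^ (a + i) * (N * (t / 2) ^ (σ / 2) * (S * h.l1 φ)) := by
          gcongr
          exact h3.trans (by gcongr)
      _ = _ := by rw [e3]; ring
  | succ j ih =>
    intro k hak hk
    obtain ⟨C, hC⟩ := ih (k + 1) (by omega) (by push_cast; linarith)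
    obtain ⟨S, hS⟩ := h.exists_l1_testQ_le o k
    have hκ : 0 < (k : ℝ) - σ / 2 := sub_pos.2 hk
    refine ⟨S * ((2 : ℝ) ^ (k - σ / 2)).toNNReal + C / ((k : ℝ) - σ / 2).toNNReal,
      fun f N hN h1 h2 t ht φ => ?_⟩
    -- As `2 = 1 + 1`, `Q_2^{(k)} = 2^k e^{-L} Q_1^{(k)}`, so the `e^{-L}` part of the Hölder norm
    -- controls the endpoint.
    have htwo : |f (testQ T k 2 φ)| ≤ 2 ^ k * (N * (S * h.l1 φ)) := by
      have e := h.testQ_comp 0 k one_pos one_pos (by norm_num) φ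
      have e2 : testQ T k 2 φ = (2 : ℝ) ^ k • testQ T 0 1 (testQ T k 1 φ) := by
        rw [e, smul_smul]
        norm_num
      rw [e2, map_smul, smul_eq_mul, abs_mul, abs_of_pos (by positivity)]
      gcongr
      refine (h1 _).trans ?_
      gcongr
      exact hS 1 (by norm_num) φ
    have h5 := h.flow_bound_of_succ f k (A := C * N * h.l1 φ) hk (by positivity) (by positivity) φ
      (fun r hr => (hC f N hN h1 h2 r hr φ).trans (le_of_eq (by ring))) htwo ht
    refine h5.trans (le_of_eq ?_)
    push_cast
    rw [Real.coe_toNNReal _ (by positivity), Real.coe_toNNReal _ hκ.le]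
    ring

theorem HeatSetting.bounds_of_holderNorm (h : HeatSetting L T) (a : ℕ) (σ : ℝ)
    (f : Distribution L o) (hf : holderNorm T a σ f < ∞) :
    (∀ φ, |f (testQ T 0 1 φ)| ≤ (holderNorm T a σ f).toReal * h.l1 φ) ∧
    ∀ t ∈ Ioc (0 : ℝ) 1, ∀ φ,
      |f (testQ T a t φ)| ≤ (holderNorm T a σ f).toReal * t ^ (σ / 2) * h.l1 φ := by
  constructor
  · intro φ
    have h1 : linftyNorm (act (T 1) f) ≤ holderNorm T a σ f := le_self_add
    have h2 := h.abs_le_of_linftyNorm hf.ne h1 φ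
    simpa only [act, testQ, opQ_zero] using h2
  · intro t ht φ
    have ht0 := ht.1
    have h1 : linftyNorm (act (opQ L T a t) f) * ENNReal.ofReal (t ^ (-σ / 2)) ≤
        holderNorm T a σ f := by
      refine le_trans ?_ (le_add_self : _ ≤ linftyNorm (act (T 1) f) + _)
      exact le_iSup₂_of_le t ht le_rfl
    have h3 : linftyNorm (act (opQ L T a t) f) ≤
        holderNorm T a σ f * ENNReal.ofReal (t ^ (σ / 2)) := by
      calc linftyNorm (act (opQ L T a t) f)
          = linftyNorm (act (opQ L T a t) f) * ENNReal.ofReal (t ^ (-σ / 2)) *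
            ENNReal.ofReal (t ^ (σ / 2)) := by
            rw [mul_assoc, ← ENNReal.ofReal_mul (by positivity), ← Real.rpow_add ht0]
            rw [show -σ / 2 + σ / 2 = 0 by ring]; simp
        _ ≤ _ := by gcongr
    have h2 := h.abs_le_of_linftyNorm (by finiteness) h3 φ
    rw [ENNReal.toReal_mul, ENNReal.toReal_ofReal (by positivity)] at h2
    exact h2

/-! ### Bounded representatives -/

theorem HeatSetting.ofLinfty_add (h : HeatSetting L T) (g₁ g₂ : Lp ℝ ∞ μ) (φ : TestFun L o) :
    ofLinfty (g₁ + g₂) φ = ofLinfty g₁ φ + ofLinfty g₂ φ := by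
  unfold ofLinfty
  rw [← integral_add (integrable_mul_of_wnorm (h.wnorm_one_lt_top φ) g₁).1
    (integrable_mul_of_wnorm (h.wnorm_one_lt_top φ) g₂).1]
  refine integral_congr_ae ?_
  filter_upwards [Lp.coeFn_add g₁ g₂] with x hx
  rw [hx, Pi.add_apply, add_mul]

theorem ofLinfty_smul (r : ℝ) (g : Lp ℝ ∞ μ) (φ : TestFun L o) :
    ofLinfty (r • g) φ = r * ofLinfty g φ := by
  unfold ofLinfty
  rw [← integral_const_mul]
  refine integral_congr_ae ?_
  filter_upwards [Lp.coeFn_smul r g] with x hx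
  rw [hx, Pi.smul_apply, smul_eq_mul, mul_assoc]

theorem HeatSetting.ofLinfty_sum (h : HeatSetting L T) (n : ℕ) (g : ℕ → Lp ℝ ∞ μ)
    (φ : TestFun L o) :
    ofLinfty (∑ i ∈ Finset.range n, g i) φ = ∑ i ∈ Finset.range n, ofLinfty (g i) φ := by
  induction n with
  | zero =>
    have := ofLinfty_smul 0 (0 : Lp ℝ ∞ μ) φ
    simpa using this
  | succ n ih => rw [Finset.sum_range_succ, Finset.sum_range_succ, h.ofLinfty_add, ih]

/-- The bounded functions `Q_t^{(k)} f` can be chosen to depend continuously on `t`. -/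
theorem HeatSetting.exists_continuousOn_rep
    (hfin : ∀ n : ℕ, μ (Metric.ball o n) < ∞) (h : HeatSetting L T) (f : Distribution L o) (k : ℕ)
    {σ A A' : ℝ} (hA : 0 ≤ A) (hA' : 0 ≤ A') (hσ : σ / 2 ≤ k + 1)
    (h1 : ∀ t ∈ Ioc (0 : ℝ) 1, ∀ φ, |f (testQ T k t φ)| ≤ A * t ^ (σ / 2) * h.l1 φ)
    (h2 : ∀ t ∈ Ioc (0 : ℝ) 1, ∀ φ, |f (testQ T (k + 1) t φ)| ≤ A' * t ^ (σ / 2) * h.l1 φ) :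
    ∃ u : ℝ → Lp ℝ ∞ μ, ContinuousOn u (Ioc 0 1) ∧ ∀ t ∈ Ioc (0 : ℝ) 1,
      ‖u t‖ ≤ A * t ^ (σ / 2) ∧ ∀ φ, f (testQ T k t φ) = ofLinfty (u t) φ := by
  have h12 : ∀ {t : ℝ}, t ∈ Ioc (0 : ℝ) 1 → t ∈ Ioc (0 : ℝ) 2 := fun ht =>
    ⟨ht.1, ht.2.trans (by norm_num)⟩
  have hex : ∀ t : ℝ, ∃ g : Lp ℝ ∞ μ, t ∈ Ioc (0 : ℝ) 1 →
      ‖g‖ ≤ A * t ^ (σ / 2) ∧ ∀ φ, f (testQ T k t φ) = ofLinfty g φ := by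
    intro t
    by_cases ht : t ∈ Ioc (0 : ℝ) 1
    · have ht0 := ht.1
      obtain ⟨g, hg1, hg2⟩ := h.exists_ofLinfty_eq (h.evalQ f.toLinearMap k (h12 ht))
        (K := A * t ^ (σ / 2)) (by positivity) (h1 t ht)
      exact ⟨g, fun _ => ⟨hg2, fun φ => congrFun hg1 φ⟩⟩
    · exact ⟨0, fun h => absurd h ht⟩
  choose u hu using hex
  refine ⟨u, ?_, hu⟩
  -- `v t` represents `φ ↦ f(e^{-tL} L^k φ)`. Its increments are bounded through order `k + 1`; the
  -- exponent `σ/2 - (k+1)` is nonpositive, so the left endpoint is the worst.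
  set v : ℝ → Lp ℝ ∞ μ := fun t => (t ^ k)⁻¹ • u t with hv
  have hvF : ∀ t ∈ Ioc (0 : ℝ) 1, ∀ φ, f (testQ T 0 t (TestFun.lap^[k] φ)) = ofLinfty (v t) φ := by
    intro t ht φ
    have ht0 := ht.1
    simp only [hv]
    rw [ofLinfty_smul, ← (hu t ht).2 φ, h.testQ_eq k (h12 ht), map_smul, smul_eq_mul, ← mul_assoc,
      inv_mul_cancel₀ (by positivity), one_mul]
  have hlip : ∀ s t : ℝ, 0 < s → s ≤ t → t ≤ 1 →
      ‖v t - v s‖ ≤ A' * s ^ (σ / 2 - (k + 1)) * (t - s) := by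
    intro s t hs hst ht
    have hs1 : s ∈ Ioc (0 : ℝ) 1 := ⟨hs, hst.trans ht⟩
    have ht1 : t ∈ Ioc (0 : ℝ) 1 := ⟨hs.trans_le hst, ht⟩
    have hbd : ∀ φ : TestFun L o, |ofLinfty (v t - v s) φ| ≤ A' * s ^ (σ / 2 - (k + 1)) * (t - s) * h.l1 φ := by
      intro φ
      have e : ofLinfty (v t - v s) φ = f (testQ T 0 t (TestFun.lap^[k] φ)) -
          f (testQ T 0 s (TestFun.lap^[k] φ)) := by
        rw [hvF t ht1, hvF s hs1, sub_eq_add_neg, ← neg_one_smul ℝ (v s), h.ofLinfty_add,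
          ofLinfty_smul (-1) (v s)]
        ring
      rw [e]
      have := norm_image_sub_le_of_norm_deriv_right_le_segment (a := s) (b := t)
        (f := fun r => f (testQ T 0 r (TestFun.lap^[k] φ)))
        (C := A' * s ^ (σ / 2 - (k + 1)) * h.l1 φ)
        ((h.continuousOn_flow f k φ).mono fun r hr => ⟨hs.trans_le hr.1, by linarith [hr.2]⟩)
        (fun r hr => h.hasDerivWithinAt_flow f k φ ⟨hs.trans_le hr.1, by linarith [hr.2]⟩)
        (fun r hr => by
          have hr0 : 0 < r := hs.trans_le hr.1
          rw [norm_neg, norm_mul, Real.norm_of_nonneg (by positivity), Real.norm_eq_abs]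
          refine (mul_le_mul_of_nonneg_left (h2 r ⟨hr0, by linarith [hr.2]⟩ φ)
            (by positivity)).trans ?_
          calc (r ^ (k + 1))⁻¹ * (A' * r ^ (σ / 2) * h.l1 φ)
              = A' * r ^ (σ / 2 - (k + 1)) * h.l1 φ := by
                rw [← Real.rpow_natCast, ← Real.rpow_neg hr0.le, sub_eq_add_neg,
                  Real.rpow_add hr0]
                push_cast; ring
            _ ≤ _ := by
                refine mul_le_mul_of_nonneg_right (mul_le_mul_of_nonneg_left ?_ hA')
                  (apply_nonneg _ _)
                exact Real.rpow_le_rpow_of_nonpos hs hr.1 (by linarith)) t ⟨hst, le_rfl⟩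
      rw [Real.norm_eq_abs] at this
      exact this.trans (le_of_eq (by ring))
    have hnn : 0 ≤ A' * s ^ (σ / 2 - (k + 1)) * (t - s) := by
      have := sub_nonneg.2 hst
      positivity
    -- Duality only yields some representative of small norm; uniqueness identifies it with `v t - v
    -- s`.
    obtain ⟨g, hg1, hg2⟩ := h.exists_ofLinfty_eq (h.linftyLinear o (v t - v s)) hnn hbd
    have : v t - v s = g := h.eq_of_ofLinfty_eq hfin hg1
    rw [this]; exact hg2
  have hvc : ContinuousOn v (Ioc 0 1) := by
    intro t ht
    have ht0 := ht.1
    unfold ContinuousWithinAt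
    rw [tendsto_iff_norm_sub_tendsto_zero]
    have hlim : Tendsto (fun s => A' * (t / 2) ^ (σ / 2 - (k + 1)) * |s - t|) (𝓝[Ioc 0 1] t)
        (𝓝 0) := by
      have : Continuous fun s => A' * (t / 2) ^ (σ / 2 - (k + 1)) * |s - t| := by fun_prop
      have h2 := this.tendsto t
      simp only [sub_self, abs_zero, mul_zero] at h2
      exact h2.mono_left nhdsWithin_le_nhds
    refine squeeze_zero' (Eventually.of_forall fun _ => norm_nonneg _) ?_ hlim
    filter_upwards [self_mem_nhdsWithin,
      mem_nhdsWithin_of_mem_nhds (Ioi_mem_nhds (half_lt_self ht0))] with s hs hs2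
    have hmono : ∀ r : ℝ, t / 2 ≤ r → r ^ (σ / 2 - (k + 1)) ≤ (t / 2) ^ (σ / 2 - (k + 1)) :=
      fun r hr => Real.rpow_le_rpow_of_nonpos (by positivity) hr (by linarith)
    rcases le_total s t with hst | hst
    · rw [norm_sub_rev, abs_sub_comm, abs_of_nonneg (sub_nonneg.2 hst)]
      refine (hlip s t hs.1 hst ht.2).trans ?_
      have := sub_nonneg.2 hst
      gcongr A' * ?_ * _
      exact hmono s (le_of_lt hs2)
    · rw [abs_of_nonneg (sub_nonneg.2 hst)]
      refine (hlip t s ht.1 hst hs.2).trans ?_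
      have := sub_nonneg.2 hst
      gcongr A' * ?_ * _
      exact hmono t (by linarith)
  have hu' : ContinuousOn (fun t : ℝ => t ^ k • v t) (Ioc 0 1) :=
    (continuous_pow k).continuousOn.smul hvc
  refine hu'.congr fun t ht => ?_
  have ht0 := ht.1
  simp only [hv]
  rw [smul_smul, mul_inv_cancel₀ (by positivity), one_smul]

/-! ### The operators `P_t` and `(tL) P_t` on test functions -/

/-- `∑_{i < n} Q_t^{(j+i)} φ / i!`, which is `P_t^{(n)} φ` for `j = 0` and `(tL) P_t^{(n)} φ` for
`j = 1`. -/
def testSum (T : ℝ → Lp ℝ 2 μ →L[ℝ] Lp ℝ 2 μ) (j n : ℕ) (t : ℝ) (φ : TestFun L o) : TestFun L o :=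
  ∑ i ∈ Finset.range n, (i.factorial : ℝ)⁻¹ • testQ T (j + i) t φ

theorem TestFun.toL2_sum (n : ℕ) (F : ℕ → TestFun L o) :
    (∑ i ∈ Finset.range n, F i).toL2 = ∑ i ∈ Finset.range n, (F i).toL2 := by
  induction n with
  | zero => rfl
  | succ n ih => rw [Finset.sum_range_succ, Finset.sum_range_succ, TestFun.toL2_add, ih]

theorem HeatSetting.opP_eq (h : HeatSetting L T) (n : ℕ) {t : ℝ} (ht : t ∈ Ioc (0 : ℝ) 2)
    (φ : TestFun L o) : opP L T n t φ.toL2 = (testSum T 0 n t φ).toL2 := by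
  rw [testSum, TestFun.toL2_sum, opP]
  refine Finset.sum_congr rfl fun i _ => ?_
  rw [TestFun.toL2_smul, h.toL2_testQ _ ht, zero_add]

theorem HeatSetting.opLP_eq (h : HeatSetting L T) (n : ℕ) {t : ℝ} (ht : t ∈ Ioc (0 : ℝ) 2)
    (φ : TestFun L o) : opLP L T n t φ.toL2 = (testSum T 1 n t φ).toL2 := by
  rw [opLP, h.opP_eq n ht]
  have hlin : t • (testSum T 0 n t φ).lap = testSum T 1 n t φ := by
    unfold testSum
    induction n with
    | zero =>
      have : (0 : TestFun L o).lap = 0 := TestFun.ext (powL_zero_vec L 1)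
      simp [this]
    | succ n ih =>
      rw [Finset.sum_range_succ, Finset.sum_range_succ, ← ih]
      have e : ∀ (φ ψ : TestFun L o) (r : ℝ), (φ + r • ψ).lap = φ.lap + r • ψ.lap := by
        intro φ ψ r
        apply TestFun.ext
        have h1 := TestFun.powL_add 1 φ (r • ψ)
        rw [TestFun.powL_smul] at h1
        exact h1
      rw [e, smul_add, smul_comm t]
      congr 2
      apply TestFun.ext
      rw [TestFun.toL2_smul, h.toL2_testQ _ ht]
      have h2 := h.powL_testQ (0 + n) 1 ht φ
      have h3 : (testQ T (0 + n) t φ).lap.toL2 = powL L 1 (testQ T (0 + n) t φ).toL2 := rfl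
      rw [h3, h.toL2_testQ _ ht, h.powL_opQ _ _ ht.1, smul_smul, pow_one,
        mul_inv_cancel₀ ht.1.ne', one_smul, zero_add]
  rw [← hlin]
  rfl

theorem HeatSetting.mapTest_opP (h : HeatSetting L T) (n : ℕ) {t : ℝ} (ht : t ∈ Ioc (0 : ℝ) 2)
    (φ : TestFun L o) : mapTest (opP L T n t) φ = testSum T 0 n t φ := by
  have hm : opP L T n t φ.toL2 ∈ testSubmodule L o := by
    rw [h.opP_eq n ht]; exact TestFun.mem _
  rw [mapTest_of_mem _ _ hm]
  exact TestFun.ext (h.opP_eq n ht φ)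

theorem HeatSetting.mapTest_opLP (h : HeatSetting L T) (n : ℕ) {t : ℝ} (ht : t ∈ Ioc (0 : ℝ) 2)
    (φ : TestFun L o) : mapTest (opLP L T n t) φ = testSum T 1 n t φ := by
  have hm : opLP L T n t φ.toL2 ∈ testSubmodule L o := by
    rw [h.opLP_eq n ht]; exact TestFun.mem _
  rw [mapTest_of_mem _ _ hm]
  exact TestFun.ext (h.opLP_eq n ht φ)

theorem HeatSetting.exists_continuousOn_rep_sum
    (hfin : ∀ n : ℕ, μ (Metric.ball o n) < ∞) (h : HeatSetting L T) (f : Distribution L o)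
    (j n : ℕ) {σ N : ℝ} (A : ℕ → ℝ≥0) (hN : 0 ≤ N) (hσ : σ / 2 ≤ 1)
    (h1 : ∀ k, j ≤ k → ∀ t ∈ Ioc (0 : ℝ) 1, ∀ φ,
      |f (testQ T k t φ)| ≤ A k * N * t ^ (σ / 2) * h.l1 φ) :
    ∃ u : ℝ → Lp ℝ ∞ μ, ContinuousOn u (Ioc 0 1) ∧ ∀ t ∈ Ioc (0 : ℝ) 1,
      ‖u t‖ ≤ (∑ i ∈ Finset.range n, (i.factorial : ℝ)⁻¹ * A (j + i)) * N * t ^ (σ / 2) ∧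
      ∀ φ, f (testSum T j n t φ) = ofLinfty (u t) φ := by
  have hex : ∀ i : ℕ, ∃ u : ℝ → Lp ℝ ∞ μ, ContinuousOn u (Ioc 0 1) ∧ ∀ t ∈ Ioc (0 : ℝ) 1,
      ‖u t‖ ≤ A (j + i) * N * t ^ (σ / 2) ∧ ∀ φ, f (testQ T (j + i) t φ) = ofLinfty (u t) φ :=
    fun i => h.exists_continuousOn_rep hfin f (j + i) (A' := A (j + i + 1) * N) (by positivity)
      (by positivity) (by have : (0 : ℝ) ≤ ((j + i : ℕ) : ℝ) := by positivity
                          linarith)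
      (h1 (j + i) (by omega)) (h1 (j + i + 1) (by omega))
  choose u hu1 hu2 using hex
  refine ⟨fun t => ∑ i ∈ Finset.range n, (i.factorial : ℝ)⁻¹ • u i t, ?_, fun t ht => ⟨?_, ?_⟩⟩
  · exact continuousOn_finsetSum _ fun i _ =>
      ((hu1 i).const_smul ((i.factorial : ℝ)⁻¹)).congr fun t _ => rfl
  · refine (norm_sum_le _ _).trans ?_
    rw [Finset.sum_mul, Finset.sum_mul]
    refine Finset.sum_le_sum fun i _ => ?_
    rw [norm_smul, Real.norm_of_nonneg (by positivity), mul_assoc, mul_assoc]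
    have := (hu2 i t ht).1
    rw [mul_assoc] at this
    gcongr
  · intro φ
    rw [testSum, map_sum, h.ofLinfty_sum]
    refine Finset.sum_congr rfl fun i _ => ?_
    rw [map_smul, ofLinfty_smul, (hu2 i t ht).2, smul_eq_mul]

end Decay

/-! ### The paraproduct integral -/

section Paraproduct

variable {M : Type*} [MetricSpace M] [MeasurableSpace M] [BorelSpace M] {μ : Measure M}
  {L : Lp ℝ 2 μ →ₗ.[ℝ] Lp ℝ 2 μ} {T : ℝ → Lp ℝ 2 μ →L[ℝ] Lp ℝ 2 μ} {o : M}

theorem HeatSetting.testSum_add (h : HeatSetting L T) (j n : ℕ) {t : ℝ} (ht : t ∈ Ioc (0 : ℝ) 2)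
    (φ ψ : TestFun L o) : testSum T j n t (φ + ψ) = testSum T j n t φ + testSum T j n t ψ := by
  unfold testSum
  rw [← Finset.sum_add_distrib]
  exact Finset.sum_congr rfl fun i _ => by rw [h.testQ_add _ ht, smul_add]

theorem HeatSetting.testSum_smul (h : HeatSetting L T) (j n : ℕ) {t : ℝ} (ht : t ∈ Ioc (0 : ℝ) 2)
    (r : ℝ) (φ : TestFun L o) : testSum T j n t (r • φ) = r • testSum T j n t φ := by
  unfold testSum
  rw [Finset.smul_sum]
  exact Finset.sum_congr rfl fun i _ => by rw [h.testQ_smul _ ht, smul_comm]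

theorem HeatSetting.continuousOn_testQ' (h : HeatSetting L T) (k : ℕ) (φ : TestFun L o) :
    ContinuousOn (fun t => testQ T k t φ) (Ioc (0 : ℝ) 2) :=
  ((continuous_pow k).continuousOn.smul (h.continuousOn_testQ (TestFun.lap^[k] φ))).congr
    fun _ ht => h.testQ_eq k ht φ

theorem HeatSetting.continuousOn_testSum (h : HeatSetting L T) (j n : ℕ) (φ : TestFun L o) :
    ContinuousOn (fun t => testSum T j n t φ) (Ioc (0 : ℝ) 2) :=
  continuousOn_finsetSum _ fun i _ =>
    ((h.continuousOn_testQ' (j + i) φ).const_smul ((i.factorial : ℝ)⁻¹)).congr fun _ _ => rfl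

theorem HeatSetting.continuous_l1 (h : HeatSetting L T) :
    Continuous (h.l1 : TestFun L o → ℝ) := by
  obtain ⟨m, C, hC⟩ := h.exists_l1_le o
  have hc : Continuous (C • testSeminorm L o (m, 0)) := by
    have := (withSeminorms_test (L := L) (o := o)).continuous_seminorm (m, 0)
    exact this.const_smul C
  exact Seminorm.continuous_of_le hc fun φ => hC φ

/-- Norm continuity of `u` and local boundedness of `‖ψ t‖₁` allow both arguments to vary. This
supplies the measurability of the paraproduct integrand. -/
theorem HeatSetting.continuousOn_pairing (h : HeatSetting L T) {s : Set ℝ} {u : ℝ → Lp ℝ ∞ μ}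
    {ψ : ℝ → TestFun L o} (hu : ContinuousOn u s) (hψ : ContinuousOn ψ s) :
    ContinuousOn (fun t => ofLinfty (u t) (ψ t)) s := by
  intro t ht
  have h1 : Tendsto (fun r => ofLinfty (u r - u t) (ψ r)) (𝓝[s] t) (𝓝 0) := by
    have h2 : Tendsto (fun r => ‖u r - u t‖ * h.l1 (ψ r)) (𝓝[s] t) (𝓝 0) := by
      have h3 := tendsto_iff_norm_sub_tendsto_zero.1 (hu t ht)
      have h4 := (h.continuous_l1.tendsto (ψ t)).comp (hψ t ht)
      simpa using h3.mul h4
    exact squeeze_zero_norm (fun r => h.abs_ofLinfty_le _ _) h2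
  have h2 : Tendsto (fun r => ofLinfty (u t) (ψ r)) (𝓝[s] t) (𝓝 (ofLinfty (u t) (ψ t))) :=
    ((h.linftyDistribution o (u t)).continuous.tendsto (ψ t)).comp (hψ t ht)
  have h3 := h1.add h2
  rw [zero_add] at h3
  refine h3.congr fun r => ?_
  rw [← h.ofLinfty_add, sub_add_cancel]

/-- The integrand of the paraproduct for given bounded products `u = Q_t f · P_t g` and
`v = (tL) P_t f · P_t g`. -/
def paraIntegrand (T : ℝ → Lp ℝ 2 μ →L[ℝ] Lp ℝ 2 μ) (b : ℕ) (u v : ℝ → Lp ℝ ∞ μ)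
    (φ : TestFun L o) (t : ℝ) : ℝ :=
  (ofLinfty (u t) (testSum T 1 b t φ) + ofLinfty (v t) (testQ T (b - 1) t φ)) / t

/-- The size in `L¹` of the test functions against which the products are paired. -/
def HeatSetting.paraSize (h : HeatSetting L T) (b : ℕ) (t : ℝ) (φ : TestFun L o) : ℝ :=
  h.l1 (testSum T 1 b t φ) + h.l1 (testQ T (b - 1) t φ)

/-- Both test-side operators are combinations of `Q_t^{(k+1)}` with `k ≥ 0`: the first carries an
extra `tL`, and `b - 1 ≥ 1`. The predicate `P` lets one reduction serve the two estimates below. -/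
theorem HeatSetting.exists_paraSize_le (h : HeatSetting L T) {b : ℕ} (hb : 2 ≤ b)
    (P : ℝ → TestFun L o → ℝ → Prop)
    (hP : ∀ k : ℕ, ∃ S : ℝ≥0, ∀ t ψ w, P t ψ w → h.l1 (testQ T (k + 1) t ψ) ≤ S * w) :
    ∃ S : ℝ≥0, ∀ t ψ w, P t ψ w → h.paraSize b t ψ ≤ S * w := by
  choose S hS using hP
  refine ⟨∑ i ∈ Finset.range b, (i.factorial : ℝ≥0)⁻¹ * S i + S (b - 2), fun t ψ w hw => ?_⟩
  unfold HeatSetting.paraSize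
  push_cast
  rw [add_mul, Finset.sum_mul]
  refine add_le_add ?_ ?_
  · refine (Finset.le_sum_of_subadditive h.l1 (map_zero h.l1).le (map_add_le_add _) _ _).trans
      (Finset.sum_le_sum fun i _ => ?_)
    rw [map_smul_eq_mul, Real.norm_of_nonneg (by positivity), mul_assoc, add_comm 1 i]
    gcongr
    exact hS i t ψ w hw
  · have e : b - 1 = (b - 2) + 1 := by omega
    rw [e]
    exact hS _ t ψ w hw

/-- One `tL` is spent on `φ`; the factor `t` gained cancels `dt/t`, leaving `t^{γ/2}`, integrable at
`0`. -/
theorem HeatSetting.exists_paraSize_le_lap (h : HeatSetting L T) (o : M) {b : ℕ} (hb : 2 ≤ b) :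
    ∃ S : ℝ≥0, ∀ t ∈ Ioc (0 : ℝ) 1, ∀ φ : TestFun L o,
      h.paraSize b t φ ≤ S * (t * h.l1 φ.lap) := by
  obtain ⟨S, hS⟩ := h.exists_paraSize_le (o := o) hb
    (fun t ψ w => t ∈ Ioc (0 : ℝ) 1 ∧ w = t * h.l1 ψ.lap) (fun k => by
      obtain ⟨S, hS⟩ := h.exists_l1_testQ_le o k
      refine ⟨S, ?_⟩
      rintro t ψ w ⟨ht, rfl⟩
      have ht2 : t ∈ Ioc (0 : ℝ) 2 := ⟨ht.1, ht.2.trans (by norm_num)⟩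
      have e : testQ T (k + 1) t ψ = t • testQ T k t ψ.lap := by
        rw [h.testQ_eq (k + 1) ht2, h.testQ_eq k ht2, smul_smul, Function.iterate_succ_apply,
          pow_succ']
      rw [e, map_smul_eq_mul, Real.norm_of_nonneg ht.1.le, mul_left_comm]
      exact mul_le_mul_of_nonneg_left (hS t ht2 _) ht.1.le)
  exact ⟨S, fun t ht φ => hS t φ _ ⟨ht, rfl⟩⟩

/-- Almost orthogonality. The composition coefficient `t^{k+1} s^a (t+s)^{-k-1-a}` is at most `t/s`,
and at most `s/t` once `a ≥ 1`. -/
theorem HeatSetting.exists_paraSize_testQ_le (h : HeatSetting L T) (o : M) {b : ℕ} (hb : 2 ≤ b)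
    (a : ℕ) : ∃ S : ℝ≥0, ∀ t ∈ Ioc (0 : ℝ) 1, ∀ s ∈ Ioc (0 : ℝ) 1, ∀ φ : TestFun L o,
      h.paraSize b t (testQ T a s φ) ≤ S * (t / s * h.l1 φ) ∧
      (1 ≤ a → h.paraSize b t (testQ T a s φ) ≤ S * (s / t * h.l1 φ)) := by
  have key : ∀ k : ℕ, ∃ S : ℝ≥0, ∀ (t : ℝ) (ψ : TestFun L o) (w : ℝ),
      (∃ s ∈ Ioc (0 : ℝ) 1, ∃ φ : TestFun L o, t ∈ Ioc (0 : ℝ) 1 ∧ ψ = testQ T a s φ ∧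
        (w = t / s * h.l1 φ ∨ (1 ≤ a ∧ w = s / t * h.l1 φ))) →
      h.l1 (testQ T (k + 1) t ψ) ≤ S * w := by
    intro k
    obtain ⟨S, hS⟩ := h.exists_l1_testQ_le o (k + 1 + a)
    refine ⟨S, ?_⟩
    rintro t ψ w ⟨s, hs, φ, ht, rfl, hw⟩
    have ht0 := ht.1
    have hs0 := hs.1
    have hst : t + s ≤ 2 := by linarith [ht.2, hs.2]
    rw [h.testQ_comp (k + 1) a ht0 hs0 hst, map_smul_eq_mul, Real.norm_of_nonneg (by positivity)]
    have h1 := hS (t + s) ⟨by positivity, hst⟩ φ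
    have hl : 0 ≤ h.l1 φ := apply_nonneg _ _
    have htp : ∀ n : ℕ, t ^ n ≤ (t + s) ^ n := fun n => pow_le_pow_left₀ ht0.le (by linarith) n
    have hsp : ∀ n : ℕ, s ^ n ≤ (t + s) ^ n := fun n => pow_le_pow_left₀ hs0.le (by linarith) n
    have hcoef : t ^ (k + 1) * s ^ a / (t + s) ^ (k + 1 + a) * h.l1 φ ≤ w := by
      rcases hw with rfl | ⟨ha, rfl⟩
      · refine mul_le_mul_of_nonneg_right ?_ hl
        rw [div_le_div_iff₀ (by positivity) hs0]
        calc t ^ (k + 1) * s ^ a * s = t * (t ^ k * s ^ (a + 1)) := by ring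
          _ ≤ t * ((t + s) ^ k * (t + s) ^ (a + 1)) := by
            gcongr <;> linarith
          _ = _ := by ring
      · refine mul_le_mul_of_nonneg_right ?_ hl
        rw [div_le_div_iff₀ (by positivity) ht0]
        obtain ⟨a, rfl⟩ : ∃ a', a = a' + 1 := ⟨a - 1, by omega⟩
        calc t ^ (k + 1) * s ^ (a + 1) * t = s * (t ^ (k + 2) * s ^ a) := by ring
          _ ≤ s * ((t + s) ^ (k + 2) * (t + s) ^ a) := by
            gcongr <;> linarith
          _ = _ := by ring
    calc _ ≤ t ^ (k + 1) * s ^ a / (t + s) ^ (k + 1 + a) * (S * h.l1 φ) := by gcongr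
      _ = S * (t ^ (k + 1) * s ^ a / (t + s) ^ (k + 1 + a) * h.l1 φ) := by ring
      _ ≤ _ := by gcongr
  obtain ⟨S, hS⟩ := h.exists_paraSize_le hb _ key
  exact ⟨S, fun t ht s hs φ => ⟨hS t _ _ ⟨s, hs, φ, ht, rfl, Or.inl rfl⟩,
    fun ha => hS t _ _ ⟨s, hs, φ, ht, rfl, Or.inr ⟨ha, rfl⟩⟩⟩⟩

theorem HeatSetting.abs_paraIntegrand_le (h : HeatSetting L T) {b : ℕ} {u v : ℝ → Lp ℝ ∞ μ}
    {K γ t : ℝ} (ht : t ∈ Ioc (0 : ℝ) 1) (hu : ‖u t‖ ≤ K * t ^ (γ / 2))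
    (hv : ‖v t‖ ≤ K * t ^ (γ / 2)) (φ : TestFun L o) {S w : ℝ} (hS : h.paraSize b t φ ≤ S * w) :
    |paraIntegrand T b u v φ t| ≤ K * S * (t ^ (γ / 2 - 1) * w) := by
  have ht0 := ht.1
  have hK : 0 ≤ K * t ^ (γ / 2) := (norm_nonneg _).trans hu
  unfold paraIntegrand
  rw [abs_div, abs_of_pos ht0, div_le_iff₀ ht0]
  have h1 : |ofLinfty (u t) (testSum T 1 b t φ)| ≤ K * t ^ (γ / 2) * h.l1 (testSum T 1 b t φ) :=
    (h.abs_ofLinfty_le _ _).trans (mul_le_mul_of_nonneg_right hu (apply_nonneg _ _))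
  have h2 : |ofLinfty (v t) (testQ T (b - 1) t φ)| ≤
      K * t ^ (γ / 2) * h.l1 (testQ T (b - 1) t φ) :=
    (h.abs_ofLinfty_le _ _).trans (mul_le_mul_of_nonneg_right hv (apply_nonneg _ _))
  calc _ ≤ K * t ^ (γ / 2) * h.paraSize b t φ := by
        refine (abs_add_le _ _).trans ((add_le_add h1 h2).trans (le_of_eq ?_))
        unfold HeatSetting.paraSize; ring
    _ ≤ K * t ^ (γ / 2) * (S * w) := by gcongr
    _ = _ := by rw [Real.rpow_sub_one ht0.ne']; field_simp

theorem HeatSetting.continuousOn_paraIntegrand (h : HeatSetting L T) {b : ℕ}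
    {u v : ℝ → Lp ℝ ∞ μ} (hu : ContinuousOn u (Ioc 0 1)) (hv : ContinuousOn v (Ioc 0 1))
    (φ : TestFun L o) : ContinuousOn (paraIntegrand T b u v φ) (Ioc 0 1) := by
  have hsub : Ioc (0 : ℝ) 1 ⊆ Ioc 0 2 := Ioc_subset_Ioc_right (by norm_num)
  exact ((h.continuousOn_pairing hu ((h.continuousOn_testSum 1 b φ).mono hsub)).add
    (h.continuousOn_pairing hv ((h.continuousOn_testQ' (b - 1) φ).mono hsub))).div
    continuousOn_id fun t ht => ht.1.ne'

/-- Bound for `∫₀¹ t^{γ/2} min(t/s, s/t) dt/t`, for an integrand dominated by it. -/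
theorem abs_integral_le_of_min_bound {F : ℝ → ℝ} {γ s K : ℝ} (hγ : γ ∈ Ioo (-2 : ℝ) 2)
    (hs : s ∈ Ioc (0 : ℝ) 1) (hK : 0 ≤ K) (hF : IntegrableOn F (Ioc 0 1))
    (h1 : ∀ t ∈ Ioc (0 : ℝ) 1, |F t| ≤ K * (t ^ (γ / 2 - 1) * (t / s)))
    (h2 : ∀ t ∈ Ioc (0 : ℝ) 1, |F t| ≤ K * (t ^ (γ / 2 - 1) * (s / t))) :
    |∫ t in Ioc (0 : ℝ) 1, F t| ≤ K * ((γ / 2 + 1)⁻¹ + (1 - γ / 2)⁻¹) * s ^ (γ / 2) := by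
  have hs0 := hs.1
  -- `γ > -2` makes `t^{γ/2}` integrable on `(0, s)`; `γ < 2` makes the integral of `t^{γ/2-2}` over
  -- `(s, 1)` comparable to its lower end.
  have g1 : 0 < γ / 2 + 1 := by linarith [hγ.1]
  have g2 : 0 < 1 - γ / 2 := by linarith [hγ.2]
  rw [← intervalIntegral.integral_of_le zero_le_one]
  have hi : ∀ a b : ℝ, 0 ≤ a → a ≤ b → b ≤ 1 → IntervalIntegrable F volume a b :=
    fun a b ha hab hb => (intervalIntegrable_iff_integrableOn_Ioc_of_le hab).2
      (hF.mono_set (Ioc_subset_Ioc ha hb))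
  rw [← intervalIntegral.integral_add_adjacent_intervals (hi 0 s le_rfl hs0.le hs.2)
    (hi s 1 hs0.le hs.2 le_rfl)]
  have n0 : (0 : ℝ) ∉ uIcc s 1 := by
    rw [uIcc_of_le hs.2]; exact fun hx => absurd hx.1 (not_le.2 hs0)
  have b1 : |∫ t in (0 : ℝ)..s, F t| ≤ K * (γ / 2 + 1)⁻¹ * s ^ (γ / 2) := by
    have := intervalIntegral.norm_integral_le_of_norm_le (f := F)
      (g := fun t => K * s⁻¹ * t ^ (γ / 2)) (μ := volume) hs0.le
      (Eventually.of_forall fun t ht => by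
        refine (h1 t ⟨ht.1, ht.2.trans hs.2⟩).trans (le_of_eq ?_)
        rw [Real.rpow_sub_one ht.1.ne']
        have := ht.1
        field_simp)
      ((intervalIntegral.intervalIntegrable_rpow' (by linarith)).const_mul _)
    refine this.trans (le_of_eq ?_)
    rw [intervalIntegral.integral_const_mul, integral_rpow (Or.inl (by linarith)),
      Real.zero_rpow g1.ne', Real.rpow_add_one hs0.ne']
    field_simp
    ring
  have b2 : |∫ t in s..1, F t| ≤ K * (1 - γ / 2)⁻¹ * s ^ (γ / 2) := by
    have := intervalIntegral.norm_integral_le_of_norm_le (f := F)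
      (g := fun t => K * s * t ^ (γ / 2 - 2)) (μ := volume) hs.2
      (Eventually.of_forall fun t ht => by
        have ht0 : 0 < t := hs0.trans ht.1
        refine (h2 t ⟨ht0, ht.2⟩).trans (le_of_eq ?_)
        rw [show γ / 2 - 2 = γ / 2 - 1 - 1 by ring, Real.rpow_sub_one ht0.ne' (γ / 2 - 1)]
        field_simp)
      ((intervalIntegral.intervalIntegrable_rpow (Or.inr n0)).const_mul _)
    refine this.trans ?_
    rw [intervalIntegral.integral_const_mul,
      integral_rpow (Or.inr ⟨by linarith, n0⟩), Real.one_rpow]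
    have e : γ / 2 - 2 + 1 = -(1 - γ / 2) := by ring
    rw [e, div_neg, ← neg_div, neg_sub, neg_sub]
    have e2 : s ^ (γ / 2 - 1) = s ^ (γ / 2) * s⁻¹ := by
      rw [Real.rpow_sub_one hs0.ne']; rfl
    rw [e2]
    calc K * s * ((s ^ (γ / 2) * s⁻¹ - 1) / (1 - γ / 2))
        ≤ K * s * ((s ^ (γ / 2) * s⁻¹) / (1 - γ / 2)) := by gcongr; linarith
      _ = _ := by field_simp
  calc _ ≤ _ := abs_add_le _ _
    _ ≤ _ := add_le_add b1 b2
    _ = _ := by ring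

/-- Convergence and Hölder bound of the paraproduct integral. -/
theorem HeatSetting.exists_integral (h : HeatSetting L T) (o : M) {a b : ℕ} (ha : 1 ≤ a)
    (hb : 2 ≤ b) {γ : ℝ} (hγ : γ ∈ Ioo (-2 : ℝ) 1) :
    ∃ C : ℝ≥0, ∀ (u v : ℝ → Lp ℝ ∞ μ) (K : ℝ), 0 ≤ K → ContinuousOn u (Ioc 0 1) →
      ContinuousOn v (Ioc 0 1) → (∀ t ∈ Ioc (0 : ℝ) 1, ‖u t‖ ≤ K * t ^ (γ / 2)) →
      (∀ t ∈ Ioc (0 : ℝ) 1, ‖v t‖ ≤ K * t ^ (γ / 2)) →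
      ∃ Pi : Distribution L o, (∀ φ, IntegrableOn (paraIntegrand T b u v φ) (Ioc 0 1) ∧
        Pi φ = (Real.Gamma b)⁻¹ * ∫ t in Ioc (0 : ℝ) 1, paraIntegrand T b u v φ t) ∧
        holderNorm T a γ Pi ≤ ENNReal.ofReal (C * K) := by
  obtain ⟨S1, hS1⟩ := h.exists_paraSize_le_lap o hb
  obtain ⟨S2, hS2⟩ := h.exists_paraSize_testQ_le o hb a
  obtain ⟨S3, hS3⟩ := h.exists_paraSize_testQ_le o hb 0
  have hg1 : 0 < γ / 2 + 1 := by linarith [hγ.1]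
  have hg2 : 0 < 1 - γ / 2 := by linarith [hγ.2]
  have hΓ : 0 < (Real.Gamma b)⁻¹ := inv_pos.2 (Real.Gamma_pos_of_pos (by positivity))
  set R0 : ℝ := (Real.Gamma b)⁻¹ * S3 * (γ / 2 + 1)⁻¹ with hR0
  set R1 : ℝ := (Real.Gamma b)⁻¹ * S2 * ((γ / 2 + 1)⁻¹ + (1 - γ / 2)⁻¹) with hR1
  have hR0' : 0 ≤ R0 := by positivity
  have hR1' : 0 ≤ R1 := by positivity
  refine ⟨R0.toNNReal + R1.toNNReal, fun u v K hK huc hvc hu hv => ?_⟩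
  have hrpow : IntegrableOn (fun t : ℝ => t ^ (γ / 2)) (Ioc 0 1) :=
    (intervalIntegrable_iff_integrableOn_Ioc_of_le zero_le_one).1
      (intervalIntegral.intervalIntegrable_rpow' (by linarith))
  have hrint : ∫ t in Ioc (0 : ℝ) 1, t ^ (γ / 2) = (γ / 2 + 1)⁻¹ := by
    rw [← intervalIntegral.integral_of_le zero_le_one, integral_rpow (Or.inl (by linarith)),
      Real.zero_rpow hg1.ne']
    simp
  -- an integrand of size `t^{γ/2}` is integrable
  have hdom : ∀ (φ : TestFun L o) (B : ℝ),
      (∀ t ∈ Ioc (0 : ℝ) 1, |paraIntegrand T b u v φ t| ≤ B * t ^ (γ / 2)) →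
      IntegrableOn (paraIntegrand T b u v φ) (Ioc 0 1) ∧
      |∫ t in Ioc (0 : ℝ) 1, paraIntegrand T b u v φ t| ≤ B * (γ / 2 + 1)⁻¹ := by
    intro φ B hB
    have hae : ∀ᵐ t ∂(volume.restrict (Ioc (0 : ℝ) 1)),
        ‖paraIntegrand T b u v φ t‖ ≤ B * t ^ (γ / 2) :=
      (ae_restrict_mem measurableSet_Ioc).mono fun t ht => hB t ht
    refine ⟨(hrpow.const_mul B).mono'
      ((h.continuousOn_paraIntegrand huc hvc φ).aestronglyMeasurable measurableSet_Ioc) hae, ?_⟩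
    have := norm_integral_le_of_norm_le (hrpow.const_mul B) hae
    rwa [integral_const_mul, hrint] at this
  have hbound : ∀ (φ : TestFun L o), ∀ t ∈ Ioc (0 : ℝ) 1,
      |paraIntegrand T b u v φ t| ≤ K * S1 * h.l1 φ.lap * t ^ (γ / 2) := by
    intro φ t ht
    refine (h.abs_paraIntegrand_le ht (hu t ht) (hv t ht) φ (hS1 t ht φ)).trans (le_of_eq ?_)
    rw [Real.rpow_sub_one ht.1.ne']
    have := ht.1
    field_simp
  have hint : ∀ φ : TestFun L o, IntegrableOn (paraIntegrand T b u v φ) (Ioc 0 1) :=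
    fun φ => (hdom φ _ (hbound φ)).1
  let Λ : TestFun L o →ₗ[ℝ] ℝ :=
    { toFun := fun φ => (Real.Gamma b)⁻¹ * ∫ t in Ioc (0 : ℝ) 1, paraIntegrand T b u v φ t
      map_add' := fun φ ψ => by
        rw [← mul_add, ← integral_add (hint φ) (hint ψ)]
        congr 1
        refine setIntegral_congr_fun measurableSet_Ioc fun t ht => ?_
        have ht2 : t ∈ Ioc (0 : ℝ) 2 := ⟨ht.1, ht.2.trans (by norm_num)⟩
        have e : ∀ (g : Lp ℝ ∞ μ) (φ ψ : TestFun L o),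
            ofLinfty g (φ + ψ) = ofLinfty g φ + ofLinfty g ψ := fun g φ ψ =>
          (h.linftyLinear o g).map_add φ ψ
        simp only [paraIntegrand]
        rw [h.testSum_add 1 b ht2, h.testQ_add (b - 1) ht2, e, e]
        ring
      map_smul' := fun r φ => by
        rw [RingHom.id_apply, smul_eq_mul, mul_left_comm, ← integral_const_mul r]
        congr 1
        refine setIntegral_congr_fun measurableSet_Ioc fun t ht => ?_
        have ht2 : t ∈ Ioc (0 : ℝ) 2 := ⟨ht.1, ht.2.trans (by norm_num)⟩
        have e : ∀ (g : Lp ℝ ∞ μ) (φ : TestFun L o), ofLinfty g (r • φ) = r * ofLinfty g φ :=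
          fun g φ => (h.linftyLinear o g).map_smul r φ
        simp only [paraIntegrand]
        rw [h.testSum_smul 1 b ht2, h.testQ_smul (b - 1) ht2, e, e]
        ring }
  have hΛ : ∀ φ, Λ φ = (Real.Gamma b)⁻¹ * ∫ t in Ioc (0 : ℝ) 1, paraIntegrand T b u v φ t :=
    fun _ => rfl
  have hΛabs : ∀ φ, |Λ φ| = (Real.Gamma b)⁻¹ *
      |∫ t in Ioc (0 : ℝ) 1, paraIntegrand T b u v φ t| := fun φ => by
    rw [hΛ, abs_mul, abs_of_pos hΓ]
  have hΛc : Continuous Λ := by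
    obtain ⟨m, C, hC⟩ := h.exists_l1_le o
    -- The second index is `1` because the integrand is controlled by the `L¹` norm of `Lφ`.
    refine continuous_of_testSeminorm_le Λ (m, 1)
      (((Real.Gamma b)⁻¹ * (K * S1 * C * (γ / 2 + 1)⁻¹)).toNNReal) fun φ => ?_
    rw [Real.coe_toNNReal _ (by positivity), hΛabs, mul_assoc]
    refine mul_le_mul_of_nonneg_left ((hdom φ _ (hbound φ)).2.trans ?_) hΓ.le
    have : h.l1 φ.lap ≤ C * testSeminorm L o (m, 1) φ := hC φ.lap
    calc K * S1 * h.l1 φ.lap * (γ / 2 + 1)⁻¹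
        ≤ K * S1 * (C * testSeminorm L o (m, 1) φ) * (γ / 2 + 1)⁻¹ := by gcongr
      _ = _ := by ring
  let Pi : Distribution L o := ⟨Λ, hΛc⟩
  refine ⟨Pi, fun φ => ⟨hint φ, rfl⟩, ?_⟩
  have hone : (1 : ℝ) ∈ Ioc (0 : ℝ) 1 := by norm_num
  -- `e^{-L}` is `Q_1^{(0)}`: the bound `t/s` with `a = 0` and `s = 1` is enough.
  have n0 : linftyNorm (act (T 1) Pi) ≤ ENNReal.ofReal (R0 * K) := by
    have hle : ∀ φ : TestFun L o, |h.evalQ Λ 0 (t := 1) (by norm_num) φ| ≤ R0 * K * h.l1 φ := by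
      intro φ
      change |Λ (testQ T 0 1 φ)| ≤ _
      rw [hΛabs]
      have := (hdom (testQ T 0 1 φ) (K * S3 * h.l1 φ) fun t ht => by
        refine (h.abs_paraIntegrand_le ht (hu t ht) (hv t ht) _ (hS3 t ht 1 hone φ).1).trans
          (le_of_eq ?_)
        rw [Real.rpow_sub_one ht.1.ne']
        have := ht.1
        field_simp).2
      calc _ ≤ (Real.Gamma b)⁻¹ * (K * S3 * h.l1 φ * (γ / 2 + 1)⁻¹) := by gcongr
        _ = _ := by rw [hR0]; ring
    have := h.linftyNorm_le _ (by positivity) hle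
    refine le_trans (le_of_eq ?_) this
    congr 1
    funext φ
    change Λ (mapTest (T 1) φ) = Λ (testQ T 0 1 φ)
    rw [testQ, opQ_zero]
  -- Here both almost-orthogonality bounds are needed, one on each side of `t = s`.
  have n1 : ∀ s ∈ Ioc (0 : ℝ) 1, linftyNorm (act (opQ L T a s) Pi) ≤
      ENNReal.ofReal (R1 * K * s ^ (γ / 2)) := by
    intro s hs
    have hs0 := hs.1
    have hle : ∀ φ : TestFun L o, |h.evalQ Λ a (t := s) ⟨hs.1, hs.2.trans (by norm_num)⟩ φ| ≤
        R1 * K * s ^ (γ / 2) * h.l1 φ := by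
      intro φ
      change |Λ (testQ T a s φ)| ≤ _
      rw [hΛabs]
      have := abs_integral_le_of_min_bound (F := paraIntegrand T b u v (testQ T a s φ))
        (γ := γ) (s := s) (K := K * S2 * h.l1 φ) ⟨hγ.1, hγ.2.trans (by norm_num)⟩ hs
        (by positivity) (hint _)
        (fun t ht => (h.abs_paraIntegrand_le ht (hu t ht) (hv t ht) _
          (hS2 t ht s hs φ).1).trans (le_of_eq (by ring)))
        (fun t ht => (h.abs_paraIntegrand_le ht (hu t ht) (hv t ht) _
          ((hS2 t ht s hs φ).2 ha)).trans (le_of_eq (by ring)))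
      calc _ ≤ (Real.Gamma b)⁻¹ *
            (K * S2 * h.l1 φ * ((γ / 2 + 1)⁻¹ + (1 - γ / 2)⁻¹) * s ^ (γ / 2)) := by gcongr
        _ = _ := by rw [hR1]; ring
    exact h.linftyNorm_le _ (by positivity) hle
  have e : (((R0.toNNReal + R1.toNNReal : ℝ≥0) : ℝ) * K) = R0 * K + R1 * K := by
    push_cast
    rw [Real.coe_toNNReal _ hR0', Real.coe_toNNReal _ hR1', add_mul]
  rw [e, ENNReal.ofReal_add (by positivity) (by positivity)]
  refine add_le_add n0 (iSup₂_le fun s hs => ?_)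
  have hs0 := hs.1
  calc _ ≤ ENNReal.ofReal (R1 * K * s ^ (γ / 2)) * ENNReal.ofReal (s ^ (-γ / 2)) := by
        gcongr; exact n1 s hs
    _ = ENNReal.ofReal (R1 * K) := by
        rw [← ENNReal.ofReal_mul (by positivity), mul_assoc, ← Real.rpow_add hs0,
          show γ / 2 + -γ / 2 = 0 by ring, Real.rpow_zero, mul_one]

/-- The paraproduct of two distributions whose heat flows decay. -/
theorem HeatSetting.exists_paraproduct
    (hfin : ∀ n : ℕ, μ (Metric.ball o n) < ∞) (h : HeatSetting L T) {a b : ℕ} (ha : 1 ≤ a)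
    (hb : 2 ≤ b) {α β : ℝ} (hα : α ≤ 2) (hβ : β ≤ 2) (hγ : α + β ∈ Ioo (-2 : ℝ) 1)
    (A B : ℕ → ℝ≥0) :
    ∃ C : ℝ≥0, ∀ (f g : Distribution L o) (N N' : ℝ), 0 ≤ N → 0 ≤ N' →
      (∀ k, 1 ≤ k → ∀ t ∈ Ioc (0 : ℝ) 1, ∀ φ,
        |f (testQ T k t φ)| ≤ A k * N * t ^ (α / 2) * h.l1 φ) →
      (∀ k, ∀ t ∈ Ioc (0 : ℝ) 1, ∀ φ,
        |g (testQ T k t φ)| ≤ B k * N' * t ^ (β / 2) * h.l1 φ) →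
      ∃ Pi : Distribution L o, HasParaproduct T b g f Pi ∧
        holderNorm T a (α + β) Pi ≤ ENNReal.ofReal (C * N' * N) := by
  obtain ⟨C, hC⟩ := h.exists_integral o ha hb hγ
  set CA : ℝ := ∑ i ∈ Finset.range b, (i.factorial : ℝ)⁻¹ * A (1 + i) with hCA
  set CB : ℝ := ∑ i ∈ Finset.range b, (i.factorial : ℝ)⁻¹ * B (0 + i) with hCB
  have hCA0 : 0 ≤ CA := Finset.sum_nonneg fun i _ => by positivity
  have hCB0 : 0 ≤ CB := Finset.sum_nonneg fun i _ => by positivity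
  -- The sum `A (b - 1) + CA` bounds both factors coming from `f`, so one constant `K` serves both
  -- products.
  refine ⟨C * ((A (b - 1) + CA.toNNReal) * CB.toNNReal), fun f g N N' hN hN' hf hg => ?_⟩
  obtain ⟨qf, hqf1, hqf2⟩ := h.exists_continuousOn_rep hfin f (b - 1) (A := A (b - 1) * N)
    (A' := A (b - 1 + 1) * N) (by positivity) (by positivity)
    (by have : (0 : ℝ) ≤ ((b - 1 : ℕ) : ℝ) := by positivity
        linarith) (hf (b - 1) (by omega)) (hf (b - 1 + 1) (by omega))
  obtain ⟨lf, hlf1, hlf2⟩ := h.exists_continuousOn_rep_sum hfin f 1 b A hN (by linarith) hf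
  obtain ⟨pg, hpg1, hpg2⟩ := h.exists_continuousOn_rep_sum hfin g 0 b B hN' (by linarith)
    fun k _ => hg k
  -- Multiplication as a continuous bilinear map on `L^∞`: the products inherit continuity in `t`.
  set mul := (ContinuousLinearMap.mul ℝ ℝ).holderL μ ∞ ∞ ∞ with hmul
  have hmulae : ∀ u v : Lp ℝ ∞ μ, ∀ᵐ x ∂μ, mul u v x = u x * v x := fun u v =>
    (ContinuousLinearMap.mul ℝ ℝ).coeFn_holder u v
  have hmuln : ∀ u v : Lp ℝ ∞ μ, ‖mul u v‖ ≤ ‖u‖ * ‖v‖ := fun u v => by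
    refine ((ContinuousLinearMap.mul ℝ ℝ).norm_holder_apply_apply_le u v).trans ?_
    have := ContinuousLinearMap.opNorm_mul_le ℝ ℝ
    calc _ ≤ 1 * ‖u‖ * ‖v‖ := by gcongr
      _ = _ := by rw [one_mul]
  have hmulc : ∀ u v : ℝ → Lp ℝ ∞ μ, ContinuousOn u (Ioc 0 1) → ContinuousOn v (Ioc 0 1) →
      ContinuousOn (fun t => mul (u t) (v t)) (Ioc 0 1) := fun u v hu hv =>
    (mul.continuous.comp_continuousOn hu).clm_apply hv
  set K : ℝ := (A (b - 1) + CA) * CB * N' * N with hK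
  have hbd : ∀ (u : ℝ → Lp ℝ ∞ μ) (E : ℝ), 0 ≤ E → E ≤ A (b - 1) + CA →
      ∀ t ∈ Ioc (0 : ℝ) 1, ‖u t‖ ≤ E * N * t ^ (α / 2) →
      ‖mul (u t) (pg t)‖ ≤ K * t ^ ((α + β) / 2) := by
    intro u E hE0 hE t ht hu
    have ht0 := ht.1
    calc _ ≤ ‖u t‖ * ‖pg t‖ := hmuln _ _
      _ ≤ ((A (b - 1) + CA) * N * t ^ (α / 2)) * (CB * N' * t ^ (β / 2)) := by
        have := (hpg2 t ht).1
        gcongr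
        exact hu.trans (by gcongr)
      _ = _ := by
        rw [hK, add_div, Real.rpow_add ht0]; ring
  obtain ⟨Pi, hPi1, hPi2⟩ := hC (fun t => mul (qf t) (pg t)) (fun t => mul (lf t) (pg t)) K
    (by positivity) (hmulc _ _ hqf1 hpg1) (hmulc _ _ hlf1 hpg1)
    (fun t ht => hbd qf (A (b - 1)) (by positivity) (by linarith) t ht (hqf2 t ht).1)
    (fun t ht => hbd lf CA hCA0 (by linarith [(A (b - 1)).2]) t ht (hlf2 t ht).1)
  have h12 : ∀ {t : ℝ}, t ∈ Ioc (0 : ℝ) 1 → t ∈ Ioc (0 : ℝ) 2 := fun ht =>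
    ⟨ht.1, ht.2.trans (by norm_num)⟩
  have hcongr : ∀ φ : TestFun L o, ∀ t ∈ Ioc (0 : ℝ) 1,
      paraIntegrand T b (fun t => mul (qf t) (pg t)) (fun t => mul (lf t) (pg t)) φ t =
      ((∫ x, (qf t x * pg t x) * opLP L T b t φ.toL2 x ∂μ) +
        ∫ x, (lf t x * pg t x) * opQ L T (b - 1) t φ.toL2 x ∂μ) / t := by
    intro φ t ht
    unfold paraIntegrand ofLinfty
    rw [h.opLP_eq b (h12 ht), ← h.toL2_testQ (b - 1) (h12 ht)]
    congr 2
    · refine integral_congr_ae ?_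
      filter_upwards [hmulae (qf t) (pg t)] with x hx
      rw [hx]
    · refine integral_congr_ae ?_
      filter_upwards [hmulae (lf t) (pg t)] with x hx
      rw [hx]
  refine ⟨Pi, ⟨qf, lf, pg, fun t ht => ⟨?_, ?_, ?_⟩, fun φ => ⟨?_, ?_⟩⟩, ?_⟩
  · funext φ
    exact (hqf2 t ht).2 φ
  · funext φ
    rw [act, h.mapTest_opLP b (h12 ht)]
    exact (hlf2 t ht).2 φ
  · funext φ
    rw [act, h.mapTest_opP b (h12 ht)]
    exact (hpg2 t ht).2 φ
  · exact (hPi1 φ).1.congr_fun (hcongr φ) measurableSet_Ioc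
  · rw [(hPi1 φ).2, setIntegral_congr_fun measurableSet_Ioc (hcongr φ)]
  · refine hPi2.trans (le_of_eq ?_)
    congr 1
    rw [hK]
    push_cast
    rw [Real.coe_toNNReal _ hCA0, Real.coe_toNNReal _ hCB0]
    ring

end Paraproduct

end

end SemigroupPara

/-! ### Conclusion: bounded `g` and `g` of negative regularity -/

open SemigroupPara in
theorem proposition3p2 {M : Type*} [MetricSpace M] [LocallyCompactSpace M]
    [TopologicalSpace.SeparableSpace M] [MeasurableSpace M] [BorelSpace M]
    (μ : Measure M) [μ.Regular] [μ.IsOpenPosMeasure] (hμ : VolumeDoubling μ)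
    (L : Lp ℝ 2 μ →ₗ.[ℝ] Lp ℝ 2 μ) (hL : IsNonnegSelfAdjoint L)
    (T : ℝ → Lp ℝ 2 μ →L[ℝ] Lp ℝ 2 μ) (hT : IsHeatSemigroup L T)
    (p : ℝ → M → M → ℝ) (hp : IsHeatKernel L T p) (hUE : GaussianUpperBound μ p)
    (o : M) (a : ℕ) (ha : 1 ≤ a) (b : ℕ) (hb : 2 ≤ b) (α : ℝ) (hα : α ∈ Ioo (-2 : ℝ) 1) :
    (∃ C : ℝ≥0, ∀ f : Distribution L o, holderNorm T a α f < ∞ →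
      ∀ g : Lp ℝ ∞ μ, ∃ Pi : Distribution L o,
        HasParaproduct T b (ofLinfty g) f Pi ∧
        holderNorm T a α Pi ≤ C * ‖g‖ₑ * holderNorm T a α f) ∧
    (∀ β : ℝ, β < 0 → α + β ∈ Ioo (-2 : ℝ) 1 →
      ∃ C : ℝ≥0, ∀ f : Distribution L o, holderNorm T a α f < ∞ →
        ∀ g : Distribution L o, holderNorm T a β g < ∞ → ∃ Pi : Distribution L o,
          HasParaproduct T b g f Pi ∧
          holderNorm T a (α + β) Pi ≤ C * holderNorm T a β g * holderNorm T a α f) := by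
  have : SecondCountableTopology M := UniformSpace.secondCountable_of_separable M
  obtain ⟨D, hD⟩ := hμ.exists_isDoublingWith
  have h : HeatSetting L T := heatSetting o hD hL hT hp hUE
  have hfin : ∀ n : ℕ, μ (Metric.ball o n) < ∞ := fun n => hD.finite o n
  have hsub : Ioc (0 : ℝ) 1 ⊆ Ioc 0 2 := Ioc_subset_Ioc_right (by norm_num)
  have hA : ∀ k : ℕ, ∃ C : ℝ≥0, 1 ≤ k → ∀ f : Distribution L o, holderNorm T a α f < ∞ →
      ∀ t ∈ Ioc (0 : ℝ) 1, ∀ φ, |f (testQ T k t φ)| ≤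
        C * (holderNorm T a α f).toReal * t ^ (α / 2) * h.l1 φ := by
    intro k
    by_cases hk : 1 ≤ k
    · have hk' : (1 : ℝ) ≤ k := by exact_mod_cast hk
      obtain ⟨C, hC⟩ := h.exists_decay o a α k (by linarith [hα.2])
      refine ⟨C, fun _ f hf t ht => ?_⟩
      obtain ⟨h1, h2⟩ := h.bounds_of_holderNorm a α f hf
      exact hC f _ ENNReal.toReal_nonneg h1 h2 t (hsub ht)
    · exact ⟨0, fun h => absurd h hk⟩
  choose A hA using hA
  constructor
  -- A bounded `g` behaves as regularity `β = 0`: `L¹` boundedness of `Q_t^{(k)}` replaces decay.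
  · choose B hB using fun k => h.exists_l1_testQ_le o k
    obtain ⟨C, hC⟩ := h.exists_paraproduct hfin ha hb (α := α) (β := 0) (by linarith [hα.2])
      (by norm_num) (by simpa using hα) A B
    refine ⟨C, fun f hf g => ?_⟩
    obtain ⟨Pi, h1, h2⟩ := hC f (h.linftyDistribution o g) _ ‖g‖ ENNReal.toReal_nonneg
      (norm_nonneg g) (fun k hk => hA k hk f hf) (fun k t ht φ => by
        refine (h.abs_ofLinfty_le g _).trans ?_
        rw [zero_div, Real.rpow_zero, mul_one, mul_comm (B k : ℝ), mul_assoc]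
        gcongr
        exact hB k t (hsub ht) φ)
    refine ⟨Pi, h1, ?_⟩
    rw [add_zero] at h2
    refine h2.trans (le_of_eq ?_)
    rw [ENNReal.ofReal_mul (by positivity), ENNReal.ofReal_mul (by positivity),
      ENNReal.ofReal_toReal hf.ne, ofReal_norm, ENNReal.ofReal_coe_nnreal]
  · intro β hβ hαβ
    -- Since `β < 0`, order `k = 0` is included, as required by the term `e^{-tL}` of `P_t`.
    have hB : ∀ k : ℕ, ∃ C : ℝ≥0, ∀ g : Distribution L o, holderNorm T a β g < ∞ →
        ∀ t ∈ Ioc (0 : ℝ) 1, ∀ φ, |g (testQ T k t φ)| ≤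
          C * (holderNorm T a β g).toReal * t ^ (β / 2) * h.l1 φ := by
      intro k
      have hk' : (0 : ℝ) ≤ k := by positivity
      obtain ⟨C, hC⟩ := h.exists_decay o a β k (by linarith)
      refine ⟨C, fun g hg t ht => ?_⟩
      obtain ⟨h1, h2⟩ := h.bounds_of_holderNorm a β g hg
      exact hC g _ ENNReal.toReal_nonneg h1 h2 t (hsub ht)
    choose B hB using hB
    obtain ⟨C, hC⟩ := h.exists_paraproduct hfin ha hb (by linarith [hα.2]) (by linarith) hαβ A B
    refine ⟨C, fun f hf g hg => ?_⟩
    obtain ⟨Pi, h1, h2⟩ := hC f g _ _ ENNReal.toReal_nonneg ENNReal.toReal_nonneg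
      (fun k hk => hA k hk f hf) (fun k => hB k g hg)
    refine ⟨Pi, h1, h2.trans (le_of_eq ?_)⟩
    rw [ENNReal.ofReal_mul (by positivity), ENNReal.ofReal_mul (by positivity),
      ENNReal.ofReal_toReal hf.ne, ENNReal.ofReal_toReal hg.ne, ENNReal.ofReal_coe_nnreal]
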